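/- Let $D^2\subset\mathbb{R}^2=\mathbb{C}$ be the open unit disc and $\omega=dx_1\wedge dy_1+dx_2\wedge dy_2$ the standard symplectic form of $\mathbb{C}^2$. A map $\Phi\in W^{1,1}(D^2,\mathbb{C}^2)$ is *Lagrangian* if $\Phi^*\omega=0$ a.e., and *weakly conformal* if $\langle\partial_x\Phi,\partial_y\Phi\rangle=0$ and $|\partial_x\Phi|^2=|\partial_y\Phi|^2$ a.e. If $\Phi\in W^{1,2}$ is both, its *Lagrangian angle* is the measurable map $\bar g:D^2\to S^1$ with $\Phi^*(dz_1\wedge dz_2)=|\partial_x\Phi|^2\,\bar g\,dx\wedge dy$ a.e., and $\Phi$ is *Hamiltonian stationary* if $\operatorname{div}(i\bar g\nabla g)=0$ in the sense of distributions on $D^2$. For an integer $j\ge 1$, $\Phi$ has a *Schoen–Wolfson singularity of type $\Sigma_{j,j+1}$* at $q\in D^2$ if $g$ has an isolated singularity of degree $1$ at $q$ and, in a punctured disc around $q$, $$\Phi=U\sum_{m\ge1}a_m\begin{pmatrix}\sqrt{m+1}\,e^{\sqrt{m(m+1)}\,G}g^m\\ i\sqrt m\,e^{\sqrt{m(m+1)}\,G}g^{-m-1}\end{pmatrix}+\Phi_0,$$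 where $U$ is a unitary matrix, $\Phi_0\in\mathbb{C}^2$ is constant, $G$ is a real function with $-i\bar g\nabla g=\nabla^\perp G$ (with $\nabla^\perp=(-\partial_y,\partial_x)$), $a_m\in\mathbb{C}$, $\sum_m|a_m|^2<\infty$, $a_j\ne0$ and $a_k=0$ for all $k<j$. **Theorem.** For every $p<2$ and every integer $j\ge1$ there is a weakly conformal, Hamiltonian stationary, Lagrangian map $\Phi:D^2\to\mathbb{C}^2$ of class $C^{\sqrt{j^2+j}}(D^2)=C^{\lfloor s\rfloor,\,s-\lfloor s\rfloor}(D^2)$, $s=\sqrt{j^2+j}$, with Lagrangian angle $\bar g$, and a set $S\subset D^2$ such that: 1. $S$ is infinite, all its points are isolated, its only accumulation point in $\mathbb{C}$ is the boundary point $-1$, and $\Phi$ has a Schoen–Wolfson singularity of type $\Sigma_{j,j+1}$ at every point of $S$; 2. $\Phi$ extends continuously to $\overline{D^2}$, and its trace $\theta\mapsto\Phi(e^{i\theta})$ is $C^\infty$; 3. $g\in W^{1,p}(D^2)$, and $g\in W^{1,(2,\infty)}_{\mathrm{loc}}(D^2)$, i.e. $\nabla g\in L^{2,\infty}_{\mathrm{loc}}(D^2)$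 (weak $L^2$); 4. $\Phi$ is a smooth branched immersion away from $S$: it is $C^\infty$ on $D^2\setminus S$, the zeros of $d\Phi$ are isolated in $D^2$, and at each point of $D^2\setminus S$ either $\Phi$ is an immersion, or $d\Phi=0$ and the Lagrangian angle is continuous. -/

import Mathlib

open MeasureTheory Topology Filter Complex
open scoped ENNReal NNReal ContDiff ComplexConjugate Matrix

noncomputable section

namespace HamStat

/-- The target `ℂ²`, with its Euclidean norm. -/
abbrev C2 : Type := EuclideanSpace ℂ (Fin 2)

/-- The open unit disc `D²`, as a subset of `ℂ = ℝ²`. -/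
abbrev disc : Set ℂ := Metric.ball (0 : ℂ) 1

/-! ### Sobolev functions on the disc -/

/-- Real test functions `φ ∈ C_c^∞(D²)`. -/
structure IsTestFunction (φ : ℂ → ℝ) : Prop where
  smooth : ContDiff ℝ ∞ φ
  compact : HasCompactSupport φ
  support_subset : tsupport φ ⊆ disc

/-- `fx`, `fy` are the weak partial derivatives of `f` on the disc
(all three functions are locally integrable there). The directions `x` and `y` are `1` and `I`. -/
structure HasWeakGradient {E : Type*} [NormedAddCommGroup E] [NormedSpace ℝ E]
    (f fx fy : ℂ → E) : Prop where
  loc : LocallyIntegrableOn f disc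
  loc_x : LocallyIntegrableOn fx disc
  loc_y : LocallyIntegrableOn fy disc
  weak_x : ∀ φ : ℂ → ℝ, IsTestFunction φ →
    ∫ z in disc, fderiv ℝ φ z 1 • f z = -∫ z in disc, φ z • fx z
  weak_y : ∀ φ : ℂ → ℝ, IsTestFunction φ →
    ∫ z in disc, fderiv ℝ φ z I • f z = -∫ z in disc, φ z • fy z

/-- `f ∈ W^{1,p}(D²)`. -/
def MemW1 {E : Type*} [NormedAddCommGroup E] [NormedSpace ℝ E] (p : ℝ≥0∞) (f : ℂ → E) : Prop :=
  ∃ fx fy : ℂ → E, HasWeakGradient f fx fy ∧ MemLp f p (volume.restrict disc) ∧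
    MemLp fx p (volume.restrict disc) ∧ MemLp fy p (volume.restrict disc)

/-- The weak Lebesgue (Lorentz) space `L^{2,∞}(μ)`: `sup_t t² μ {‖f‖ > t} < ∞`. -/
def MemWeakL2 {E : Type*} [NormedAddCommGroup E] (f : ℂ → E) (μ : Measure ℂ) : Prop :=
  AEStronglyMeasurable f μ ∧ ∃ C : ℝ≥0, ∀ t : ℝ≥0, (t : ℝ≥0∞) ^ 2 * μ {z | t < ‖f z‖₊} ≤ C

/-- `f ∈ W^{1,(2,∞)}_loc(D²)`: the weak gradient is in `L^{2,∞}` on every compact subset. -/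
def MemW1WeakL2Loc {E : Type*} [NormedAddCommGroup E] [NormedSpace ℝ E] (f : ℂ → E) : Prop :=
  ∃ fx fy : ℂ → E, HasWeakGradient f fx fy ∧ ∀ K : Set ℂ, IsCompact K → K ⊆ disc →
    MemWeakL2 fx (volume.restrict K) ∧ MemWeakL2 fy (volume.restrict K)

/-- The Hölder class `C^s(D²) = C^{⌊s⌋, s - ⌊s⌋}(D²)`: derivatives up to order `⌊s⌋` exist, are
continuous and bounded on the disc, and those of order `⌊s⌋` are Hölder continuous on the disc
with exponent `s - ⌊s⌋`. -/
def MemHolder {E : Type*} [NormedAddCommGroup E] [NormedSpace ℝ E] (s : ℝ) (f : ℂ → E) : Prop :=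
  ContDiffOn ℝ (⌊s⌋₊ : ℕ) f disc ∧
  (∀ k : ℕ, k ≤ ⌊s⌋₊ → ∃ C : ℝ, ∀ z ∈ disc, ‖iteratedFDeriv ℝ k f z‖ ≤ C) ∧
  ∃ C : ℝ, ∀ z ∈ disc, ∀ w ∈ disc,
    ‖iteratedFDeriv ℝ ⌊s⌋₊ f z - iteratedFDeriv ℝ ⌊s⌋₊ f w‖ ≤ C * ‖z - w‖ ^ (s - ⌊s⌋₊)

/-! ### Lagrangian maps -/

/-- The Euclidean scalar product of `ℂ² = ℝ⁴`. -/
def realInner (a b : C2) : ℝ := ∑ i, (conj (a i) * b i).re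

/-- The symplectic form `ω = dx₁ ∧ dy₁ + dx₂ ∧ dy₂`. -/
def symplecticForm (a b : C2) : ℝ := ∑ i, ((a i).re * (b i).im - (a i).im * (b i).re)

/-- The holomorphic volume form `dz₁ ∧ dz₂`. -/
def holVolume (a b : C2) : ℂ := a 0 * b 1 - a 1 * b 0

/-- `Φ ∈ W^{1,1}(D², ℂ²)` is Lagrangian: `Φ^* ω = 0` a.e. -/
def IsLagrangian (Φ : ℂ → C2) : Prop :=
  MemW1 1 Φ ∧ ∃ Φx Φy : ℂ → C2, HasWeakGradient Φ Φx Φy ∧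
    ∀ᵐ z ∂(volume.restrict disc), symplecticForm (Φx z) (Φy z) = 0

/-- `Φ ∈ W^{1,1}(D², ℂ²)` is weakly conformal. -/
def IsWeaklyConformal (Φ : ℂ → C2) : Prop :=
  MemW1 1 Φ ∧ ∃ Φx Φy : ℂ → C2, HasWeakGradient Φ Φx Φy ∧
    ∀ᵐ z ∂(volume.restrict disc),
      realInner (Φx z) (Φy z) = 0 ∧ ‖Φx z‖ ^ 2 = ‖Φy z‖ ^ 2

/-- The measurable map `ϑ : D² → S¹` is (a representative of) the Lagrangian angle of
`Φ ∈ W^{1,2}(D², ℂ²)`: `Φ^*(dz₁ ∧ dz₂) = e^{2λ} ϑ dx ∧ dy` a.e., where `e^{2λ} = |∂ₓΦ|²`. -/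
def IsLagrangianAngle (Φ : ℂ → C2) (ϑ : ℂ → ℂ) : Prop :=
  MemW1 2 Φ ∧ AEStronglyMeasurable ϑ (volume.restrict disc) ∧ (∀ z ∈ disc, ‖ϑ z‖ = 1) ∧
  ∃ Φx Φy : ℂ → C2, HasWeakGradient Φ Φx Φy ∧
    ∀ᵐ z ∂(volume.restrict disc), holVolume (Φx z) (Φy z) = ((‖Φx z‖ ^ 2 : ℝ) : ℂ) * ϑ z

/-- `g` is weakly differentiable and `div (i ḡ ∇g) = 0` in the sense of distributions on `D²`. -/
def IsCircleHarmonic (g : ℂ → ℂ) : Prop :=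
  ∃ gx gy : ℂ → ℂ, HasWeakGradient g gx gy ∧ ∀ φ : ℂ → ℝ, IsTestFunction φ →
    ∫ z in disc, (fderiv ℝ φ z 1 • (I * conj (g z) * gx z) +
      fderiv ℝ φ z I • (I * conj (g z) * gy z)) = 0

/-- The Lagrangian map `Φ` is Hamiltonian stationary: its Lagrangian angle `ḡ` satisfies
`div (i ḡ ∇g) = 0`. -/
def IsHamiltonianStationary (Φ : ℂ → C2) : Prop :=
  IsLagrangian Φ ∧ ∃ g : ℂ → ℂ, IsLagrangianAngle Φ (fun z => conj (g z)) ∧ IsCircleHarmonic g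

/-! ### Branch points -/

/-- `p` is a branch point of `Φ` (with Lagrangian angle `ϑ`): the differential of `Φ` vanishes at
`p` and the Lagrangian angle is continuous there. -/
def IsBranchPoint (Φ : ℂ → C2) (ϑ : ℂ → ℂ) (p : ℂ) : Prop :=
  DifferentiableAt ℝ Φ p ∧ fderiv ℝ Φ p = 0 ∧ ContinuousAt ϑ p

/-- `Φ` (with Lagrangian angle `ϑ`) is a smooth branched immersion of `D² ∖ S`:
the zeros of its differential are isolated in `D²`, `Φ` is smooth on `D² ∖ S`, and every point of
`D² ∖ S` at which `Φ` is not an immersion is a branch point. -/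
structure IsSmoothBranchedImmersionAwayFrom (Φ : ℂ → C2) (ϑ : ℂ → ℂ) (S : Set ℂ) : Prop where
  isolated : ∀ z ∈ disc, ∀ᶠ w in 𝓝[≠] z, fderiv ℝ Φ w ≠ 0
  smooth : ContDiffOn ℝ ∞ Φ (disc \ S)
  immersion_or_branch : ∀ z ∈ disc \ S,
    Function.Injective (fderiv ℝ Φ z) ∨ IsBranchPoint Φ ϑ z

/-! ### Schoen–Wolfson singularities -/

/-- `g` has an isolated singularity of degree `d` at `p`: it is continuous with values in `S¹` on a
punctured disc around `p` and has winding number `d` along small circles around `p`. -/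
def HasSingularityOfDegree (g : ℂ → ℂ) (p : ℂ) (d : ℤ) : Prop :=
  ∃ r > 0, ContinuousOn g (Metric.ball p r \ {p}) ∧ (∀ z ∈ Metric.ball p r \ {p}, ‖g z‖ = 1) ∧
    ∀ ε : ℝ, 0 < ε → ε < r → ∃ β : ℝ → ℝ, Continuous β ∧
      (∀ θ, g (circleMap p ε θ) = Complex.exp (β θ * I)) ∧
      ∀ θ, β (θ + 2 * Real.pi) = β θ + 2 * Real.pi * d

/-- `- i ḡ ∇g = ∇^⊥ G` on `V`, where `∇^⊥ = (-∂_y, ∂_x)`. -/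
def IsPotentialOn (g : ℂ → ℂ) (G : ℂ → ℝ) (V : Set ℂ) : Prop :=
  ∀ z ∈ V, DifferentiableAt ℝ g z ∧ DifferentiableAt ℝ G z ∧
    -I * conj (g z) * fderiv ℝ g z 1 = -((fderiv ℝ G z I : ℝ) : ℂ) ∧
    -I * conj (g z) * fderiv ℝ g z I = ((fderiv ℝ G z 1 : ℝ) : ℂ)

/-- The `m`-th model term
`(√(m+1) e^{√(m(m+1)) G} g^m, i √m e^{√(m(m+1)) G} g^{-m-1})`, as a function of the values
`γ ∈ S¹` of `g` and `t` of `G`. -/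
def modelTerm (m : ℕ) (γ : ℂ) (t : ℝ) : Fin 2 → ℂ :=
  ![(Real.sqrt (m + 1) : ℂ) * (Real.exp (Real.sqrt (m * (m + 1)) * t) : ℂ) * γ ^ m,
    I * (Real.sqrt m : ℂ) * (Real.exp (Real.sqrt (m * (m + 1)) * t) : ℂ) * γ ^ (-(m : ℤ) - 1)]

/-- `Φ` (with Lagrangian angle `ḡ`) has a Schoen–Wolfson singularity of type `Σ_{j,j+1}` at `p`:
`g` has a singularity of degree `1` at `p`, and around `p`
`Φ = U · ∑_m a_m (√(m+1) e^{√(m(m+1)) G} g^m, i √m e^{√(m(m+1)) G} g^{-m-1}) + Φ₀` with `U`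
unitary, `- i ḡ ∇g = ∇^⊥ G`, `∑ |a_m|² < ∞`, where `a_j ≠ 0` and `a_k = 0` for all `k < j`.
The sum runs over `m ≥ 1`: as `j ≥ 1`, the term of index `0` is absent. -/
def IsSchoenWolfsonSingularity (j : ℕ) (Φ : ℂ → C2) (g : ℂ → ℂ) (p : ℂ) : Prop :=
  1 ≤ j ∧ HasSingularityOfDegree g p 1 ∧
  ∃ r > 0, Metric.ball p r ⊆ disc ∧
  ∃ (G : ℂ → ℝ) (U : Matrix.unitaryGroup (Fin 2) ℂ) (a : ℕ → ℂ) (Φ₀ : C2),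
    IsPotentialOn g G (Metric.ball p r \ {p}) ∧
    Summable (fun m => ‖a m‖ ^ 2) ∧
    (∀ z ∈ Metric.ball p r \ {p}, ∃ s : Fin 2 → ℂ,
      HasSum (fun m => a m • modelTerm m (g z) (G z)) s ∧
      Φ z = WithLp.toLp 2 ((U : Matrix (Fin 2) (Fin 2) ℂ) *ᵥ s) + Φ₀) ∧
    a j ≠ 0 ∧ ∀ k < j, a k = 0

end HamStat

end

/-! With s = √(j² + j) and φ = arg w, the cone F(w) = (√(j+1) |w|^s e^{ijφ}, i√j |w|^s e^{-i(j+1)φ})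
is homogeneous of degree s, conformal and Lagrangian, with Lagrangian angle e^{-iφ}; conformality
forces s² = j(j+1). All this survives precomposition with a holomorphic h. So Φ = F ∘ h has g =
h/|h| and G = log|h|, the identity -iḡ∇g = ∇^⊥G being the Cauchy–Riemann equations for log h, and
every simple zero of h is a singularity of type Σ_{j,j+1} with a one-term expansion
(`coneMap_pointwise`, `isSchoenWolfsonSingularity_coneMap`).

It remains to choose h. Take h = e^{-L²} sin L with L = log(1+z). Its zeros in the disc are the
points e^{-kπ} - 1, k ≥ 0; they are simple and accumulate only at -1. As Im L is bounded, e^{-L²}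
decays faster than every power of 1+z, and all derivatives of h are bounded on the disc
(`flatSine_holderClass`). By homogeneity F is C^{j,s-j} on bounded sets, and so is the composition
on the disc (`IsHomogeneous.holderClass`, `HolderClass.comp`). On the unit circle h vanishes only at
-1. There each derivative in θ of a monomial in |h|, h and its conjugate is the same monomial times
a factor of polynomial growth at -1, and the flatness of h beats that factor
(`hasDerivAt_monomial_mul_tame`); hence the trace is smooth.

The partial derivatives of g are bounded by |h'/h|. Simple poles put h'/h locally in weak L².
Globally h'/h = cot L/(1+z) - 2L/(1+z), and scaling 1+z by e^{-π} multiplies the first term by e^π,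
so its q-th power integrals over successive shells form a convergent geometric series for q < 2
(`integrableOn_cotLog`). Once h'/h is integrable, replacing |w| by √(|w|²+δ) and letting δ → 0 gives
the weak gradient of g and div(iḡ∇g) = 0 across the zeros (`hasWeakGradient_phase`,
`isCircleHarmonic_phase`). -/

noncomputable section

namespace HamStat

/-! ### Hölder classes -/

/-- Functions with bounded derivatives up to order `k` on `U`, the last of which is `α`-Hölder. -/
def HolderClass (α : ℝ) (U : Set ℂ) : ℕ → ∀ (E : Type) [NormedAddCommGroup E] [NormedSpace ℝ E],
    (ℂ → E) → Prop
  | 0, _, _, _, f => (∃ C, ∀ z ∈ U, ‖f z‖ ≤ C) ∧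
      ∃ C, ∀ z ∈ U, ∀ w ∈ U, ‖f z - f w‖ ≤ C * ‖z - w‖ ^ α
  | k + 1, E, _, _, f => (∃ C, ∀ z ∈ U, ‖f z‖ ≤ C) ∧ (∀ z ∈ U, DifferentiableAt ℝ f z) ∧
      HolderClass α U k (ℂ →L[ℝ] E) (fderiv ℝ f)

namespace HolderClass

variable {α : ℝ} {U : Set ℂ} {E F H : Type} [NormedAddCommGroup E] [NormedSpace ℝ E]
  [NormedAddCommGroup F] [NormedSpace ℝ F] [NormedAddCommGroup H] [NormedSpace ℝ H]

lemma bounded {k : ℕ} {f : ℂ → E} (hf : HolderClass α U k E f) :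
    ∃ C, 0 ≤ C ∧ ∀ z ∈ U, ‖f z‖ ≤ C := by
  obtain ⟨C, hC⟩ : ∃ C, ∀ z ∈ U, ‖f z‖ ≤ C := by
    cases k with
    | zero => exact hf.1
    | succ k => exact hf.1
  exact ⟨max C 0, le_max_right _ _, fun z hz => (hC z hz).trans (le_max_left _ _)⟩

/-- Openness matters: `fderiv` is taken in the whole plane, and only on an open set is it determined
by the values there. -/
lemma congr {k : ℕ} (hU : IsOpen U) {f g : ℂ → E} (hf : HolderClass α U k E f)
    (h : Set.EqOn f g U) : HolderClass α U k E g := by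
  induction k generalizing E with
  | zero =>
    obtain ⟨⟨C, hC⟩, C', hC'⟩ := hf
    refine ⟨⟨C, fun z hz => h hz ▸ hC z hz⟩, C', fun z hz w hw => ?_⟩
    rw [← h hz, ← h hw]
    exact hC' z hz w hw
  | succ k ih =>
    obtain ⟨⟨C, hC⟩, hd, hk⟩ := hf
    have he : ∀ z ∈ U, g =ᶠ[𝓝 z] f := fun z hz => by
      filter_upwards [hU.mem_nhds hz] with w hw using (h hw).symm
    exact ⟨⟨C, fun z hz => h hz ▸ hC z hz⟩,
      fun z hz => (hd z hz).congr_of_eventuallyEq (he z hz),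
      ih hk fun z hz => ((he z hz).fderiv_eq).symm⟩

lemma add {k : ℕ} (hU : IsOpen U) {f g : ℂ → E} (hf : HolderClass α U k E f)
    (hg : HolderClass α U k E g) : HolderClass α U k E (fun z => f z + g z) := by
  induction k generalizing E with
  | zero =>
    obtain ⟨⟨C, hC⟩, C', hC'⟩ := hf
    obtain ⟨⟨D, hD⟩, D', hD'⟩ := hg
    refine ⟨⟨C + D, fun z hz => norm_add_le_of_le (hC z hz) (hD z hz)⟩,
      C' + D', fun z hz w hw => ?_⟩
    rw [add_mul, add_sub_add_comm]
    exact norm_add_le_of_le (hC' z hz w hw) (hD' z hz w hw)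
  | succ k ih =>
    obtain ⟨⟨C, hC⟩, hd, hk⟩ := hf
    obtain ⟨⟨D, hD⟩, hd', hk'⟩ := hg
    refine ⟨⟨C + D, fun z hz => norm_add_le_of_le (hC z hz) (hD z hz)⟩,
      fun z hz => (hd z hz).add (hd' z hz), (ih hk hk').congr hU fun z hz => ?_⟩
    exact (fderiv_add (hd z hz) (hd' z hz)).symm

lemma clm_comp {k : ℕ} (hU : IsOpen U) (T : E →L[ℝ] F) {f : ℂ → E} (hf : HolderClass α U k E f) :
    HolderClass α U k F (fun z => T (f z)) := by
  induction k generalizing E F with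
  | zero =>
    obtain ⟨⟨C, hC⟩, C', hC'⟩ := hf
    refine ⟨⟨‖T‖ * C, fun z hz => T.le_opNorm_of_le (hC z hz)⟩, ‖T‖ * C', fun z hz w hw => ?_⟩
    rw [← map_sub, mul_assoc]
    exact T.le_opNorm_of_le (hC' z hz w hw)
  | succ k ih =>
    obtain ⟨⟨C, hC⟩, hd, hk⟩ := hf
    refine ⟨⟨‖T‖ * C, fun z hz => T.le_opNorm_of_le (hC z hz)⟩,
      fun z hz => T.differentiableAt.comp z (hd z hz),
      (ih (ContinuousLinearMap.compL ℝ ℂ E F T) hk).congr hU fun z hz => ?_⟩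
    exact ((T.hasFDerivAt.comp z (hd z hz).hasFDerivAt).fderiv).symm

/-- On a bounded convex set, a bound of the derivative gives a Hölder estimate. -/
lemma holder_of_fderiv_bounded (hα : α ∈ Set.Ioc (0 : ℝ) 1) (hc : Convex ℝ U)
    (hb : Bornology.IsBounded U) {f : ℂ → E} {C : ℝ} (hC0 : 0 ≤ C)
    (hd : ∀ z ∈ U, DifferentiableAt ℝ f z) (hC : ∀ z ∈ U, ‖fderiv ℝ f z‖ ≤ C) :
    ∃ C', ∀ z ∈ U, ∀ w ∈ U, ‖f z - f w‖ ≤ C' * ‖z - w‖ ^ α := by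
  obtain ⟨R, hR⟩ := (Metric.isBounded_iff.1 hb)
  refine ⟨C * (max R 0) ^ (1 - α), fun z hz w hw => ?_⟩
  have h1 := hc.norm_image_sub_le_of_norm_fderiv_le hd hC hw hz
  refine h1.trans ?_
  rw [mul_assoc]
  refine mul_le_mul_of_nonneg_left ?_ hC0
  rcases (norm_nonneg (z - w)).eq_or_lt with h0 | h0
  · rw [← h0, Real.zero_rpow hα.1.ne', mul_zero]
  -- Trade the Lipschitz bound for exponent α: the factor with exponent 1 - α is bounded by a power
  -- of the diameter.
  · calc ‖z - w‖ = ‖z - w‖ ^ (1 - α) * ‖z - w‖ ^ α := by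
          rw [← Real.rpow_add h0, sub_add_cancel, Real.rpow_one]
      _ ≤ _ := by
          gcongr
          · linarith [hα.2]
          · refine le_max_of_le_left ?_
            rw [← dist_eq_norm]
            exact hR hz hw

lemma of_succ (hα : α ∈ Set.Ioc (0 : ℝ) 1) (hc : Convex ℝ U) (hb : Bornology.IsBounded U)
    {k : ℕ} {f : ℂ → E} (hf : HolderClass α U (k + 1) E f) : HolderClass α U k E f := by
  induction k generalizing E with
  | zero =>
    obtain ⟨C, hC0, hC⟩ := hf.2.2.bounded
    exact ⟨hf.1, holder_of_fderiv_bounded hα hc hb hC0 hf.2.1 hC⟩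
  | succ k ih => exact ⟨hf.1, hf.2.1, ih hf.2.2⟩

/-- Leibniz rule: both terms of the derivative are bilinear expressions one order lower, the
undifferentiated factor being demoted by `of_succ`. -/
lemma bilinear (hα : α ∈ Set.Ioc (0 : ℝ) 1) (hU : IsOpen U) (hc : Convex ℝ U)
    (hb : Bornology.IsBounded U) {k : ℕ} (B : E →L[ℝ] F →L[ℝ] H) {f : ℂ → E} {g : ℂ → F}
    (hf : HolderClass α U k E f) (hg : HolderClass α U k F g) :
    HolderClass α U k H (fun z => B (f z) (g z)) := by
  induction k generalizing E F H with
  | zero =>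
    obtain ⟨C, hC0, hC⟩ := hf.bounded
    obtain ⟨D, hD0, hD⟩ := hg.bounded
    obtain ⟨_, C', hC'⟩ := hf
    obtain ⟨_, D', hD'⟩ := hg
    refine ⟨⟨‖B‖ * C * D, fun z hz => B.le_of_opNorm₂_le_of_le le_rfl (hC z hz) (hD z hz)⟩,
      ‖B‖ * C' * D + ‖B‖ * C * D', fun z hz w hw => ?_⟩
    have : B (f z) (g z) - B (f w) (g w) = B (f z - f w) (g z) + B (f w) (g z - g w) := by
      simp
    rw [this]
    refine (norm_add_le_of_le (B.le_of_opNorm₂_le_of_le le_rfl (hC' z hz w hw) (hD z hz))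
      (B.le_of_opNorm₂_le_of_le le_rfl (hC w hw) (hD' z hz w hw))).trans_eq ?_
    ring
  | succ k ih =>
    obtain ⟨C, hC0, hC⟩ := hf.bounded
    obtain ⟨D, hD0, hD⟩ := hg.bounded
    refine ⟨⟨‖B‖ * C * D, fun z hz => B.le_of_opNorm₂_le_of_le le_rfl (hC z hz) (hD z hz)⟩,
      fun z hz => (B.hasFDerivAt_of_bilinear (hf.2.1 z hz).hasFDerivAt
        (hg.2.1 z hz).hasFDerivAt).differentiableAt, ?_⟩
    refine ((ih (B.precompR ℂ) (hf.of_succ hα hc hb) hg.2.2).add hU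
      (ih (B.precompL ℂ) hf.2.2 (hg.of_succ hα hc hb))).congr hU fun z hz => ?_
    exact (B.fderiv_of_bilinear (hf.2.1 z hz) (hg.2.1 z hz)).symm

/-- Chain rule and induction on the order of f. The inner map is Lipschitz, so the exponent α is
kept. -/
lemma comp (hα : α ∈ Set.Ioc (0 : ℝ) 1) (hU : IsOpen U) (hc : Convex ℝ U)
    (hb : Bornology.IsBounded U) {V : Set ℂ} {k : ℕ} {f : ℂ → E} {h : ℂ → ℂ}
    (hf : HolderClass α V k E f) (hh : ∀ k, HolderClass α U k ℂ h) (hV : Set.MapsTo h U V) :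
    HolderClass α U k E (fun z => f (h z)) := by
  induction k generalizing E with
  | zero =>
    obtain ⟨⟨C, hC⟩, C', hC'⟩ := hf
    obtain ⟨M, hM0, hM⟩ := (hh 1).2.2.bounded
    refine ⟨⟨C, fun z hz => hC _ (hV hz)⟩, max C' 0 * M ^ α, fun z hz w hw => ?_⟩
    calc ‖f (h z) - f (h w)‖ ≤ max C' 0 * ‖h z - h w‖ ^ α :=
          (hC' _ (hV hz) _ (hV hw)).trans (by gcongr; exact le_max_left _ _)
      _ ≤ max C' 0 * (M * ‖z - w‖) ^ α := by
          have := hc.norm_image_sub_le_of_norm_fderiv_le (hh 1).2.1 hM hw hz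
          have := hα.1.le
          gcongr
      _ = _ := by rw [Real.mul_rpow hM0 (norm_nonneg _), mul_assoc]
  | succ k ih =>
    obtain ⟨⟨C, hC⟩, hd, hk⟩ := hf
    refine ⟨⟨C, fun z hz => hC _ (hV hz)⟩,
      fun z hz => (hd _ (hV hz)).comp z ((hh 1).2.1 z hz), ?_⟩
    refine (bilinear hα hU hc hb (ContinuousLinearMap.compL ℝ ℂ ℂ E) (ih hk)
      (hh (k + 1)).2.2).congr hU fun z hz => ?_
    exact (fderiv_comp z (hd _ (hV hz)) ((hh 1).2.1 z hz)).symm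

lemma contDiffOn (hα : 0 < α) (hU : IsOpen U) {k : ℕ} {f : ℂ → E}
    (hf : HolderClass α U k E f) : ContDiffOn ℝ k f U := by
  induction k generalizing E with
  | zero =>
    obtain ⟨_, C, hC⟩ := hf
    rw [Nat.cast_zero, contDiffOn_zero]
    intro z hz
    rw [ContinuousWithinAt, tendsto_iff_norm_sub_tendsto_zero]
    have h0 : Tendsto (fun w => C * ‖w - z‖ ^ α) (𝓝[U] z) (𝓝 0) := by
      have : Continuous (fun w : ℂ => C * ‖w - z‖ ^ α) := by
        refine continuous_const.mul (Continuous.rpow_const (by fun_prop) fun _ => Or.inr hα.le)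
      have := this.tendsto z
      simp only [sub_self, norm_zero, Real.zero_rpow hα.ne', mul_zero] at this
      exact this.mono_left nhdsWithin_le_nhds
    refine squeeze_zero' (Eventually.of_forall fun _ => norm_nonneg _) ?_ h0
    filter_upwards [self_mem_nhdsWithin] with w hw using hC w hw z hz
  | succ k ih =>
    rw [Nat.cast_succ, contDiffOn_succ_iff_fderiv_of_isOpen hU]
    exact ⟨fun z hz => (hf.2.1 z hz).differentiableWithinAt, by simp, ih hf.2.2⟩

lemma iteratedFDeriv_holder {k : ℕ} {f : ℂ → E} (hf : HolderClass α U k E f) :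
    ∃ C : ℝ, ∀ z ∈ U, ∀ w ∈ U,
      ‖iteratedFDeriv ℝ k f z - iteratedFDeriv ℝ k f w‖ ≤ C * ‖z - w‖ ^ α := by
  induction k generalizing E with
  | zero =>
    obtain ⟨_, C, hC⟩ := hf
    refine ⟨C, fun z hz w hw => ?_⟩
    rw [iteratedFDeriv_zero_eq_comp, Function.comp_apply, Function.comp_apply, ← map_sub,
      LinearIsometryEquiv.norm_map]
    exact hC z hz w hw
  | succ k ih =>
    obtain ⟨C, hC⟩ := ih hf.2.2
    refine ⟨C, fun z hz w hw => ?_⟩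
    have := hC z hz w hw
    rw [← dist_eq_norm_sub] at this ⊢
    simpa only [iteratedFDeriv_succ_eq_comp_right, Function.comp_apply,
      LinearIsometryEquiv.dist_map] using this

lemma iteratedFDeriv_bounded {k : ℕ} {f : ℂ → E} (hf : HolderClass α U k E f) {i : ℕ}
    (hi : i ≤ k) : ∃ C : ℝ, ∀ z ∈ U, ‖iteratedFDeriv ℝ i f z‖ ≤ C := by
  induction i generalizing E k with
  | zero =>
    obtain ⟨C, _, hC⟩ := hf.bounded
    exact ⟨C, fun z hz => by simpa using hC z hz⟩
  | succ i ih =>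
    obtain ⟨k, rfl⟩ : ∃ l, k = l + 1 := ⟨k - 1, by omega⟩
    obtain ⟨C, hC⟩ := ih hf.2.2 (by omega)
    exact ⟨C, fun z hz => by rw [← norm_iteratedFDeriv_fderiv]; exact hC z hz⟩

lemma memHolder {s : ℝ} (hs : 0 < s - ⌊s⌋₊) {f : ℂ → E}
    (hf : HolderClass (s - ⌊s⌋₊) disc ⌊s⌋₊ E f) : MemHolder s f :=
  ⟨hf.contDiffOn hs Metric.isOpen_ball, fun _ hk => hf.iteratedFDeriv_bounded hk,
    hf.iteratedFDeriv_holder⟩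

end HolderClass

/-! ### Homogeneous functions -/

/-- `f` is smooth away from `0` and positively homogeneous of degree `d`. -/
structure IsHomogeneous {E : Type} [NormedAddCommGroup E] [NormedSpace ℝ E]
    (d : ℝ) (f : ℂ → E) : Prop where
  smooth : ∀ w ≠ 0, ContDiffAt ℝ ∞ f w
  homog : ∀ t : ℝ, 0 < t → ∀ w, f (t • w) = t ^ d • f w
  zero : f 0 = 0

namespace IsHomogeneous

variable {E : Type} [NormedAddCommGroup E] [NormedSpace ℝ E] {d : ℝ} {f : ℂ → E}

lemma norm_le (hf : IsHomogeneous d f) : ∃ C, 0 ≤ C ∧ ∀ w ≠ 0, ‖f w‖ ≤ C * ‖w‖ ^ d := by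
  have hcont : ContinuousOn f (Metric.sphere 0 1) := fun w hw =>
    (hf.smooth w (ne_zero_of_mem_unit_sphere ⟨w, hw⟩)).continuousAt.continuousWithinAt
  obtain ⟨C, hC⟩ := (isCompact_sphere (0 : ℂ) 1).exists_bound_of_continuousOn hcont
  refine ⟨max C 0, le_max_right _ _, fun w hw => ?_⟩
  have hw0 : 0 < ‖w‖ := norm_pos_iff.2 hw
  have h1 : ‖f (‖w‖⁻¹ • w)‖ ≤ C := hC _ (by simp [hw0.ne'])
  have h2 : w = ‖w‖ • (‖w‖⁻¹ • w) := by rw [smul_smul, mul_inv_cancel₀ hw0.ne', one_smul]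
  have h3 : ‖f w‖ = ‖w‖ ^ d * ‖f (‖w‖⁻¹ • w)‖ := by
    conv_lhs => rw [h2, hf.homog _ hw0, norm_smul]
    rw [Real.norm_of_nonneg (by positivity)]
  rw [h3, mul_comm]
  gcongr
  exact h1.trans (le_max_left _ _)

/-- The growth bound |f(w)| ≤ C|w|^d is o(|w|) when d > 1. -/
lemma hasFDerivAt_zero (hf : IsHomogeneous d f) (hd : 1 < d) :
    HasFDerivAt f (0 : ℂ →L[ℝ] E) 0 := by
  obtain ⟨C, hC0, hC⟩ := hf.norm_le
  rw [hasFDerivAt_iff_isLittleO_nhds_zero]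
  simp only [zero_add, hf.zero, sub_zero, zero_apply]
  have hO : f =O[𝓝 0] fun w : ℂ => ‖w‖ ^ d := by
    refine Asymptotics.IsBigO.of_bound C (Eventually.of_forall fun w => ?_)
    by_cases hw : w = 0
    · rw [hw, hf.zero, norm_zero]; positivity
    · rw [Real.norm_of_nonneg (by positivity)]; exact hC w hw
  refine hO.trans_isLittleO ?_
  rw [← Asymptotics.isLittleO_norm_right]
  have h1 : Tendsto (fun w : ℂ => ‖w‖ ^ (d - 1)) (𝓝 0) (𝓝 0) := by
    have : Continuous (fun w : ℂ => ‖w‖ ^ (d - 1)) :=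
      continuous_norm.rpow_const fun _ => Or.inr (by linarith)
    have := this.tendsto 0
    rwa [norm_zero, Real.zero_rpow (by linarith)] at this
  refine Asymptotics.isLittleO_of_tendsto' ?_ ?_
  · exact Eventually.of_forall fun w hw => by rw [hw, Real.zero_rpow (by linarith)]
  · refine h1.congr fun w => ?_
    by_cases hw : w = 0
    · rw [hw, norm_zero, Real.zero_rpow (by linarith), Real.zero_rpow (by linarith), zero_div]
    · rw [Real.rpow_sub (norm_pos_iff.2 hw), Real.rpow_one]

/-- Differentiate f(tw) = t^d f(w) in w and divide by t. -/
lemma fderiv_homogeneous (hf : IsHomogeneous d f) (hd : 1 < d) :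
    IsHomogeneous (d - 1) (fderiv ℝ f) where
  smooth w hw := (hf.smooth w hw).fderiv_right (by simp)
  zero := (hf.hasFDerivAt_zero hd).fderiv
  homog t ht w := by
    have h1 : (fun w => f (t • w)) = t ^ d • f := funext fun w => hf.homog t ht w
    have h2 : fderiv ℝ (fun w => f (t • w)) w = t • fderiv ℝ f (t • w) := fderiv_comp_smul t
    rw [h1, fderiv_const_smul_field, Pi.smul_apply] at h2
    rw [Real.rpow_sub ht, Real.rpow_one, div_eq_inv_mul, mul_smul, h2, smul_smul,
      inv_mul_cancel₀ ht.ne', one_smul]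

lemma bounded_ball (hf : IsHomogeneous d f) (hd : 0 ≤ d) (R : ℝ) :
    ∃ C, ∀ w ∈ Metric.ball (0 : ℂ) R, ‖f w‖ ≤ C := by
  obtain ⟨C, hC0, hC⟩ := hf.norm_le
  refine ⟨C * R ^ d, fun w hw => ?_⟩
  rw [mem_ball_zero_iff] at hw
  have hR : 0 < R := (norm_nonneg w).trans_lt hw
  by_cases hw0 : w = 0
  · rw [hw0, hf.zero, norm_zero]; positivity
  · refine (hC w hw0).trans ?_
    gcongr

/-- Two regimes. If |z - w| is comparable to the distance to the origin, the size of f suffices.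
Otherwise the mean value inequality applies on a ball that stays at distance |z - w| from the
origin, where the derivative is at most D|z - w|^{d-1}. -/
lemma holder (hf : IsHomogeneous d f) (hd : d ∈ Set.Ioo (0 : ℝ) 1) :
    ∃ C, ∀ z w : ℂ, ‖f z - f w‖ ≤ C * ‖z - w‖ ^ d := by
  obtain ⟨C, hC0, hC⟩ := hf.norm_le
  have hC' : ∀ w, ‖f w‖ ≤ C * ‖w‖ ^ d := fun w => by
    by_cases hw : w = 0
    · rw [hw, hf.zero, norm_zero]; positivity
    · exact hC w hw
  have hD : ∃ D, 0 ≤ D ∧ ∀ w ≠ 0, ‖fderiv ℝ f w‖ ≤ D * ‖w‖ ^ (d - 1) := by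
    have hcont : ContinuousOn (fderiv ℝ f) (Metric.sphere 0 1) := fun w hw =>
      ((hf.smooth w (ne_zero_of_mem_unit_sphere ⟨w, hw⟩)).fderiv_right (m := ∞)
        (by simp)).continuousAt.continuousWithinAt
    obtain ⟨D, hD⟩ := (isCompact_sphere (0 : ℂ) 1).exists_bound_of_continuousOn hcont
    refine ⟨max D 0, le_max_right _ _, fun w hw => ?_⟩
    have hw0 : 0 < ‖w‖ := norm_pos_iff.2 hw
    have h1 : ‖fderiv ℝ f (‖w‖⁻¹ • w)‖ ≤ D := hD _ (by simp [hw0.ne'])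
    have h0 : (fun v => f (‖w‖⁻¹ • v)) = (‖w‖⁻¹) ^ d • f :=
      funext fun v => hf.homog _ (inv_pos.2 hw0) v
    have h2 : fderiv ℝ (fun v => f (‖w‖⁻¹ • v)) w = ‖w‖⁻¹ • fderiv ℝ f (‖w‖⁻¹ • w) :=
      fderiv_comp_smul _
    rw [h0, fderiv_const_smul_field, Pi.smul_apply] at h2
    have h3 : fderiv ℝ f w = ‖w‖ ^ (d - 1) • fderiv ℝ f (‖w‖⁻¹ • w) := by
      have h4 : ‖w‖ ^ (d - 1) = ‖w‖ ^ d * ‖w‖⁻¹ := by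
        rw [Real.rpow_sub hw0, Real.rpow_one, div_eq_mul_inv]
      rw [h4, mul_smul, ← h2, smul_smul, ← Real.mul_rpow hw0.le (by positivity),
        mul_inv_cancel₀ hw0.ne', Real.one_rpow, one_smul]
    rw [h3, norm_smul, Real.norm_of_nonneg (by positivity), mul_comm]
    gcongr
    exact h1.trans (le_max_left _ _)
  obtain ⟨D, hD0, hD⟩ := hD
  have key : ∀ z w : ℂ, ‖w‖ ≤ ‖z‖ →
      ‖f z - f w‖ ≤ (2 * C * 2 ^ d + D) * ‖z - w‖ ^ d := by
    intro z w hwz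
    by_cases hcase : ‖z‖ ≤ 2 * ‖z - w‖
    · have h1 : ‖f z - f w‖ ≤ 2 * C * ‖z‖ ^ d := by
        refine (norm_sub_le _ _).trans ?_
        have h2 : ‖w‖ ^ d ≤ ‖z‖ ^ d := by have := hd.1.le; gcongr
        nlinarith [hC' z, hC' w]
      have h2 : ‖z‖ ^ d ≤ 2 ^ d * ‖z - w‖ ^ d := by
        rw [← Real.mul_rpow (by norm_num) (norm_nonneg _)]
        have := hd.1.le
        gcongr
      have h3 : 0 ≤ D * ‖z - w‖ ^ d := by positivity
      nlinarith
    · push Not at hcase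
      rcases eq_or_ne z w with rfl | hne
      · simp [Real.zero_rpow hd.1.ne']
      have hpos : 0 < ‖z - w‖ := norm_pos_iff.2 (sub_ne_zero.2 hne)
      have hball : ∀ x ∈ Metric.closedBall z ‖z - w‖, ‖z - w‖ ≤ ‖x‖ := fun x hx => by
        rw [mem_closedBall_iff_norm] at hx
        have := norm_sub_norm_le z x
        rw [norm_sub_rev] at this
        linarith
      have hx0 : ∀ x ∈ Metric.closedBall z ‖z - w‖, x ≠ 0 := fun x hx =>
        norm_pos_iff.1 (hpos.trans_le (hball x hx))
      have h1 := (convex_closedBall z ‖z - w‖).norm_image_sub_le_of_norm_fderiv_le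
        (f := f) (𝕜 := ℝ) (C := D * ‖z - w‖ ^ (d - 1)) (x := w) (y := z)
        (fun x hx => (hf.smooth x (hx0 x hx)).differentiableAt (by simp))
        (fun x hx => (hD x (hx0 x hx)).trans (by
          refine mul_le_mul_of_nonneg_left ?_ hD0
          exact Real.rpow_le_rpow_of_nonpos hpos (hball x hx) (by linarith [hd.2])))
        (by rw [mem_closedBall_iff_norm, norm_sub_rev]) (by simp)
      refine h1.trans ?_
      rw [mul_assoc, Real.rpow_sub_one hpos.ne', div_mul_cancel₀ _ hpos.ne']
      have : 0 ≤ 2 * C * 2 ^ d := by positivity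
      gcongr
      linarith
  refine ⟨2 * C * 2 ^ d + D, fun z w => ?_⟩
  rcases le_total ‖w‖ ‖z‖ with h | h
  · exact key z w h
  · rw [norm_sub_rev, norm_sub_rev z w]
    exact key w z h

/-- Each derivative lowers the degree by one; after k of them the degree is α, where `holder`
applies. -/
lemma holderClass {α : ℝ} (hα : α ∈ Set.Ioo (0 : ℝ) 1) (k : ℕ) (hf : IsHomogeneous (k + α) f)
    (R : ℝ) : HolderClass α (Metric.ball 0 R) k E f := by
  induction k generalizing E with
  | zero =>
    rw [Nat.cast_zero, zero_add] at hf
    obtain ⟨C, hC⟩ := hf.holder hα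
    exact ⟨hf.bounded_ball hα.1.le R, C, fun z _ w _ => hC z w⟩
  | succ k ih =>
    have h1 : 1 < ((k + 1 : ℕ) : ℝ) + α := by
      have : (0 : ℝ) ≤ k := k.cast_nonneg
      push_cast
      linarith [hα.1]
    refine ⟨hf.bounded_ball (by linarith) R, fun z _ => ?_, ih ?_⟩
    · by_cases hz : z = 0
      · rw [hz]; exact (hf.hasFDerivAt_zero h1).differentiableAt
      · exact (hf.smooth z hz).differentiableAt (by simp)
    · have h2 := hf.fderiv_homogeneous h1
      have h3 : ((k + 1 : ℕ) : ℝ) + α - 1 = k + α := by push_cast; ring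
      rwa [h3] at h2

end IsHomogeneous

/-! ### The model cone -/

/-- The monomial `|w|^c w^a w̄^b`. -/
def monomial (c : ℝ) (a b : ℕ) (w : ℂ) : ℂ := ((‖w‖ ^ c : ℝ) : ℂ) * w ^ a * conj w ^ b

lemma norm_monomial (c : ℝ) (a b : ℕ) {w : ℂ} (hw : w ≠ 0) :
    ‖monomial c a b w‖ = ‖w‖ ^ (c + a + b) := by
  have h : 0 < ‖w‖ := norm_pos_iff.2 hw
  rw [monomial, norm_mul, norm_mul, norm_pow, norm_pow, RCLike.norm_conj, Complex.norm_real,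
    Real.norm_of_nonneg (by positivity), Real.rpow_add h, Real.rpow_add h, Real.rpow_natCast,
    Real.rpow_natCast]

/-- Logarithmic differentiation: with γ' = γτ, the factors |γ|^c, γ^a and its conjugate power
contribute c Re τ, aτ and b times the conjugate of τ. -/
lemma hasDerivAt_monomial_comp (c : ℝ) (a b : ℕ) {γ : ℝ → ℂ} {t : ℝ} {τ : ℂ}
    (hγ : HasDerivAt γ (γ t * τ) t) (h0 : γ t ≠ 0) :
    HasDerivAt (fun t => monomial c a b (γ t))
      (monomial c a b (γ t) * (c * τ.re + a * τ + b * conj τ)) t := by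
  have hpos : 0 < ‖γ t‖ := norm_pos_iff.2 h0
  have h1 : HasDerivAt (fun t => ‖γ t‖ ^ c) (‖γ t‖ ^ c * (c * τ.re)) t := by
    have h2 := (hγ.norm_sq.rpow_const (p := c / 2) (Or.inl (by positivity)))
    have h3 : (fun t => (‖γ t‖ ^ 2) ^ (c / 2)) = fun t => ‖γ t‖ ^ c := by
      ext t
      rw [← Real.rpow_natCast, ← Real.rpow_mul (norm_nonneg _)]
      congr 1
      push_cast
      ring
    rw [h3] at h2
    convert h2 using 1
    have h4 : inner ℝ (γ t) (γ t * τ) = ‖γ t‖ ^ 2 * τ.re := by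
      rw [Complex.inner, mul_right_comm, Complex.mul_conj, Complex.re_ofReal_mul,
        Complex.normSq_eq_norm_sq]
    have h5 : (‖γ t‖ ^ 2) ^ (c / 2 - 1) = ‖γ t‖ ^ c / ‖γ t‖ ^ 2 := by
      rw [Real.rpow_sub_one (by positivity), ← congrFun h3 t]
    rw [h4, h5]
    field_simp
  have h2 : HasDerivAt (fun t => conj (γ t)) (conj (γ t * τ)) t :=
    HasDerivAt.star hγ
  have h3 := (h1.ofReal_comp.mul (hγ.pow a)).mul (h2.pow b)
  refine h3.congr_deriv ?_
  simp only [Pi.mul_apply, Pi.pow_apply]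
  -- For a = 0 the truncated exponent `a - 1` is harmless because of the factor a; likewise for b
  -- below.
  have ha : (a : ℂ) * γ t ^ (a - 1) * (γ t * τ) = a * γ t ^ a * τ := by
    cases a with
    | zero => simp
    | succ a => simp only [Nat.add_sub_cancel, pow_succ]; ring
  have hb : (b : ℂ) * conj (γ t) ^ (b - 1) * conj (γ t * τ) = b * conj (γ t) ^ b * conj τ := by
    rw [map_mul]
    cases b with
    | zero => simp
    | succ b => simp only [Nat.add_sub_cancel, pow_succ]; ring
  rw [ha, hb, monomial]
  push_cast
  ring

lemma contDiffAt_monomial (c : ℝ) (a b : ℕ) {w : ℂ} (hw : w ≠ 0) :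
    ContDiffAt ℝ ∞ (monomial c a b) w := by
  have h1 : ContDiffAt ℝ ∞ (fun w : ℂ => ‖w‖ ^ c) w :=
    (contDiffAt_norm ℝ hw).rpow_const_of_ne (norm_ne_zero_iff.2 hw)
  have h2 : ContDiffAt ℝ ∞ (fun w : ℂ => ((‖w‖ ^ c : ℝ) : ℂ)) w :=
    Complex.ofRealCLM.contDiff.contDiffAt.comp w h1
  have h3 : ContDiffAt ℝ ∞ (fun w : ℂ => conj w) w := Complex.conjCLE.contDiff.contDiffAt
  exact (h2.mul (contDiffAt_id.pow a)).mul (h3.pow b)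

lemma monomial_smul (c : ℝ) (a b : ℕ) {t : ℝ} (ht : 0 < t) (w : ℂ) :
    monomial c a b (t • w) = t ^ (c + a + b) • monomial c a b w := by
  rw [monomial, monomial, norm_smul, Real.norm_of_nonneg ht.le]
  simp only [Complex.real_smul, map_mul, Complex.conj_ofReal]
  rw [Real.mul_rpow ht.le (norm_nonneg _), Real.rpow_add ht, Real.rpow_add ht,
    Real.rpow_natCast, Real.rpow_natCast]
  push_cast
  ring

/-- The exponent `√(j² + j)`. -/
def coneDegree (j : ℕ) : ℝ := Real.sqrt ((j : ℝ) ^ 2 + j)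

lemma coneDegree_sq (j : ℕ) : coneDegree j ^ 2 = j * (j + 1) := by
  rw [coneDegree, Real.sq_sqrt (by positivity)]; ring

lemma coneDegree_gt {j : ℕ} (hj : 1 ≤ j) : (j : ℝ) < coneDegree j := by
  have : (1 : ℝ) ≤ j := by exact_mod_cast hj
  exact Real.lt_sqrt_of_sq_lt (by linarith)

lemma coneDegree_lt (j : ℕ) : coneDegree j < j + 1 := by
  have : (0 : ℝ) ≤ j := j.cast_nonneg
  rw [coneDegree, Real.sqrt_lt' (by positivity)]
  nlinarith

/-- Since j² < j² + j < (j+1)², the Hölder class is C^{j,s-j} with s - j strictly between 0 and 1.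
-/
lemma floor_coneDegree {j : ℕ} (hj : 1 ≤ j) : ⌊coneDegree j⌋₊ = j := by
  rw [Nat.floor_eq_iff (a := coneDegree j) (Real.sqrt_nonneg _)]
  exact ⟨(coneDegree_gt hj).le, coneDegree_lt j⟩

/-- The Schoen–Wolfson cone
`w ↦ (√(j+1) |w|^s (w/|w|)^j, i √j |w|^s (w/|w|)^{-j-1})` with `s = √(j² + j)`. -/
def cone (j : ℕ) (w : ℂ) : C2 :=
  WithLp.toLp 2 ![(Real.sqrt (j + 1) : ℂ) * monomial (coneDegree j - j) j 0 w,
    I * (Real.sqrt j : ℂ) * monomial (coneDegree j - j - 1) 0 (j + 1) w]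

lemma cone_apply_zero (j : ℕ) (w : ℂ) :
    cone j w 0 = (Real.sqrt (j + 1) : ℂ) * monomial (coneDegree j - j) j 0 w := rfl

lemma cone_apply_one (j : ℕ) (w : ℂ) :
    cone j w 1 = I * (Real.sqrt j : ℂ) * monomial (coneDegree j - j - 1) 0 (j + 1) w := rfl

lemma cone_isHomogeneous {j : ℕ} (hj : 1 ≤ j) : IsHomogeneous (coneDegree j) (cone j) where
  smooth w hw := by
    refine contDiffAt_piLp' 2 fun i => ?_
    fin_cases i
    · exact contDiffAt_const.mul (contDiffAt_monomial _ _ _ hw)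
    · exact contDiffAt_const.mul (contDiffAt_monomial _ _ _ hw)
  homog t ht w := by
    ext i
    fin_cases i
    · change cone j (t • w) 0 = t ^ coneDegree j • cone j w 0
      rw [cone_apply_zero, cone_apply_zero, monomial_smul _ _ _ ht]
      simp
      ring
    · change cone j (t • w) 1 = t ^ coneDegree j • cone j w 1
      rw [cone_apply_one, cone_apply_one, monomial_smul _ _ _ ht]
      simp
      ring
  zero := by
    ext i
    fin_cases i
    · change cone j 0 0 = 0
      rw [cone_apply_zero, monomial, zero_pow (by omega : j ≠ 0)]
      simp
    · change cone j 0 1 = 0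
      rw [cone_apply_one, monomial, map_zero, zero_pow (Nat.succ_ne_zero j)]
      simp

lemma hasFDerivAt_cone_zero {j : ℕ} (hj : 1 ≤ j) : HasFDerivAt (cone j) (0 : ℂ →L[ℝ] C2) 0 := by
  refine (cone_isHomogeneous hj).hasFDerivAt_zero ?_
  have : (1 : ℝ) ≤ j := by exact_mod_cast hj
  linarith [coneDegree_gt hj]

lemma differentiableAt_cone {j : ℕ} (hj : 1 ≤ j) (w : ℂ) : DifferentiableAt ℝ (cone j) w := by
  by_cases hw : w = 0
  · rw [hw]; exact (hasFDerivAt_cone_zero hj).differentiableAt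
  · exact ((cone_isHomogeneous hj).smooth w hw).differentiableAt (by simp)

lemma continuous_cone {j : ℕ} (hj : 1 ≤ j) : Continuous (cone j) :=
  continuous_iff_continuousAt.2 fun w => (differentiableAt_cone hj w).continuousAt

/-- The direction wτ amounts to moving by τ in the coordinate log w: Re τ dilates, with weight s,
and Im τ rotates, with weights j and -(j+1). -/
lemma fderiv_cone_apply {j : ℕ} (hj : 1 ≤ j) {w : ℂ} (hw : w ≠ 0) (τ : ℂ) :
    fderiv ℝ (cone j) w (w * τ) 0 = cone j w 0 * (coneDegree j * τ.re + j * τ.im * I) ∧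
    fderiv ℝ (cone j) w (w * τ) 1 =
      cone j w 1 * (coneDegree j * τ.re - (j + 1) * τ.im * I) := by
  have hγ : HasDerivAt (fun t : ℝ => w + t * (w * τ)) (w * τ) 0 := by
    simpa using (((hasDerivAt_id (0 : ℝ)).ofReal_comp).mul_const (w * τ)).const_add w
  have hγ' : HasDerivAt (fun t : ℝ => w + t * (w * τ))
      ((fun t : ℝ => w + t * (w * τ)) 0 * τ) 0 := by simpa using hγ
  have h0 : (fun t : ℝ => w + t * (w * τ)) 0 ≠ 0 := by simpa using hw
  have hF : HasDerivAt (fun t : ℝ => cone j (w + t * (w * τ)))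
      (fderiv ℝ (cone j) w (w * τ)) 0 := by
    exact (differentiableAt_cone hj w).hasFDerivAt.comp_hasDerivAt_of_eq (0 : ℝ) hγ (by simp)
  have hcomp : ∀ i, HasDerivAt (fun t : ℝ => cone j (w + t * (w * τ)) i)
      (fderiv ℝ (cone j) w (w * τ) i) 0 := fun i =>
    ((EuclideanSpace.proj i : C2 →L[ℂ] ℂ).restrictScalars ℝ).hasFDerivAt.comp_hasDerivAt 0 hF
  have hτ : τ = τ.re + τ.im * I := (re_add_im τ).symm
  have hτ' : conj τ = τ.re - τ.im * I := by
    apply Complex.ext <;> simp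
  constructor
  · refine (hcomp 0).unique (((hasDerivAt_monomial_comp (coneDegree j - j) j 0 hγ'
      h0).const_mul (Real.sqrt (j + 1) : ℂ)).congr_deriv ?_)
    simp only [ofReal_zero, zero_mul, add_zero, cone_apply_zero, Nat.cast_zero]
    conv_lhs => enter [2, 2, 2, 2]; rw [hτ]
    push_cast
    ring
  · refine (hcomp 1).unique (((hasDerivAt_monomial_comp (coneDegree j - j - 1) 0 (j + 1) hγ'
      h0).const_mul (I * (Real.sqrt j : ℂ))).congr_deriv ?_)
    simp only [ofReal_zero, zero_mul, add_zero, cone_apply_one, Nat.cast_zero]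
    rw [hτ']
    push_cast
    ring

lemma norm_sq_cone_zero (j : ℕ) {w : ℂ} (hw : w ≠ 0) :
    ‖cone j w 0‖ ^ 2 = (j + 1) * (‖w‖ ^ coneDegree j) ^ 2 := by
  rw [cone_apply_zero, norm_mul, norm_monomial _ _ _ hw, Complex.norm_real,
    Real.norm_of_nonneg (Real.sqrt_nonneg _), mul_pow, Real.sq_sqrt (by positivity)]
  simp

lemma norm_sq_cone_one (j : ℕ) {w : ℂ} (hw : w ≠ 0) :
    ‖cone j w 1‖ ^ 2 = j * (‖w‖ ^ coneDegree j) ^ 2 := by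
  rw [cone_apply_one, norm_mul, norm_mul, norm_monomial _ _ _ hw, Complex.norm_real,
    Real.norm_of_nonneg (Real.sqrt_nonneg _), mul_pow, mul_pow, Real.sq_sqrt (by positivity)]
  simp

/-- The phases e^{ijφ} and e^{-i(j+1)φ} multiply to e^{-iφ}; this is the source of the Lagrangian
angle. The constants give √(j+1)√j = s. -/
lemma cone_mul (j : ℕ) {w : ℂ} (hw : w ≠ 0) :
    cone j w 0 * cone j w 1 =
      I * coneDegree j * ((‖w‖ ^ coneDegree j) ^ 2 : ℝ) * conj (w / ‖w‖) := by
  have h : 0 < ‖w‖ := norm_pos_iff.2 hw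
  have h1 : (Real.sqrt (j + 1) : ℂ) * (Real.sqrt j : ℂ) = coneDegree j := by
    rw [← ofReal_mul, ← Real.sqrt_mul (by positivity), coneDegree]
    congr 2
    ring
  have h2 : w ^ j * conj w ^ (j + 1) = ((‖w‖ ^ (2 * j) : ℝ) : ℂ) * conj w := by
    rw [pow_succ, ← mul_assoc, ← mul_pow, Complex.mul_conj, Complex.normSq_eq_norm_sq]
    push_cast
    ring
  have h3 : ‖w‖ ^ (coneDegree j - j) * ‖w‖ ^ (coneDegree j - j - 1) * ‖w‖ ^ (2 * j) =
      (‖w‖ ^ coneDegree j) ^ 2 * ‖w‖⁻¹ := by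
    rw [← Real.rpow_natCast ‖w‖ (2 * j), ← Real.rpow_add h, ← Real.rpow_add h,
      ← Real.rpow_neg_one, ← Real.rpow_natCast, ← Real.rpow_mul h.le, ← Real.rpow_add h]
    congr 1
    push_cast
    ring
  rw [cone_apply_zero, cone_apply_one, monomial, monomial, pow_zero, pow_zero, mul_one, mul_one]
  calc _ = I * ((Real.sqrt (j + 1) : ℂ) * (Real.sqrt j : ℂ)) *
        ((‖w‖ ^ (coneDegree j - j) * ‖w‖ ^ (coneDegree j - j - 1) : ℝ) : ℂ) *
        (w ^ j * conj w ^ (j + 1)) := by push_cast; ring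
    _ = I * coneDegree j * ((‖w‖ ^ (coneDegree j - j) * ‖w‖ ^ (coneDegree j - j - 1) *
        ‖w‖ ^ (2 * j) : ℝ) : ℂ) * conj w := by rw [h1, h2]; push_cast; ring
    _ = _ := by
      rw [h3, map_div₀, conj_ofReal]
      push_cast
      ring

/-- Half of conformality. The coefficient of (Re τ)² is (2j+1)s², that of (Im τ)² is (j+1)j² +
j(j+1)² = (2j+1)j(j+1); they agree exactly because s² = j(j+1). -/
lemma norm_sq_fderiv_cone {j : ℕ} (hj : 1 ≤ j) {w : ℂ} (hw : w ≠ 0) (τ : ℂ) :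
    ‖fderiv ℝ (cone j) w (w * τ)‖ ^ 2 =
      (2 * j + 1) * coneDegree j ^ 2 * (‖w‖ ^ coneDegree j) ^ 2 * ‖τ‖ ^ 2 := by
  obtain ⟨h0, h1⟩ := fderiv_cone_apply hj hw τ
  rw [EuclideanSpace.norm_sq_eq, Fin.sum_univ_two, h0, h1, norm_mul, norm_mul, mul_pow, mul_pow,
    norm_sq_cone_zero j hw, norm_sq_cone_one j hw, ← Complex.normSq_eq_norm_sq,
    ← Complex.normSq_eq_norm_sq, ← Complex.normSq_eq_norm_sq, Complex.normSq_apply,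
    Complex.normSq_apply, Complex.normSq_apply]
  simp
  linear_combination (-(2 * j + 1) * (‖w‖ ^ coneDegree j) ^ 2 * τ.im ^ 2) * coneDegree_sq j

lemma realInner_fderiv_cone {j : ℕ} (hj : 1 ≤ j) {w : ℂ} (hw : w ≠ 0) (τ : ℂ) :
    realInner (fderiv ℝ (cone j) w (w * τ)) (fderiv ℝ (cone j) w (w * (τ * I))) = 0 := by
  obtain ⟨h0, h1⟩ := fderiv_cone_apply hj hw τ
  obtain ⟨h0', h1'⟩ := fderiv_cone_apply hj hw (τ * I)
  have key : ∀ A x y : ℂ, (conj (A * x) * (A * y)).re = ‖A‖ ^ 2 * (conj x * y).re := by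
    intro A x y
    rw [← Complex.normSq_eq_norm_sq, ← re_ofReal_mul, ← mul_conj, map_mul]
    congr 1
    ring
  rw [realInner, Fin.sum_univ_two, h0, h1, h0', h1', key, key, norm_sq_cone_zero j hw,
    norm_sq_cone_one j hw]
  simp
  linear_combination (-(2 * j + 1) * (‖w‖ ^ coneDegree j) ^ 2 * τ.im * τ.re) * coneDegree_sq j

/-- The squared sizes j+1 and j balance the angular speeds j and -(j+1), so the two components
cancel; the value of s plays no role here. -/
lemma symplecticForm_fderiv_cone {j : ℕ} (hj : 1 ≤ j) {w : ℂ} (hw : w ≠ 0) (τ : ℂ) :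
    symplecticForm (fderiv ℝ (cone j) w (w * τ)) (fderiv ℝ (cone j) w (w * (τ * I))) = 0 := by
  obtain ⟨h0, h1⟩ := fderiv_cone_apply hj hw τ
  obtain ⟨h0', h1'⟩ := fderiv_cone_apply hj hw (τ * I)
  have key : ∀ A x y : ℂ, (A * x).re * (A * y).im - (A * x).im * (A * y).re =
      ‖A‖ ^ 2 * (conj x * y).im := by
    intro A x y
    rw [← Complex.normSq_eq_norm_sq, Complex.normSq_apply]
    simp
    ring
  rw [symplecticForm, Fin.sum_univ_two, h0, h1, h0', h1', key, key, norm_sq_cone_zero j hw,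
    norm_sq_cone_one j hw]
  simp
  ring

/-- The determinant of the two logarithmic tangent factors is -is(2j+1)|τ|²; `cone_mul` supplies the
remaining is|w|^{2s} and the phase. -/
lemma holVolume_fderiv_cone {j : ℕ} (hj : 1 ≤ j) {w : ℂ} (hw : w ≠ 0) (τ : ℂ) :
    holVolume (fderiv ℝ (cone j) w (w * τ)) (fderiv ℝ (cone j) w (w * (τ * I))) =
      ((‖fderiv ℝ (cone j) w (w * τ)‖ ^ 2 : ℝ) : ℂ) * conj (w / ‖w‖) := by
  obtain ⟨h0, h1⟩ := fderiv_cone_apply hj hw τ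
  obtain ⟨h0', h1'⟩ := fderiv_cone_apply hj hw (τ * I)
  have h2 : (τ * I).re = -τ.im := by simp
  have h3 : (τ * I).im = τ.re := by simp
  rw [norm_sq_fderiv_cone hj hw, holVolume, h0, h1, h0', h1', h2, h3,
    ← Complex.normSq_eq_norm_sq τ, Complex.normSq_apply]
  push_cast
  have hm := cone_mul j hw
  push_cast at hm
  linear_combination (-I * coneDegree j * (2 * j + 1) * (τ.re * τ.re + τ.im * τ.im)) * hm +
    (-(coneDegree j : ℂ) ^ 2 * (2 * j + 1) * (τ.re * τ.re + τ.im * τ.im) *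
      ((‖w‖ ^ coneDegree j : ℝ) : ℂ) ^ 2 * conj (w / ‖w‖)) * I_sq

/-! ### A holomorphic function with zeros accumulating at a flat boundary point -/

/-- The half plane `Re z > -1`. -/
def halfPlane : Set ℂ := {z | -1 < z.re}

lemma isOpen_halfPlane : IsOpen halfPlane := isOpen_lt continuous_const Complex.continuous_re

lemma convex_halfPlane : Convex ℝ halfPlane := convex_halfSpace_re_gt (-1)

lemma mem_halfPlane_of_norm_le {z : ℂ} (hz : ‖z‖ ≤ 1) (h : z ≠ -1) : z ∈ halfPlane := by
  have h1 : |z.re| ≤ 1 := (abs_re_le_norm z).trans hz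
  have h2 := abs_le.1 h1
  refine lt_of_le_of_ne h2.1 fun h3 => h ?_
  have h4 : z.re ^ 2 + z.im ^ 2 ≤ 1 := by
    have := Complex.normSq_eq_norm_sq z
    rw [Complex.normSq_apply] at this
    nlinarith [norm_nonneg z]
  rw [← h3] at h4
  have h5 : z.im = 0 := by nlinarith
  exact Complex.ext (by simp [← h3]) (by simp [h5])

lemma disc_subset_halfPlane : disc ⊆ halfPlane := fun z hz => by
  rw [mem_ball_zero_iff] at hz
  exact mem_halfPlane_of_norm_le hz.le fun h => by simp [h] at hz

lemma one_add_ne_zero_iff {z : ℂ} : 1 + z ≠ 0 ↔ z ≠ -1 := by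
  rw [not_iff_not, add_comm]
  exact add_eq_zero_iff_eq_neg

lemma ne_neg_one_of_mem_halfPlane {z : ℂ} (hz : z ∈ halfPlane) : z ≠ -1 := by
  rintro rfl
  simp [halfPlane] at hz

lemma hasDerivAt_log_one_add {z : ℂ} (hz : z ∈ halfPlane) :
    HasDerivAt (fun z => log (1 + z)) (1 + z)⁻¹ z := by
  have h1 : 1 + z ∈ slitPlane := by
    left
    have : -1 < z.re := hz
    simp
    linarith
  simpa using ((hasDerivAt_id z).const_add 1).clog h1

/-- `(1 + z)^{-n} L^m exp(-L² + c L)` with `L = log (1 + z)`. -/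
def gaussLog (c : ℂ) (n m : ℕ) (z : ℂ) : ℂ :=
  (1 + z)⁻¹ ^ n * log (1 + z) ^ m * cexp (-log (1 + z) ^ 2 + c * log (1 + z))

/-- With x = Re L and |Im L| ≤ π, the factor e^{-x²} absorbs e^{n|x|} from the powers of (1+z)⁻¹,
e^{|x|} from L^m and e^{|x|} from e^{cL}. The constant contains (n+2)²/4, the maximum of (n+2)|x| -
x². -/
lemma gaussLog_bounded {c : ℂ} (hc : ‖c‖ ≤ 1) (n m : ℕ) :
    ∃ C, 0 ≤ C ∧ ∀ z ≠ -1, ‖gaussLog c n m z‖ ≤ C := by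
  refine ⟨m.factorial * Real.exp ((n + 2) ^ 2 / 4 + Real.pi ^ 2 + 2 * Real.pi), by positivity,
    fun z hz => ?_⟩
  have hz0 : 1 + z ≠ 0 := one_add_ne_zero_iff.2 hz
  set L := log (1 + z) with hL
  have hx : L.re = Real.log ‖1 + z‖ := log_re _
  have hy : |L.im| ≤ Real.pi := by rw [hL, log_im]; exact abs_arg_le_pi _
  have hLn : ‖L‖ ≤ |L.re| + Real.pi := (norm_le_abs_re_add_abs_im L).trans (by linarith)
  have h1 : ‖(1 + z)⁻¹ ^ n‖ ≤ Real.exp (n * |L.re|) := by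
    rw [norm_pow, norm_inv, ← Real.exp_log (norm_pos_iff.2 hz0), ← hx, ← Real.exp_neg,
      ← Real.exp_nat_mul]
    gcongr
    exact neg_le_abs _
  have h2 : ‖L ^ m‖ ≤ m.factorial * Real.exp (|L.re| + Real.pi) := by
    rw [norm_pow]
    have := Real.pow_div_factorial_le_exp (x := ‖L‖) (norm_nonneg _) m
    rw [div_le_iff₀ (by positivity), mul_comm] at this
    refine this.trans ?_
    gcongr
  have h3 : ‖cexp (-L ^ 2 + c * L)‖ ≤
      Real.exp (-L.re ^ 2 + Real.pi ^ 2 + (|L.re| + Real.pi)) := by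
    rw [Complex.norm_exp, add_re]
    gcongr
    · have : L.im ^ 2 ≤ Real.pi ^ 2 := sq_le_sq' (by linarith [(abs_le.1 hy).1])
        (abs_le.1 hy).2
      simp [sq] at this ⊢
      linarith
    · refine ((re_le_norm _).trans ?_).trans hLn
      rw [norm_mul]
      exact mul_le_of_le_one_left (norm_nonneg _) hc
  calc ‖gaussLog c n m z‖ ≤ Real.exp (n * |L.re|) *
        (m.factorial * Real.exp (|L.re| + Real.pi)) *
        Real.exp (-L.re ^ 2 + Real.pi ^ 2 + (|L.re| + Real.pi)) := by
        rw [gaussLog, norm_mul, norm_mul]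
        gcongr
    _ = m.factorial * Real.exp (n * |L.re| + (|L.re| + Real.pi) +
        (-L.re ^ 2 + Real.pi ^ 2 + (|L.re| + Real.pi))) := by
        rw [Real.exp_add (n * |L.re| + _), Real.exp_add (n * |L.re|)]; ring
    _ ≤ _ := by
        refine mul_le_mul_of_nonneg_left (Real.exp_le_exp.2 ?_) (by positivity)
        nlinarith [sq_nonneg (|L.re| - (n + 2) / 2), sq_abs L.re]

/-- The family is closed under differentiation, which turns the uniform bound into bounds for all
derivatives. At m = 0 the truncated `m - 1` comes with coefficient 0. -/
lemma hasDerivAt_gaussLog (c : ℂ) (n m : ℕ) {z : ℂ} (hz : z ∈ halfPlane) :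
    HasDerivAt (gaussLog c n m) ((c - n) * gaussLog c (n + 1) m z +
      (m * gaussLog c (n + 1) (m - 1) z + (-2) * gaussLog c (n + 1) (m + 1) z)) z := by
  have hz0 : 1 + z ≠ 0 := one_add_ne_zero_iff.2 (ne_neg_one_of_mem_halfPlane hz)
  have hL := hasDerivAt_log_one_add hz
  have h1 : HasDerivAt (fun z : ℂ => (1 + z)⁻¹) (-(1 + z)⁻¹ ^ 2) z := by
    refine (((hasDerivAt_id z).const_add 1).inv hz0).congr_deriv ?_
    simp [neg_div]
  have h2 := ((h1.pow n).mul (hL.pow m)).mul (((hL.pow 2).neg.add (hL.const_mul c)).cexp)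
  refine h2.congr_deriv ?_
  simp only [Pi.mul_apply, Pi.pow_apply, Pi.neg_apply, Pi.add_apply]
  have hn : (n : ℂ) * (1 + z)⁻¹ ^ (n - 1) * (-(1 + z)⁻¹ ^ 2) = -(n * (1 + z)⁻¹ ^ (n + 1)) := by
    cases n with
    | zero => simp
    | succ n => simp only [Nat.add_sub_cancel, pow_succ]; ring
  rw [hn]
  simp only [gaussLog]
  push_cast
  ring

lemma HolderClass.of_hasDerivAt {α : ℝ} {U : Set ℂ} (hU : IsOpen U) {k : ℕ} {f f' : ℂ → ℂ}
    (hb : ∃ C, ∀ z ∈ U, ‖f z‖ ≤ C) (hd : ∀ z ∈ U, HasDerivAt f (f' z) z)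
    (hf' : HolderClass α U k ℂ f') : HolderClass α U (k + 1) ℂ f := by
  refine ⟨hb, fun z hz => (hd z hz).differentiableAt.restrictScalars ℝ,
    (hf'.clm_comp hU (ContinuousLinearMap.mul ℝ ℂ)).congr hU fun z hz => ?_⟩
  have h1 := (hd z hz).complexToReal_fderiv.fderiv
  rw [h1]
  ext
  simp

lemma gaussLog_holderClass {α : ℝ} (hα : α ∈ Set.Ioc (0 : ℝ) 1) {c : ℂ} (hc : ‖c‖ ≤ 1)
    (k n m : ℕ) : HolderClass α disc k ℂ (gaussLog c n m) := by
  have hne : ∀ z ∈ disc, z ≠ -1 := fun z hz =>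
    ne_neg_one_of_mem_halfPlane (disc_subset_halfPlane hz)
  have hb : ∀ n m, ∃ C, ∀ z ∈ disc, ‖gaussLog c n m z‖ ≤ C := fun n m => by
    obtain ⟨C, _, hC⟩ := gaussLog_bounded hc n m
    exact ⟨C, fun z hz => hC z (hne z hz)⟩
  induction k generalizing n m with
  | zero =>
    refine ⟨hb n m, ?_⟩
    obtain ⟨C₁, hC₁⟩ := hb (n + 1) m
    obtain ⟨C₂, hC₂⟩ := hb (n + 1) (m - 1)
    obtain ⟨C₃, hC₃⟩ := hb (n + 1) (m + 1)
    have h0 : (0 : ℂ) ∈ disc := by simp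
    have hD : ∀ z ∈ disc, ‖(c - n) * gaussLog c (n + 1) m z +
        (m * gaussLog c (n + 1) (m - 1) z + (-2) * gaussLog c (n + 1) (m + 1) z)‖ ≤
        ‖c - n‖ * C₁ + (‖(m : ℂ)‖ * C₂ + ‖(-2 : ℂ)‖ * C₃) := fun z hz => by
      refine norm_add_le_of_le ?_ (norm_add_le_of_le ?_ ?_)
      · rw [norm_mul]; gcongr; exact hC₁ z hz
      · rw [norm_mul]; gcongr; exact hC₂ z hz
      · rw [norm_mul]; gcongr; exact hC₃ z hz
    refine HolderClass.holder_of_fderiv_bounded hα (convex_ball _ _) Metric.isBounded_ball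
      ((norm_nonneg _).trans (hD 0 h0)) (fun z hz => (hasDerivAt_gaussLog c n m
        (disc_subset_halfPlane hz)).differentiableAt.restrictScalars ℝ) fun z hz => ?_
    rw [(hasDerivAt_gaussLog c n m (disc_subset_halfPlane hz)).complexToReal_fderiv.fderiv]
    refine (norm_smul_le _ _).trans ?_
    rw [norm_one, mul_one]
    exact hD z hz
  | succ k ih =>
    refine HolderClass.of_hasDerivAt Metric.isOpen_ball (hb n m)
      (fun z hz => hasDerivAt_gaussLog c n m (disc_subset_halfPlane hz)) ?_
    have hmul : ∀ (a : ℂ) {f : ℂ → ℂ}, HolderClass α disc k ℂ f →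
        HolderClass α disc k ℂ (fun z => a * f z) := fun a f hf =>
      hf.clm_comp Metric.isOpen_ball (ContinuousLinearMap.mul ℝ ℂ a)
    exact (hmul _ (ih _ _)).add Metric.isOpen_ball
      ((hmul _ (ih _ _)).add Metric.isOpen_ball (hmul _ (ih _ _)))

/-- The function `exp(-L²) sin L`, `L = log (1 + z)`, extended by `0` at `-1`. -/
def flatSine (z : ℂ) : ℂ :=
  if z = -1 then 0 else cexp (-log (1 + z) ^ 2) * sin (log (1 + z))

/-- The derivative of `flatSine` on the half plane. -/
def flatSineDeriv (z : ℂ) : ℂ :=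
  (1 + z)⁻¹ * cexp (-log (1 + z) ^ 2) * (cos (log (1 + z)) - 2 * log (1 + z) * sin (log (1 + z)))

lemma flatSine_neg_one : flatSine (-1) = 0 := if_pos rfl

lemma flatSine_of_ne {z : ℂ} (hz : z ≠ -1) :
    flatSine z = cexp (-log (1 + z) ^ 2) * sin (log (1 + z)) := if_neg hz

/-- Writing sin L as two exponentials explains the parameter c: only c = ±i occur, both of modulus
1. -/
lemma flatSine_eq_gaussLog {z : ℂ} (hz : z ≠ -1) :
    flatSine z = I / 2 * gaussLog (-I) 0 0 z + (-I / 2) * gaussLog I 0 0 z := by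
  rw [flatSine_of_ne hz, gaussLog, gaussLog, Complex.sin, Complex.exp_add, Complex.exp_add]
  rw [neg_mul, neg_mul, mul_comm I (log (1 + z))]
  ring

lemma hasDerivAt_flatSine {z : ℂ} (hz : z ∈ halfPlane) :
    HasDerivAt flatSine (flatSineDeriv z) z := by
  have hL := hasDerivAt_log_one_add hz
  have h1 := (hL.pow 2).neg.cexp.mul hL.csin
  have h2 : HasDerivAt (fun z => cexp (-log (1 + z) ^ 2) * sin (log (1 + z)))
      (flatSineDeriv z) z := by
    refine h1.congr_deriv ?_
    simp only [flatSineDeriv, Pi.neg_apply, Pi.pow_apply]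
    push_cast
    ring
  refine h2.congr_of_eventuallyEq ?_
  filter_upwards [isOpen_halfPlane.mem_nhds hz] with w hw
  exact flatSine_of_ne (ne_neg_one_of_mem_halfPlane hw)

lemma differentiableOn_flatSine : DifferentiableOn ℂ flatSine halfPlane := fun _ hz =>
  (hasDerivAt_flatSine hz).differentiableAt.differentiableWithinAt

lemma flatSine_holderClass {α : ℝ} (hα : α ∈ Set.Ioc (0 : ℝ) 1) (k : ℕ) :
    HolderClass α disc k ℂ flatSine := by
  have hmul : ∀ (a : ℂ) {f : ℂ → ℂ}, HolderClass α disc k ℂ f →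
      HolderClass α disc k ℂ (fun z => a * f z) := fun a f hf =>
    hf.clm_comp Metric.isOpen_ball (ContinuousLinearMap.mul ℝ ℂ a)
  refine ((hmul (I / 2) (gaussLog_holderClass hα (c := -I) (by simp) k 0 0)).add
    Metric.isOpen_ball (hmul (-I / 2) (gaussLog_holderClass hα (c := I) (by simp) k 0 0))).congr
    Metric.isOpen_ball fun z hz => ?_
  exact (flatSine_eq_gaussLog (ne_neg_one_of_mem_halfPlane (disc_subset_halfPlane hz))).symm

/-- `flatSine` vanishes to infinite order at `-1`. -/
lemma norm_flatSine_le (N : ℕ) : ∃ C, 0 ≤ C ∧ ∀ z, ‖flatSine z‖ ≤ C * ‖1 + z‖ ^ N := by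
  obtain ⟨C₁, h₁, hC₁⟩ := gaussLog_bounded (c := -I) (by simp) N 0
  obtain ⟨C₂, h₂, hC₂⟩ := gaussLog_bounded (c := I) (by simp) N 0
  refine ⟨C₁ + C₂, by positivity, fun z => ?_⟩
  by_cases hz : z = -1
  · rw [hz, flatSine_neg_one, norm_zero]; positivity
  have hz0 : 1 + z ≠ 0 := one_add_ne_zero_iff.2 hz
  -- Pulling out (1+z)^N leaves a member of the same bounded family.
  have h : ∀ c, gaussLog c 0 0 z = (1 + z) ^ N * gaussLog c N 0 z := fun c => by
    rw [gaussLog, gaussLog, ← mul_assoc, ← mul_assoc, ← mul_pow (1 + z), mul_inv_cancel₀ hz0]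
    simp
  rw [flatSine_eq_gaussLog hz, h, h]
  refine (norm_add_le _ _).trans ?_
  simp only [norm_mul, norm_div, norm_neg, norm_I, norm_pow, Complex.norm_ofNat]
  have h1 := hC₁ z hz
  have h2 := hC₂ z hz
  have h3 : 0 ≤ ‖1 + z‖ ^ N := by positivity
  nlinarith [mul_le_mul_of_nonneg_left h1 h3, mul_le_mul_of_nonneg_left h2 h3,
    mul_nonneg h3 h₁, mul_nonneg h3 h₂]

lemma flatSine_bounded : ∃ R, 0 < R ∧ ∀ z, ‖flatSine z‖ < R := by
  obtain ⟨C, hC0, hC⟩ := norm_flatSine_le 0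
  exact ⟨C + 1, by positivity, fun z => (hC z).trans_lt (by simp)⟩

lemma continuousAt_flatSine_neg_one : ContinuousAt flatSine (-1) := by
  obtain ⟨C, _, hC⟩ := norm_flatSine_le 1
  rw [ContinuousAt, flatSine_neg_one]
  refine squeeze_zero_norm hC ?_
  have : Continuous fun z : ℂ => C * ‖1 + z‖ ^ 1 := by fun_prop
  have h := this.tendsto (-1)
  simpa using h

lemma continuousOn_flatSine : ContinuousOn flatSine (Metric.closedBall 0 1) := by
  intro z hz
  rw [mem_closedBall_zero_iff] at hz
  by_cases h : z = -1
  · rw [h]; exact continuousAt_flatSine_neg_one.continuousWithinAt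
  · exact (hasDerivAt_flatSine
      (mem_halfPlane_of_norm_le hz h)).continuousAt.continuousWithinAt

lemma flatSine_eq_zero_iff {z : ℂ} (hz : z ≠ -1) :
    flatSine z = 0 ↔ sin (log (1 + z)) = 0 := by
  rw [flatSine_of_ne hz, mul_eq_zero, or_iff_right (Complex.exp_ne_zero _)]

/-- Zeros are simple because sine and cosine have no common zero. -/
lemma flatSineDeriv_ne_zero {z : ℂ} (hz : z ≠ -1) (h : flatSine z = 0) :
    flatSineDeriv z ≠ 0 := by
  rw [flatSine_eq_zero_iff hz] at h
  have hc : cos (log (1 + z)) ≠ 0 := fun hc => by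
    have := Complex.sin_sq_add_cos_sq (log (1 + z))
    simp [h, hc] at this
  rw [flatSineDeriv, h, mul_zero, sub_zero]
  exact mul_ne_zero (mul_ne_zero (inv_ne_zero (one_add_ne_zero_iff.2 hz))
    (Complex.exp_ne_zero _)) hc

/-- At a zero 1 + z = e^{kπ} with k an integer. Since |1+z| ≤ 2 < 1 + π ≤ e^π, only k ≤ 0 is
possible, and then z lies in (-1, 0]. Hence there is no zero on the unit circle apart from -1. -/
lemma norm_lt_one_of_flatSine_eq_zero {z : ℂ} (hz : ‖z‖ ≤ 1) (h1 : z ≠ -1)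
    (h : flatSine z = 0) : ‖z‖ < 1 := by
  rw [flatSine_eq_zero_iff h1, Complex.sin_eq_zero_iff] at h
  obtain ⟨k, hk⟩ := h
  have hz0 : 1 + z ≠ 0 := one_add_ne_zero_iff.2 h1
  have hexp : 1 + z = ((Real.exp (k * Real.pi) : ℝ) : ℂ) := by
    rw [← Complex.exp_log hz0, hk]; push_cast; rfl
  have h2 : Real.exp (k * Real.pi) ≤ 2 := by
    have : ‖1 + z‖ ≤ 2 := (norm_add_le _ _).trans (by rw [norm_one]; linarith)
    rwa [hexp, Complex.norm_real, Real.norm_of_nonneg (Real.exp_pos _).le] at this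
  have hk0 : k ≤ 0 := by
    by_contra hk0
    have : (1 : ℝ) ≤ k := by exact_mod_cast (not_le.1 hk0 : (0 : ℤ) < k)
    have h3 := Real.add_one_le_exp (k * Real.pi)
    nlinarith [Real.pi_gt_three]
  have h3 : Real.exp (k * Real.pi) ≤ 1 := by
    rw [Real.exp_le_one_iff]
    have : (k : ℝ) ≤ 0 := by exact_mod_cast hk0
    nlinarith [Real.pi_pos]
  have hzz : z = ((Real.exp (k * Real.pi) - 1 : ℝ) : ℂ) := by
    push_cast; push_cast at hexp; rw [← hexp]; ring
  rw [hzz, Complex.norm_real, Real.norm_eq_abs, abs_lt]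
  constructor <;> linarith [Real.exp_pos (k * Real.pi)]

lemma flatSine_eventually_ne {z : ℂ} (hz : z ∈ halfPlane) :
    ∀ᶠ w in 𝓝[≠] z, flatSine w ≠ 0 := by
  by_cases h : flatSine z = 0
  · exact (hasDerivAt_flatSine hz).eventually_ne
      (flatSineDeriv_ne_zero (ne_neg_one_of_mem_halfPlane hz) h)
  · exact ((hasDerivAt_flatSine hz).continuousAt.eventually_ne h).filter_mono nhdsWithin_le_nhds

lemma flatSineDeriv_eq {z : ℂ} (hz : z ∈ halfPlane) : deriv flatSine z = flatSineDeriv z :=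
  (hasDerivAt_flatSine hz).deriv

lemma differentiableOn_flatSineDeriv : DifferentiableOn ℂ flatSineDeriv halfPlane :=
  (differentiableOn_flatSine.deriv isOpen_halfPlane).congr fun _ hz => (flatSineDeriv_eq hz).symm

/-- Identity theorem: accumulating zeros would make the derivative vanish on the half plane, but it
equals 1 at the origin. This isolates the branch points. -/
lemma flatSineDeriv_eventually_ne {z : ℂ} (hz : z ∈ halfPlane) :
    ∀ᶠ w in 𝓝[≠] z, flatSineDeriv w ≠ 0 := by
  by_contra hcon
  have han := differentiableOn_flatSineDeriv.analyticOnNhd isOpen_halfPlane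
  have h0 := han.eqOn_zero_of_preconnected_of_frequently_eq_zero
    convex_halfPlane.isPreconnected hz (by simpa only [Filter.Frequently, ne_eq] using hcon)
  have h1 : (0 : ℂ) ∈ halfPlane := by simp [halfPlane]
  have := h0 h1
  simp [flatSineDeriv] at this

/-- The zeros of `flatSine` in the disc. -/
def zeroSet : Set ℂ := {z | z ∈ disc ∧ flatSine z = 0}

lemma exists_seq_zeroSet : ∃ a : ℕ → ℂ, Function.Injective a ∧ (∀ k, a k ∈ zeroSet) ∧
    Tendsto a atTop (𝓝 (-1)) := by
  have hexp : ∀ k : ℕ, (1 : ℂ) + ((Real.exp (-(k * Real.pi)) - 1 : ℝ) : ℂ) =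
      ((Real.exp (-(k * Real.pi)) : ℝ) : ℂ) := fun k => by push_cast; ring
  refine ⟨fun k => ((Real.exp (-(k * Real.pi)) - 1 : ℝ) : ℂ), fun k l hkl => ?_, fun k => ?_, ?_⟩
  · have h1 := Complex.ofReal_injective hkl
    have h2 := Real.exp_injective (sub_left_injective h1)
    have h3 : (k : ℝ) * Real.pi = l * Real.pi := neg_injective h2
    exact_mod_cast mul_right_cancel₀ Real.pi_ne_zero h3
  · have hne : ((Real.exp (-(k * Real.pi)) - 1 : ℝ) : ℂ) ≠ -1 := by
      rw [← one_add_ne_zero_iff, hexp]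
      exact_mod_cast (Real.exp_pos _).ne'
    have hpos := Real.exp_pos (-(k * Real.pi))
    have hle : Real.exp (-(k * Real.pi)) ≤ 1 := by
      rw [Real.exp_le_one_iff, neg_nonpos]; positivity
    refine ⟨?_, ?_⟩
    · rw [mem_ball_zero_iff, Complex.norm_real, Real.norm_eq_abs, abs_lt]
      constructor <;> linarith
    · rw [flatSine_eq_zero_iff hne, hexp, ← Complex.ofReal_log hpos.le, Real.log_exp,
        Complex.sin_eq_zero_iff]
      exact ⟨-k, by push_cast; ring⟩
  · have h1 : Tendsto (fun k : ℕ => Real.exp (-(k * Real.pi)) - 1) atTop (𝓝 (0 - 1)) := by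
      refine (Real.tendsto_exp_neg_atTop_nhds_zero.comp ?_).sub_const 1
      exact tendsto_natCast_atTop_atTop.atTop_mul_const Real.pi_pos
    have h2 := (Complex.continuous_ofReal.tendsto _).comp h1
    simpa [Function.comp_def] using h2

lemma zeroSet_subset : zeroSet ⊆ disc := fun _ hz => hz.1

lemma zeroSet_infinite : zeroSet.Infinite := by
  obtain ⟨a, ha, hm, _⟩ := exists_seq_zeroSet
  exact (Set.infinite_range_of_injective ha).mono (Set.range_subset_iff.2 hm)

lemma zeroSet_isolated {z : ℂ} (hz : z ∈ halfPlane) : ∀ᶠ w in 𝓝[≠] z, w ∉ zeroSet := by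
  filter_upwards [flatSine_eventually_ne hz] with w hw h using hw h.2

lemma derivedSet_zeroSet : derivedSet zeroSet = {(-1 : ℂ)} := by
  ext z
  rw [mem_derivedSet, accPt_iff_frequently_nhdsNE, Set.mem_singleton_iff]
  constructor
  · intro h
    by_contra hz
    have hcl : z ∈ Metric.closedBall (0 : ℂ) 1 := by
      refine Metric.closure_ball_subset_closedBall (closure_mono zeroSet_subset ?_)
      exact mem_closure_iff_frequently.2 (h.filter_mono nhdsWithin_le_nhds)
    rw [mem_closedBall_zero_iff] at hcl
    exact h (zeroSet_isolated (mem_halfPlane_of_norm_le hcl hz))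
  · rintro rfl
    obtain ⟨a, _, hm, ht⟩ := exists_seq_zeroSet
    have h1 : Tendsto a atTop (𝓝[≠] (-1)) := tendsto_nhdsWithin_iff.2 ⟨ht,
      Eventually.of_forall fun k =>
        ne_neg_one_of_mem_halfPlane (disc_subset_halfPlane (hm k).1)⟩
    exact h1.frequently (Eventually.of_forall hm).frequently

/-! ### Smoothness of the trace -/

/-- Functions on the unit circle, of polynomial growth at `-1` together with their derivatives. -/
inductive IsTame : (ℝ → ℂ) → Prop
  | const (c : ℂ) : IsTame fun _ => c
  | exp : IsTame fun θ => cexp (θ * I)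
  | inv : IsTame fun θ => (1 + cexp (θ * I))⁻¹
  | log : IsTame fun θ => Complex.log (1 + cexp (θ * I))
  | cot : IsTame fun θ =>
      Complex.cos (Complex.log (1 + cexp (θ * I))) / Complex.sin (Complex.log (1 + cexp (θ * I)))
  | star {P : ℝ → ℂ} : IsTame P → IsTame fun θ => (starRingEnd ℂ) (P θ)
  | add {P Q : ℝ → ℂ} : IsTame P → IsTame Q → IsTame fun θ => P θ + Q θ
  | mul {P Q : ℝ → ℂ} : IsTame P → IsTame Q → IsTame fun θ => P θ * Q θ

lemma norm_exp_mul_I (θ : ℝ) : ‖cexp (θ * I)‖ = 1 := Complex.norm_exp_ofReal_mul_I θ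

lemma hasDerivAt_exp_mul_I (θ : ℝ) :
    HasDerivAt (fun θ : ℝ => cexp (θ * I)) (cexp (θ * I) * I) θ := by
  simpa using ((hasDerivAt_id θ).ofReal_comp.mul_const I).cexp

lemma flatSine_exp_ne_zero {θ : ℝ} (h : cexp (θ * I) ≠ -1) : flatSine (cexp (θ * I)) ≠ 0 :=
  fun h0 => by
    have := norm_lt_one_of_flatSine_eq_zero (norm_exp_mul_I θ).le h h0
    rw [norm_exp_mul_I] at this
    exact lt_irrefl _ this

/-- The generators are chosen so that differentiation stays inside the algebra; for the cotangent,
cot' = -(1 + cot²). Conjugates are included because monomials involve the conjugate of h. -/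
lemma IsTame.hasDerivAt {P : ℝ → ℂ} (hP : IsTame P) :
    ∃ Q, IsTame Q ∧ ∀ θ : ℝ, cexp (θ * I) ≠ -1 → HasDerivAt P (Q θ) θ := by
  have hlog : ∀ θ : ℝ, cexp (θ * I) ≠ -1 →
      HasDerivAt (fun θ : ℝ => Complex.log (1 + cexp (θ * I)))
        ((1 + cexp (θ * I))⁻¹ * (cexp (θ * I) * I)) θ := fun θ hθ =>
    HasDerivAt.comp (h₂ := fun z => Complex.log (1 + z)) θ
      (hasDerivAt_log_one_add (mem_halfPlane_of_norm_le (norm_exp_mul_I θ).le hθ))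
      (hasDerivAt_exp_mul_I θ)
  induction hP with
  | const c => exact ⟨_, .const 0, fun θ _ => hasDerivAt_const θ c⟩
  | exp => exact ⟨_, .mul .exp (.const I), fun θ _ => hasDerivAt_exp_mul_I θ⟩
  | inv =>
    refine ⟨_, .mul (.const (-1)) (.mul (.mul .inv .inv) (.mul .exp (.const I))), fun θ hθ => ?_⟩
    refine (((hasDerivAt_exp_mul_I θ).const_add 1).inv (one_add_ne_zero_iff.2 hθ)).congr_deriv ?_
    rw [div_eq_mul_inv, sq, mul_inv]
    ring
  | log => exact ⟨_, .mul .inv (.mul .exp (.const I)), hlog⟩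
  | cot =>
    refine ⟨_, .mul (.const (-1)) (.mul (.add (.const 1) (.mul .cot .cot))
      (.mul .inv (.mul .exp (.const I)))), fun θ hθ => ?_⟩
    have hs := flatSine_exp_ne_zero hθ
    rw [Ne, flatSine_eq_zero_iff hθ] at hs
    refine (((Complex.hasDerivAt_cos _).comp θ (hlog θ hθ)).div
      ((Complex.hasDerivAt_sin _).comp θ (hlog θ hθ)) hs).congr_deriv ?_
    simp only [Function.comp_apply]
    field_simp
    ring
  | star _ ih =>
    obtain ⟨Q, hQ, h⟩ := ih
    exact ⟨_, .star hQ, fun θ hθ => (h θ hθ).star⟩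
  | add _ _ ih₁ ih₂ =>
    obtain ⟨Q₁, hQ₁, h₁⟩ := ih₁
    obtain ⟨Q₂, hQ₂, h₂⟩ := ih₂
    exact ⟨_, .add hQ₁ hQ₂, fun θ hθ => (h₁ θ hθ).add (h₂ θ hθ)⟩
  | mul hP₁ hP₂ ih₁ ih₂ =>
    obtain ⟨Q₁, hQ₁, h₁⟩ := ih₁
    obtain ⟨Q₂, hQ₂, h₂⟩ := ih₂
    exact ⟨_, .add (.mul hQ₁ hP₂) (.mul hP₁ hQ₂), fun θ hθ => (h₁ θ hθ).mul (h₂ θ hθ)⟩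

lemma norm_cos_le (L : ℂ) : ‖Complex.cos L‖ ≤ Real.exp |L.im| := by
  have h1 : ‖cexp (L * I)‖ ≤ Real.exp |L.im| := by
    rw [Complex.norm_exp]; gcongr; simpa using neg_le_abs L.im
  have h2 : ‖cexp (-L * I)‖ ≤ Real.exp |L.im| := by
    rw [Complex.norm_exp]; gcongr; simpa using le_abs_self L.im
  rw [Complex.cos, norm_div, Complex.norm_ofNat, div_le_iff₀ (by norm_num)]
  exact (norm_add_le _ _).trans (by linarith)

/-- The two exponentials in sin L have moduli e^{∓Im L}; for |Im L| ≥ 1 one is at least 2 and the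
other at most 1. -/
lemma le_norm_sin {L : ℂ} (h : 1 ≤ |L.im|) : 1 / 2 ≤ ‖Complex.sin L‖ := by
  have h1 : ‖cexp (L * I)‖ = Real.exp (-L.im) := by rw [Complex.norm_exp]; simp
  have h2 : ‖cexp (-L * I)‖ = Real.exp L.im := by rw [Complex.norm_exp]; simp
  rw [Complex.sin, norm_div, norm_mul, norm_I, mul_one, Complex.norm_ofNat]
  have h3 := abs_norm_sub_norm_le (cexp (-L * I)) (cexp (L * I))
  rw [h1, h2] at h3
  refine div_le_div_of_nonneg_right (le_trans ?_ h3) (by norm_num)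
  rcases le_abs.1 h with h4 | h4
  · have h5 := Real.add_one_le_exp L.im
    have h6 : Real.exp (-L.im) ≤ 1 := Real.exp_le_one_iff.2 (by linarith)
    exact le_abs.2 (Or.inl (by linarith))
  · have h5 := Real.add_one_le_exp (-L.im)
    have h6 : Real.exp (L.im) ≤ 1 := Real.exp_le_one_iff.2 (by linarith)
    exact le_abs.2 (Or.inr (by linarith))

/-- On the unit circle Re(1+z) = |1+z|²/2, so the cosine of arg(1+z) is |1+z|/2 < 1/2, whereas |arg|
< 1 would give at least 1 - 1/2. This keeps the circle near -1 away from the real zeros and bounds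
the cotangent there. -/
lemma one_le_abs_arg {z : ℂ} (hz : ‖z‖ = 1) (h : z ≠ -1) (h1 : ‖1 + z‖ < 1) :
    1 ≤ |(Complex.log (1 + z)).im| := by
  have hz0 : 1 + z ≠ 0 := one_add_ne_zero_iff.2 h
  rw [log_im]
  by_contra hcon
  push Not at hcon
  have h2 := Complex.cos_arg hz0
  have h3 := Real.one_sub_sq_div_two_le_cos (x := arg (1 + z))
  have h4 : arg (1 + z) ^ 2 < 1 := by rw [← sq_abs]; nlinarith [abs_nonneg (arg (1 + z))]
  have hpos : 0 < ‖1 + z‖ := norm_pos_iff.2 hz0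
  have h5 : (1 + z).re = ‖1 + z‖ ^ 2 / 2 := by
    have e1 := Complex.normSq_eq_norm_sq z
    rw [← Complex.normSq_eq_norm_sq (1 + z), Complex.normSq_apply]
    rw [hz, Complex.normSq_apply] at e1
    simp
    nlinarith
  have h6 : Real.cos (arg (1 + z)) = ‖1 + z‖ / 2 := by
    rw [h2, h5]; field_simp
  rw [h6] at h3
  linarith

/-- Restricting to |1+e^{iθ}| < 1 makes larger powers of the inverse larger, so that exponents can
be added for sums too. The logarithm costs one power; the cotangent is bounded by `le_norm_sin`. -/
lemma IsTame.norm_le {P : ℝ → ℂ} (hP : IsTame P) : ∃ (N : ℕ) (C : ℝ), 0 ≤ C ∧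
    ∀ θ : ℝ, cexp (θ * I) ≠ -1 → ‖1 + cexp (θ * I)‖ < 1 →
      ‖P θ‖ ≤ C * ‖1 + cexp (θ * I)‖⁻¹ ^ N := by
  induction hP with
  | const c => exact ⟨0, ‖c‖, norm_nonneg _, fun θ _ _ => by simp⟩
  | exp => exact ⟨0, 1, zero_le_one, fun θ _ _ => by simp⟩
  | inv => exact ⟨1, 1, zero_le_one, fun θ _ _ => by simp⟩
  | log =>
    refine ⟨1, 1 + Real.pi, by positivity, fun θ hθ h1 => ?_⟩
    have hpos : 0 < ‖1 + cexp (θ * I)‖ := norm_pos_iff.2 (one_add_ne_zero_iff.2 hθ)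
    have hinv : 1 ≤ ‖1 + cexp (θ * I)‖⁻¹ := (one_le_inv₀ hpos).2 h1.le
    refine (norm_le_abs_re_add_abs_im _).trans ?_
    rw [log_re, log_im, pow_one, add_mul, one_mul]
    refine add_le_add ?_ ?_
    · rw [abs_of_nonpos (Real.log_nonpos hpos.le h1.le), ← Real.log_inv]
      exact (Real.log_le_sub_one_of_pos (by positivity)).trans (by linarith)
    · exact (abs_arg_le_pi _).trans (le_mul_of_one_le_right Real.pi_pos.le hinv)
  | cot =>
    refine ⟨0, 2 * Real.exp Real.pi, by positivity, fun θ hθ h1 => ?_⟩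
    have hs := le_norm_sin (one_le_abs_arg (norm_exp_mul_I θ) hθ h1)
    rw [pow_zero, mul_one, norm_div, div_le_iff₀ (by linarith)]
    have hc : ‖Complex.cos (Complex.log (1 + cexp (θ * I)))‖ ≤ Real.exp Real.pi :=
      (norm_cos_le _).trans (Real.exp_le_exp.2 (by rw [log_im]; exact abs_arg_le_pi _))
    nlinarith [Real.exp_pos Real.pi]
  | star _ ih => simpa using ih
  | add _ _ ih₁ ih₂ =>
    obtain ⟨N₁, C₁, h₁, hC₁⟩ := ih₁
    obtain ⟨N₂, C₂, h₂, hC₂⟩ := ih₂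
    refine ⟨N₁ + N₂, C₁ + C₂, by positivity, fun θ hθ h1 => ?_⟩
    have hpos : 0 < ‖1 + cexp (θ * I)‖ := norm_pos_iff.2 (one_add_ne_zero_iff.2 hθ)
    have hinv : 1 ≤ ‖1 + cexp (θ * I)‖⁻¹ := (one_le_inv₀ hpos).2 h1.le
    rw [add_mul]
    refine norm_add_le_of_le ((hC₁ θ hθ h1).trans ?_) ((hC₂ θ hθ h1).trans ?_)
    · gcongr; simp_all
    · gcongr; simp_all
  | mul _ _ ih₁ ih₂ =>
    obtain ⟨N₁, C₁, h₁, hC₁⟩ := ih₁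
    obtain ⟨N₂, C₂, h₂, hC₂⟩ := ih₂
    refine ⟨N₁ + N₂, C₁ * C₂, by positivity, fun θ hθ h1 => ?_⟩
    rw [norm_mul, pow_add, mul_mul_mul_comm]
    exact mul_le_mul (hC₁ θ hθ h1) (hC₂ θ hθ h1) (norm_nonneg _) (by positivity)

/-! ### Monomials of `flatSine` along the unit circle -/

lemma monomial_zero {c : ℝ} {a b : ℕ} (hab : a + b ≠ 0) : monomial c a b 0 = 0 := by
  rw [monomial]
  rcases Nat.eq_zero_or_pos a with h | h
  · rw [map_zero, zero_pow (by omega : b ≠ 0), mul_zero]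
  · rw [zero_pow h.ne']; simp

/-- Over the point -1 the flatness of h beats the growth of P, so the product is O((θ - θ₀)²). -/
lemma hasDerivAt_monomial_mul_tame_of_eq {c : ℝ} {a b : ℕ} (hab : a + b ≠ 0)
    (hs : 1 ≤ c + a + b) {P : ℝ → ℂ} (hP : IsTame P) {θ₀ : ℝ} (h0 : cexp (θ₀ * I) = -1) :
    HasDerivAt (fun θ : ℝ => monomial c a b (flatSine (cexp (θ * I))) * P θ) 0 θ₀ := by
  obtain ⟨N, C, hC0, hC⟩ := hP.norm_le
  -- N powers cancel the growth of P; the other two give the quadratic decay.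
  obtain ⟨D, hD0, hD⟩ := norm_flatSine_le (N + 2)
  have he : ContinuousAt (fun θ : ℝ => cexp (θ * I)) θ₀ :=
    (hasDerivAt_exp_mul_I θ₀).continuousAt
  have hW0 : monomial c a b (flatSine (-1)) = 0 := by
    rw [flatSine_neg_one, monomial_zero hab]
  have ev1 : ∀ᶠ θ : ℝ in 𝓝 θ₀, ‖1 + cexp (θ * I)‖ < 1 := by
    have h1 : ContinuousAt (fun θ : ℝ => ‖1 + cexp (θ * I)‖) θ₀ :=
      (continuousAt_const.add he).norm
    refine h1.eventually_lt continuousAt_const ?_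
    rw [h0]; simp
  have ev2 : ∀ᶠ θ : ℝ in 𝓝 θ₀, ‖flatSine (cexp (θ * I))‖ < 1 := by
    have h2 : ContinuousAt (fun θ : ℝ => flatSine (cexp (θ * I))) θ₀ := by
      refine ContinuousAt.comp (g := flatSine) ?_ he
      rw [h0]
      exact continuousAt_flatSine_neg_one
    refine h2.norm.eventually_lt continuousAt_const ?_
    rw [h0, flatSine_neg_one]; simp
  have hO : (fun θ : ℝ => monomial c a b (flatSine (cexp (θ * I))) * P θ) =O[𝓝 θ₀]
      fun θ : ℝ => ‖cexp (θ * I) - cexp (θ₀ * I)‖ ^ 2 := by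
    refine Asymptotics.IsBigO.of_bound (D * C) ?_
    filter_upwards [ev1, ev2] with θ h1 h2
    rw [h0, sub_neg_eq_add, add_comm (cexp (θ * I)), norm_pow, norm_norm]
    by_cases hθ : cexp (θ * I) = -1
    · rw [hθ, hW0, zero_mul, norm_zero]; positivity
    have hpos : 0 < ‖1 + cexp (θ * I)‖ := norm_pos_iff.2 (one_add_ne_zero_iff.2 hθ)
    have hne := flatSine_exp_ne_zero hθ
    rw [norm_mul, norm_monomial _ _ _ hne]
    calc _ ≤ ‖flatSine (cexp (θ * I))‖ ^ (1 : ℝ) * (C * ‖1 + cexp (θ * I)‖⁻¹ ^ N) := by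
          refine mul_le_mul ?_ (hC θ hθ h1) (norm_nonneg _) (by positivity)
          exact Real.rpow_le_rpow_of_exponent_ge (norm_pos_iff.2 hne) h2.le hs
      _ ≤ D * ‖1 + cexp (θ * I)‖ ^ (N + 2) * (C * ‖1 + cexp (θ * I)‖⁻¹ ^ N) := by
          rw [Real.rpow_one]
          gcongr
          exact hD _
      _ = D * C * ‖1 + cexp (θ * I)‖ ^ 2 := by
          rw [pow_add, inv_pow]
          field_simp
  rw [hasDerivAt_iff_isLittleO]
  simp only [h0, hW0, zero_mul, sub_zero, smul_zero]
  refine hO.trans_isLittleO ?_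
  have h3 : (fun θ : ℝ => cexp (θ * I) - cexp (θ₀ * I)) =O[𝓝 θ₀] fun θ => θ - θ₀ :=
    (hasDerivAt_exp_mul_I θ₀).hasFDerivAt.isBigO_sub
  refine (h3.norm_left.pow 2).trans_isLittleO ?_
  have h4 : (fun θ : ℝ => θ - θ₀) =o[𝓝 θ₀] fun _ => (1 : ℝ) := by
    rw [Asymptotics.isLittleO_one_iff]
    simpa using (continuous_id.sub continuous_const).tendsto (f := fun θ : ℝ => θ - θ₀) θ₀
  simpa [sq] using (Asymptotics.isBigO_refl (fun θ : ℝ => θ - θ₀) (𝓝 θ₀)).mul_isLittleO h4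

/-- Away from -1 the logarithmic derivative T of θ ↦ h(e^{iθ}) is tame, so the derivative is the
same monomial times a new tame factor. At -1 both sides vanish, whatever value that factor takes. -/
lemma hasDerivAt_monomial_mul_tame {c : ℝ} {a b : ℕ} (hab : a + b ≠ 0)
    (hs : 1 ≤ c + a + b) {P : ℝ → ℂ} (hP : IsTame P) : ∃ R, IsTame R ∧ ∀ θ : ℝ,
      HasDerivAt (fun θ : ℝ => monomial c a b (flatSine (cexp (θ * I))) * P θ)
        (monomial c a b (flatSine (cexp (θ * I))) * R θ) θ := by
  obtain ⟨Q, hQ, hPQ⟩ := hP.hasDerivAt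
  set T : ℝ → ℂ := fun θ => (1 + cexp (θ * I))⁻¹ *
    (cos (log (1 + cexp (θ * I))) / sin (log (1 + cexp (θ * I))) +
      (-2) * log (1 + cexp (θ * I))) * (cexp (θ * I) * I) with hT
  have hTt : IsTame T :=
    .mul (.mul .inv (.add .cot (.mul (.const (-2)) .log))) (.mul .exp (.const I))
  refine ⟨fun θ => (c * ((1 / 2) * (T θ + conj (T θ))) + a * T θ + b * conj (T θ)) * P θ + Q θ,
    .add (.mul (.add (.add (.mul (.const c) (.mul (.const (1 / 2)) (.add hTt hTt.star)))
      (.mul (.const a) hTt)) (.mul (.const b) hTt.star)) hP) hQ, fun θ => ?_⟩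
  by_cases hθ : cexp (θ * I) = -1
  · refine (hasDerivAt_monomial_mul_tame_of_eq hab hs hP hθ).congr_deriv ?_
    rw [hθ, flatSine_neg_one, monomial_zero hab, zero_mul]
  · have hne := flatSine_exp_ne_zero hθ
    have hs := hne
    rw [Ne, flatSine_eq_zero_iff hθ] at hs
    have h1 : HasDerivAt (fun θ : ℝ => flatSine (cexp (θ * I)))
        (flatSine (cexp (θ * I)) * T θ) θ := by
      refine ((hasDerivAt_flatSine (mem_halfPlane_of_norm_le (norm_exp_mul_I θ).le hθ)).comp
        θ (hasDerivAt_exp_mul_I θ)).congr_deriv ?_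
      rw [flatSine_of_ne hθ, hT, flatSineDeriv]
      field_simp
      ring
    refine ((hasDerivAt_monomial_comp c a b h1 hne).mul (hPQ θ hθ)).congr_deriv ?_
    rw [Complex.re_eq_add_conj]
    ring

lemma contDiff_monomial_flatSine {c : ℝ} {a b : ℕ} (hab : a + b ≠ 0) (hs : 1 ≤ c + a + b) :
    ContDiff ℝ ∞ (fun θ : ℝ => monomial c a b (flatSine (cexp (θ * I)))) := by
  -- The induction needs all tame factors at once, since each derivative changes the factor; P = 1
  -- is the case of interest.
  have key : ∀ (n : ℕ) {P : ℝ → ℂ}, IsTame P →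
      ContDiff ℝ n (fun θ : ℝ => monomial c a b (flatSine (cexp (θ * I))) * P θ) := by
    intro n
    induction n with
    | zero =>
      intro P hP
      obtain ⟨R, _, hd⟩ := hasDerivAt_monomial_mul_tame hab hs hP
      exact contDiff_zero.2 (continuous_iff_continuousAt.2 fun θ => (hd θ).continuousAt)
    | succ n ih =>
      intro P hP
      obtain ⟨R, hR, hd⟩ := hasDerivAt_monomial_mul_tame hab hs hP
      rw [Nat.cast_succ, contDiff_succ_iff_deriv]
      refine ⟨fun θ => (hd θ).differentiableAt, by simp, ?_⟩
      rw [funext fun θ => (hd θ).deriv]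
      exact ih hR
  refine contDiff_infty.2 fun n => ?_
  simpa using key n (.const 1)

lemma contDiff_trace {j : ℕ} (hj : 1 ≤ j) :
    ContDiff ℝ ∞ (fun θ : ℝ => cone j (flatSine (cexp (θ * I)))) := by
  have h1 : (1 : ℝ) ≤ j := by exact_mod_cast hj
  have h2 := coneDegree_gt hj
  refine contDiff_piLp' 2 fun i => ?_
  fin_cases i
  · exact contDiff_const.mul (contDiff_monomial_flatSine (by omega) (by push_cast; linarith))
  · exact contDiff_const.mul (contDiff_monomial_flatSine (by omega) (by push_cast; linarith))

/-! ### Weak derivatives -/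

namespace IsTestFunction

variable {φ : ℂ → ℝ}

lemma fderiv_apply (hφ : IsTestFunction φ) (v : ℂ) :
    IsTestFunction (fun z => fderiv ℝ φ z v) where
  smooth := (hφ.smooth.fderiv_right (m := ∞) (by simp)).clm_apply contDiff_const
  compact := (hφ.compact.fderiv (𝕜 := ℝ)).comp_left (g := fun T : ℂ →L[ℝ] ℝ => T v) (by simp)
  support_subset := by
    refine (closure_mono ?_).trans ((tsupport_fderiv_subset ℝ).trans hφ.support_subset)
    intro z hz hz0
    exact hz (by simp [hz0])

lemma eq_zero (hφ : IsTestFunction φ) {z : ℂ} (hz : z ∉ disc) : φ z = 0 :=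
  image_eq_zero_of_notMem_tsupport fun h => hz (hφ.support_subset h)

lemma bounded (hφ : IsTestFunction φ) : ∃ C, ∀ z, ‖φ z‖ ≤ C :=
  hφ.compact.exists_bound_of_continuous hφ.smooth.continuous

lemma integrable_smul {E : Type*} [NormedAddCommGroup E] [NormedSpace ℝ E]
    (hφ : IsTestFunction φ) {u : ℂ → E} (hu : LocallyIntegrableOn u disc) :
    Integrable (fun z => φ z • u z) := by
  rw [← integrableOn_iff_integrable_of_support_subset (s := tsupport φ)]
  · exact (hu.integrableOn_compact_subset hφ.support_subset hφ.compact).continuousOn_smul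
      hφ.smooth.continuous.continuousOn hφ.compact
  · intro z hz
    exact subset_tsupport φ fun h => hz (by simp [h])

lemma setIntegral_smul {E : Type*} [NormedAddCommGroup E] [NormedSpace ℝ E]
    (hφ : IsTestFunction φ) (u : ℂ → E) : ∫ z in disc, φ z • u z = ∫ z, φ z • u z :=
  setIntegral_eq_integral_of_forall_compl_eq_zero fun z hz => by rw [hφ.eq_zero hz, zero_smul]

lemma fderiv_comm (hφ : IsTestFunction φ) (v w z : ℂ) :
    fderiv ℝ (fun z => fderiv ℝ φ z v) z w = fderiv ℝ (fun z => fderiv ℝ φ z w) z v := by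
  have hd : DifferentiableAt ℝ (fderiv ℝ φ) z :=
    ((hφ.smooth.fderiv_right (m := ∞) (by simp)).differentiable (by simp)) z
  have h : ∀ v w, fderiv ℝ (fun z => fderiv ℝ φ z v) z w = fderiv ℝ (fderiv ℝ φ) z w v :=
    fun v w => by
      rw [fderiv_clm_apply hd (differentiableAt_const v)]
      simp
  rw [h, h]
  exact (hφ.smooth.contDiffAt.isSymmSndFDerivAt
    (by simpa using WithTop.coe_le_coe.2 (le_top : (2 : ℕ∞) ≤ ⊤))).eq w v

end IsTestFunction

lemma integrableOn_of_tendsto {E : Type*} [NormedAddCommGroup E] {u : ℕ → ℂ → E} {v : ℂ → E}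
    {b : ℂ → ℝ} (hb : IntegrableOn b disc)
    (hu : ∀ n, AEStronglyMeasurable (u n) (volume.restrict disc))
    (hle : ∀ n, ∀ᵐ z ∂volume.restrict disc, ‖u n z‖ ≤ b z)
    (hlim : ∀ᵐ z ∂volume.restrict disc, Tendsto (fun n => u n z) atTop (𝓝 (v z))) :
    IntegrableOn v disc := by
  refine Integrable.mono' hb (aestronglyMeasurable_of_tendsto_ae atTop hu hlim) ?_
  filter_upwards [hlim, ae_all_iff.2 hle] with z h1 h2
  exact le_of_tendsto h1.norm (Eventually.of_forall h2)

section

variable {E : Type*} [NormedAddCommGroup E] [NormedSpace ℝ E]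

lemma continuousOn_fderiv_apply {f : ℂ → E} (hf : ContDiffOn ℝ 1 f disc) (v : ℂ) :
    ContinuousOn (fun z => fderiv ℝ f z v) disc :=
  (hf.continuousOn_fderiv_of_isOpen Metric.isOpen_ball le_rfl).clm_apply continuousOn_const

lemma integral_fderiv_smul_eq {f : ℂ → E} (hf : ContDiffOn ℝ 1 f disc) {φ : ℂ → ℝ}
    (hφ : IsTestFunction φ) (v : ℂ) :
    ∫ z in disc, fderiv ℝ φ z v • f z = -∫ z in disc, φ z • fderiv ℝ f z v := by
  have hm : MeasurableSet disc := measurableSet_ball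
  rw [(hφ.fderiv_apply v).setIntegral_smul, hφ.setIntegral_smul, eq_comm, neg_eq_iff_eq_neg]
  refine integral_smul_fderiv_eq_neg_fderiv_smul_of_integrable
    ((hφ.fderiv_apply v).integrable_smul (hf.continuousOn.locallyIntegrableOn hm))
    (hφ.integrable_smul ((continuousOn_fderiv_apply hf v).locallyIntegrableOn hm))
    (hφ.integrable_smul (hf.continuousOn.locallyIntegrableOn hm))
    (fun z _ => hφ.smooth.differentiable (by simp) z) (fun z hz => ?_)
  exact (hf.differentiableOn one_ne_zero).differentiableAt
    (Metric.isOpen_ball.mem_nhds (hφ.support_subset hz))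

/-- The classical derivatives of a `C¹` function are its weak derivatives. -/
lemma hasWeakGradient_of_contDiffOn {f : ℂ → E} (hf : ContDiffOn ℝ 1 f disc) :
    HasWeakGradient f (fun z => fderiv ℝ f z 1) (fun z => fderiv ℝ f z I) where
  loc := hf.continuousOn.locallyIntegrableOn measurableSet_ball
  loc_x := (continuousOn_fderiv_apply hf 1).locallyIntegrableOn measurableSet_ball
  loc_y := (continuousOn_fderiv_apply hf I).locallyIntegrableOn measurableSet_ball
  weak_x _ hφ := integral_fderiv_smul_eq hf hφ 1
  weak_y _ hφ := integral_fderiv_smul_eq hf hφ I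

/-- The curl of a gradient vanishes weakly for f merely C¹: both derivatives are moved onto the test
function, whose second derivative is symmetric. -/
lemma integral_fderiv_smul_fderiv_sub_eq_zero {f : ℂ → E} (hf : ContDiffOn ℝ 1 f disc) {φ : ℂ → ℝ}
    (hφ : IsTestFunction φ) :
    ∫ z in disc, (fderiv ℝ φ z 1 • fderiv ℝ f z I - fderiv ℝ φ z I • fderiv ℝ f z 1) = 0 := by
  have hi : ∀ v w, IntegrableOn (fun z => fderiv ℝ φ z v • fderiv ℝ f z w) disc := fun v w =>
    ((hφ.fderiv_apply v).integrable_smul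
      ((continuousOn_fderiv_apply hf w).locallyIntegrableOn measurableSet_ball)).integrableOn
  have h1 := integral_fderiv_smul_eq hf (hφ.fderiv_apply 1) I
  have h2 := integral_fderiv_smul_eq hf (hφ.fderiv_apply I) 1
  rw [integral_sub (hi 1 I) (hi I 1), sub_eq_zero, ← neg_inj, ← h1, ← h2]
  simp only [hφ.fderiv_comm 1 I]

lemma tendsto_integral_smul {u : ℕ → ℂ → E} {v : ℂ → E} {b : ℂ → ℝ} (hb : IntegrableOn b disc)
    (hu : ∀ n, AEStronglyMeasurable (u n) (volume.restrict disc))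
    (hle : ∀ n, ∀ᵐ z ∂volume.restrict disc, ‖u n z‖ ≤ b z)
    (hlim : ∀ᵐ z ∂volume.restrict disc, Tendsto (fun n => u n z) atTop (𝓝 (v z)))
    {φ : ℂ → ℝ} (hφ : IsTestFunction φ) :
    Tendsto (fun n => ∫ z in disc, φ z • u n z) atTop (𝓝 (∫ z in disc, φ z • v z)) := by
  obtain ⟨C, hC⟩ := hφ.bounded
  refine tendsto_integral_of_dominated_convergence (fun z => C * b z)
    (fun n => hφ.smooth.continuous.aestronglyMeasurable.smul (hu n)) (hb.const_mul C)
    (fun n => ?_) ?_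
  · filter_upwards [hle n] with z hz
    rw [norm_smul]
    exact mul_le_mul (hC z) hz (norm_nonneg _) ((norm_nonneg _).trans (hC z))
  · filter_upwards [hlim] with z hz using hz.const_smul _

/-- Weak gradients pass to dominated limits. -/
lemma hasWeakGradient_of_tendsto {u : ℕ → ℂ → E} (hC : ∀ n, ContDiffOn ℝ 1 (u n) disc)
    {v vx vy : ℂ → E} {b : ℂ → ℝ} (hb : IntegrableOn b disc)
    (hle : ∀ n, ∀ᵐ z ∂volume.restrict disc,
      ‖u n z‖ ≤ b z ∧ ‖fderiv ℝ (u n) z 1‖ ≤ b z ∧ ‖fderiv ℝ (u n) z I‖ ≤ b z)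
    (hlim : ∀ᵐ z ∂volume.restrict disc, Tendsto (fun n => u n z) atTop (𝓝 (v z)) ∧
      Tendsto (fun n => fderiv ℝ (u n) z 1) atTop (𝓝 (vx z)) ∧
      Tendsto (fun n => fderiv ℝ (u n) z I) atTop (𝓝 (vy z))) :
    HasWeakGradient v vx vy := by
  have m0 : ∀ n, AEStronglyMeasurable (u n) (volume.restrict disc) := fun n =>
    (hC n).continuousOn.aestronglyMeasurable measurableSet_ball
  have md : ∀ v n, AEStronglyMeasurable (fun z => fderiv ℝ (u n) z v) (volume.restrict disc) :=
    fun v n => (continuousOn_fderiv_apply (hC n) v).aestronglyMeasurable measurableSet_ball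
  have l0 := fun n => (hle n).mono fun z h => h.1
  have l1 := fun n => (hle n).mono fun z h => h.2.1
  have l2 := fun n => (hle n).mono fun z h => h.2.2
  have t0 := hlim.mono fun z h => h.1
  have t1 := hlim.mono fun z h => h.2.1
  have t2 := hlim.mono fun z h => h.2.2
  refine ⟨(integrableOn_of_tendsto hb m0 l0 t0).locallyIntegrableOn,
    (integrableOn_of_tendsto hb (md 1) l1 t1).locallyIntegrableOn,
    (integrableOn_of_tendsto hb (md I) l2 t2).locallyIntegrableOn, fun φ hφ => ?_, fun φ hφ => ?_⟩
  · refine tendsto_nhds_unique (tendsto_integral_smul hb m0 l0 t0 (hφ.fderiv_apply 1)) ?_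
    simp only [fun n => integral_fderiv_smul_eq (hC n) hφ 1]
    exact (tendsto_integral_smul hb (md 1) l1 t1 hφ).neg
  · refine tendsto_nhds_unique (tendsto_integral_smul hb m0 l0 t0 (hφ.fderiv_apply I)) ?_
    simp only [fun n => integral_fderiv_smul_eq (hC n) hφ I]
    exact (tendsto_integral_smul hb (md I) l2 t2 hφ).neg

end

/-! ### The phase of a holomorphic function -/

/-- `w / |w|`, with value `1` at `0`. -/
def phase (w : ℂ) : ℂ := if w = 0 then 1 else w / ‖w‖

lemma phase_of_ne {w : ℂ} (hw : w ≠ 0) : phase w = w / ‖w‖ := if_neg hw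

lemma norm_phase (w : ℂ) : ‖phase w‖ = 1 := by
  by_cases hw : w = 0
  · simp [phase, hw]
  · rw [phase_of_ne hw, norm_div, Complex.norm_real, norm_norm,
      div_self (norm_ne_zero_iff.2 hw)]

lemma measurable_phase : Measurable phase :=
  Measurable.ite (measurableSet_singleton 0) measurable_const (by fun_prop)

/-- A smooth approximation of the phase. -/
def regPhase (δ : ℝ) (w : ℂ) : ℂ := w / (Real.sqrt (‖w‖ ^ 2 + δ) : ℝ)

/-- A smooth approximation of `log |w|`. -/
def regLog (δ : ℝ) (w : ℂ) : ℂ := ((Real.log (‖w‖ ^ 2 + δ) / 2 : ℝ) : ℂ)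

lemma contDiff_regPhase {δ : ℝ} (hδ : 0 < δ) : ContDiff ℝ ∞ (regPhase δ) := by
  have h0 : ∀ w : ℂ, ‖w‖ ^ 2 + δ ≠ 0 := fun w => by positivity
  have h1 : ContDiff ℝ ∞ (fun w : ℂ => Real.sqrt (‖w‖ ^ 2 + δ)) :=
    ((contDiff_norm_sq ℝ).add contDiff_const).sqrt h0
  have h2 : regPhase δ = fun w => (Real.sqrt (‖w‖ ^ 2 + δ))⁻¹ • w := by
    ext w
    rw [regPhase, Complex.real_smul, ofReal_inv, div_eq_inv_mul]
  rw [h2]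
  refine (h1.inv fun w => ?_).smul contDiff_id
  exact (Real.sqrt_pos.2 (by positivity)).ne'

lemma contDiff_regLog {δ : ℝ} (hδ : 0 < δ) : ContDiff ℝ ∞ (regLog δ) := by
  have h0 : ∀ w : ℂ, ‖w‖ ^ 2 + δ ≠ 0 := fun w => by positivity
  exact Complex.ofRealCLM.contDiff.comp
    ((((contDiff_norm_sq ℝ).add contDiff_const).log h0).div_const 2)

lemma fderiv_eq_of_hasDerivAt_line {E : Type*} [NormedAddCommGroup E] [NormedSpace ℝ E]
    {f : ℂ → E} {w v : ℂ} {d : E} (hf : DifferentiableAt ℝ f w)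
    (hd : HasDerivAt (fun t : ℝ => f (w + t • v)) d 0) : fderiv ℝ f w v = d := by
  have h1 : HasDerivAt (fun t : ℝ => w + t • v) v 0 := by
    simpa using ((hasDerivAt_id (0 : ℝ)).smul_const v).const_add w
  exact (hf.hasFDerivAt.comp_hasDerivAt_of_eq (0 : ℝ) h1 (by simp)).unique hd

lemma hasDerivAt_norm_sq_line (w v : ℂ) (δ : ℝ) :
    HasDerivAt (fun t : ℝ => ‖w + t • v‖ ^ 2 + δ) (2 * (conj w * v).re) 0 := by
  have h1 : HasDerivAt (fun t : ℝ => w + t • v) v 0 := by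
    simpa using ((hasDerivAt_id (0 : ℝ)).smul_const v).const_add w
  refine (h1.norm_sq.add_const δ).congr_deriv ?_
  rw [Complex.inner]
  simp [mul_comm]

lemma fderiv_regPhase {δ : ℝ} (hδ : 0 < δ) (w v : ℂ) :
    fderiv ℝ (regPhase δ) w v = (v - w * ((conj w * v).re / (‖w‖ ^ 2 + δ) : ℝ)) /
      (Real.sqrt (‖w‖ ^ 2 + δ) : ℝ) := by
  refine fderiv_eq_of_hasDerivAt_line ((contDiff_regPhase hδ).differentiable (by simp) w) ?_
  have hpos : 0 < ‖w‖ ^ 2 + δ := by positivity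
  have hs : 0 < Real.sqrt (‖w‖ ^ 2 + δ) := Real.sqrt_pos.2 hpos
  have h1 : HasDerivAt (fun t : ℝ => w + t • v) v 0 := by
    simpa using ((hasDerivAt_id (0 : ℝ)).smul_const v).const_add w
  have h2 := ((hasDerivAt_norm_sq_line w v δ).sqrt (by simpa using hpos.ne')).ofReal_comp
  refine (h1.div h2 (by simpa using hs.ne')).congr_deriv ?_
  have h3 : ((Real.sqrt (‖w‖ ^ 2 + δ) : ℝ) : ℂ) ≠ 0 := by exact_mod_cast hs.ne'
  have h4 : ((‖w‖ ^ 2 + δ : ℝ) : ℂ) = ((Real.sqrt (‖w‖ ^ 2 + δ) : ℝ) : ℂ) ^ 2 := by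
    rw [← ofReal_pow, Real.sq_sqrt hpos.le]
  simp only [zero_smul, add_zero, ofReal_div, h4]
  push_cast
  field_simp

lemma fderiv_regLog {δ : ℝ} (hδ : 0 < δ) (w v : ℂ) :
    fderiv ℝ (regLog δ) w v = ((conj w * v).re / (‖w‖ ^ 2 + δ) : ℝ) := by
  refine fderiv_eq_of_hasDerivAt_line ((contDiff_regLog hδ).differentiable (by simp) w) ?_
  have hpos : 0 < ‖w‖ ^ 2 + δ := by positivity
  have h2 := (((hasDerivAt_norm_sq_line w v δ).log (by simpa using hpos.ne')).div_const
    2).ofReal_comp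
  refine h2.congr_deriv ?_
  simp only [zero_smul, add_zero]
  congr 1
  ring

/-- Uniform in δ: for v = h' it gives the dominating function 2|h'/h|. -/
lemma norm_fderiv_regPhase_le {δ : ℝ} (hδ : 0 < δ) {w : ℂ} (hw : w ≠ 0) (v : ℂ) :
    ‖fderiv ℝ (regPhase δ) w v‖ ≤ 2 * ‖v / w‖ := by
  have hw0 : 0 < ‖w‖ := norm_pos_iff.2 hw
  have hpos : 0 < ‖w‖ ^ 2 + δ := by positivity
  have hs : ‖w‖ ≤ Real.sqrt (‖w‖ ^ 2 + δ) := Real.le_sqrt_of_sq_le (by linarith)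
  have h1 : ‖w * ((conj w * v).re / (‖w‖ ^ 2 + δ) : ℝ)‖ ≤ ‖v‖ := by
    rw [norm_mul, Complex.norm_real, norm_div, Real.norm_of_nonneg hpos.le, ← mul_div_assoc,
      div_le_iff₀ hpos]
    have : ‖(conj w * v).re‖ ≤ ‖w‖ * ‖v‖ := by
      refine (abs_re_le_norm _).trans_eq ?_
      rw [norm_mul, RCLike.norm_conj]
    nlinarith [norm_nonneg v, mul_le_mul_of_nonneg_left this hw0.le, mul_nonneg hδ.le (norm_nonneg v)]
  rw [fderiv_regPhase hδ, norm_div, norm_div, Complex.norm_real,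
    Real.norm_of_nonneg (Real.sqrt_nonneg _), ← mul_div_assoc]
  exact div_le_div₀ (by positivity) ((norm_sub_le _ _).trans (by linarith)) hw0 hs

lemma norm_fderiv_regLog_le {δ : ℝ} (hδ : 0 < δ) {w : ℂ} (hw : w ≠ 0) (v : ℂ) :
    ‖fderiv ℝ (regLog δ) w v‖ ≤ ‖v / w‖ := by
  have hw0 : 0 < ‖w‖ := norm_pos_iff.2 hw
  have hpos : 0 < ‖w‖ ^ 2 + δ := by positivity
  rw [fderiv_regLog hδ, Complex.norm_real, norm_div, Real.norm_of_nonneg hpos.le, norm_div,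
    div_le_div_iff₀ hpos hw0]
  have : ‖(conj w * v).re‖ ≤ ‖w‖ * ‖v‖ := by
    refine (abs_re_le_norm _).trans_eq ?_
    rw [norm_mul, RCLike.norm_conj]
  nlinarith [norm_nonneg v, mul_le_mul_of_nonneg_right this hw0.le, mul_nonneg hδ.le (norm_nonneg v)]

lemma norm_regPhase_le {δ : ℝ} (hδ : 0 < δ) (w : ℂ) : ‖regPhase δ w‖ ≤ 1 := by
  rw [regPhase, norm_div, Complex.norm_real, Real.norm_of_nonneg (Real.sqrt_nonneg _)]
  exact div_le_one_of_le₀ (Real.le_sqrt_of_sq_le (by linarith)) (Real.sqrt_nonneg _)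

lemma re_conj_mul_div {w : ℂ} (hw : w ≠ 0) (v : ℂ) :
    (conj w * v).re / ‖w‖ ^ 2 = (v / w).re := by
  have h : conj w * v = ((‖w‖ ^ 2 : ℝ) : ℂ) * (v / w) := by
    rw [← Complex.normSq_eq_norm_sq, ← Complex.mul_conj]
    field_simp
  have hw0 : 0 < ‖w‖ := norm_pos_iff.2 hw
  rw [h, re_ofReal_mul]
  field_simp

section Limits

variable {δ : ℕ → ℝ} {w : ℂ}

lemma tendsto_sqrt_reg (hδ : Tendsto δ atTop (𝓝 0)) :
    Tendsto (fun n => ((Real.sqrt (‖w‖ ^ 2 + δ n) : ℝ) : ℂ)) atTop (𝓝 (‖w‖ : ℂ)) := by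
  have := (hδ.const_add (‖w‖ ^ 2)).sqrt
  rw [add_zero, Real.sqrt_sq (norm_nonneg _)] at this
  exact (Complex.continuous_ofReal.tendsto _).comp this

lemma tendsto_ratio (hδ : Tendsto δ atTop (𝓝 0)) (hw : w ≠ 0) (v : ℂ) :
    Tendsto (fun n => (conj w * v).re / (‖w‖ ^ 2 + δ n)) atTop (𝓝 (v / w).re) := by
  have hw0 : 0 < ‖w‖ := norm_pos_iff.2 hw
  rw [← re_conj_mul_div hw]
  have := (hδ.const_add (‖w‖ ^ 2))
  rw [add_zero] at this
  exact tendsto_const_nhds.div this (by positivity)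

lemma tendsto_regPhase (hδ : Tendsto δ atTop (𝓝 0)) (hw : w ≠ 0) :
    Tendsto (fun n => regPhase (δ n) w) atTop (𝓝 (phase w)) := by
  rw [phase_of_ne hw]
  exact tendsto_const_nhds.div (tendsto_sqrt_reg hδ) (by simpa using hw)

/-- Since v/w is the increment of log w, in the limit the radial part Re(v/w) drops out and the
rotation by Im(v/w) remains. -/
lemma tendsto_fderiv_regPhase (hδ : Tendsto δ atTop (𝓝 0)) (hδ0 : ∀ n, 0 < δ n) (hw : w ≠ 0)
    (v : ℂ) : Tendsto (fun n => fderiv ℝ (regPhase (δ n)) w v) atTop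
    (𝓝 (phase w * (I * (v / w).im))) := by
  have h1 : phase w * (I * (v / w).im) = (v - w * ((v / w).re : ℝ)) / ‖w‖ := by
    have h2 : v = w * (((v / w).re : ℂ) + (v / w).im * I) := by
      rw [re_add_im]; field_simp
    rw [phase_of_ne hw]
    conv_rhs => rw [h2]
    have h3 : w * (((v / w).re : ℂ) + (v / w).im * I) / w = v / w := by rw [← h2]
    rw [h3]
    ring
  rw [h1]
  simp only [fun n => fderiv_regPhase (hδ0 n) w v]
  refine Tendsto.div ?_ (tendsto_sqrt_reg hδ) (by simpa using hw)
  exact tendsto_const_nhds.sub (tendsto_const_nhds.mul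
    ((Complex.continuous_ofReal.tendsto _).comp (tendsto_ratio hδ hw v)))

lemma tendsto_fderiv_regLog (hδ : Tendsto δ atTop (𝓝 0)) (hδ0 : ∀ n, 0 < δ n) (hw : w ≠ 0)
    (v : ℂ) : Tendsto (fun n => fderiv ℝ (regLog (δ n)) w v) atTop
    (𝓝 ((v / w).re : ℂ)) := by
  simp only [fun n => fderiv_regLog (hδ0 n) w v]
  exact (Complex.continuous_ofReal.tendsto _).comp (tendsto_ratio hδ hw v)

end Limits

section Holomorphic

variable {h h' : ℂ → ℂ}

lemma contDiffOn_of_holomorphic (hd : ∀ z ∈ disc, HasDerivAt h (h' z) z) :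
    ContDiffOn ℝ ∞ h disc :=
  (DifferentiableOn.contDiffOn (fun z hz => (hd z hz).differentiableAt.differentiableWithinAt)
    Metric.isOpen_ball).restrict_scalars ℝ

lemma fderiv_comp_holomorphic (hd : ∀ z ∈ disc, HasDerivAt h (h' z) z)
    {E : Type*} [NormedAddCommGroup E] [NormedSpace ℝ E] {f : ℂ → E} {z : ℂ} (hz : z ∈ disc) (hf : DifferentiableAt ℝ f (h z)) (v : ℂ) :
    fderiv ℝ (fun z => f (h z)) z v = fderiv ℝ f (h z) (h' z * v) := by
  have h1 := hf.hasFDerivAt.comp z (hd z hz).complexToReal_fderiv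
  have h2 := h1.fderiv
  simp only [Function.comp_def] at h2
  rw [h2]
  simp

/-- The weak gradient of the phase of a holomorphic function. -/
lemma hasWeakGradient_phase (hd : ∀ z ∈ disc, HasDerivAt h (h' z) z)
    (hint : IntegrableOn (fun z => h' z / h z) disc)
    (hne : ∀ᵐ z ∂volume.restrict disc, h z ≠ 0) :
    HasWeakGradient (fun z => phase (h z))
    (fun z => phase (h z) * (I * (h' z / h z).im))
    (fun z => phase (h z) * (I * (h' z / h z).re)) := by
  have hδ0 : ∀ n : ℕ, (0 : ℝ) < 1 / (n + 1) := fun n => by positivity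
  have hδ : Tendsto (fun n : ℕ => (1 : ℝ) / (n + 1)) atTop (𝓝 0) :=
    tendsto_one_div_add_atTop_nhds_zero_nat
  have hdisc : ∀ᵐ z ∂volume.restrict disc, z ∈ disc := ae_restrict_mem measurableSet_ball
  have hfd : ∀ n : ℕ, ∀ z ∈ disc, ∀ v, fderiv ℝ (fun z => regPhase (1 / ((n : ℝ) + 1)) (h z)) z v =
      fderiv ℝ (regPhase (1 / ((n : ℝ) + 1))) (h z) (h' z * v) := fun n z hz v =>
    fderiv_comp_holomorphic hd hz ((contDiff_regPhase (hδ0 n)).differentiable (by simp) _) v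
  have h1 : IntegrableOn (fun _ : ℂ => (1 : ℝ)) disc :=
    integrableOn_const (measure_ball_lt_top.ne)
  refine hasWeakGradient_of_tendsto (u := fun n z => regPhase (1 / ((n : ℝ) + 1)) (h z))
    (b := fun z => 1 + 2 * ‖h' z / h z‖) (fun n => ?_) (h1.add (hint.norm.const_mul 2))
    (fun n => ?_) ?_
  · exact ((contDiff_regPhase (hδ0 n)).comp_contDiffOn (contDiffOn_of_holomorphic hd)).of_le
      (by simp)
  · filter_upwards [hne, hdisc] with z hz hzd
    refine ⟨(norm_regPhase_le (hδ0 n) _).trans (by linarith [norm_nonneg (h' z / h z)]), ?_, ?_⟩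
    · rw [hfd n z hzd, mul_one]
      exact (norm_fderiv_regPhase_le (hδ0 n) hz _).trans (by linarith)
    · rw [hfd n z hzd]
      refine (norm_fderiv_regPhase_le (hδ0 n) hz _).trans ?_
      rw [norm_div, norm_mul, norm_I, mul_one, ← norm_div]
      linarith
  · filter_upwards [hne, hdisc] with z hz hzd
    refine ⟨tendsto_regPhase hδ hz, ?_, ?_⟩
    · simp only [fun n => hfd n z hzd, mul_one]
      exact tendsto_fderiv_regPhase hδ hδ0 hz _
    · simp only [fun n => hfd n z hzd]
      have := tendsto_fderiv_regPhase hδ hδ0 hz (h' z * I)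
      rwa [mul_div_right_comm, mul_I_im] at this

/-- The phase of a holomorphic function is a (singular) harmonic map into the circle. -/
lemma isCircleHarmonic_phase (hd : ∀ z ∈ disc, HasDerivAt h (h' z) z)
    (hint : IntegrableOn (fun z => h' z / h z) disc)
    (hne : ∀ᵐ z ∂volume.restrict disc, h z ≠ 0) :
    IsCircleHarmonic (fun z => phase (h z)) := by
  refine ⟨_, _, hasWeakGradient_phase hd hint hne, fun φ hφ => ?_⟩
  have hδ0 : ∀ n : ℕ, (0 : ℝ) < 1 / (n + 1) := fun n => by positivity
  have hδ : Tendsto (fun n : ℕ => (1 : ℝ) / (n + 1)) atTop (𝓝 0) :=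
    tendsto_one_div_add_atTop_nhds_zero_nat
  have hdisc : ∀ᵐ z ∂volume.restrict disc, z ∈ disc := ae_restrict_mem measurableSet_ball
  have hC : ∀ n : ℕ, ContDiffOn ℝ 1 (fun z => regLog (1 / ((n : ℝ) + 1)) (h z)) disc := fun n =>
    ((contDiff_regLog (hδ0 n)).comp_contDiffOn (contDiffOn_of_holomorphic hd)).of_le (by simp)
  have hfd : ∀ n : ℕ, ∀ z ∈ disc, ∀ v, fderiv ℝ (fun z => regLog (1 / ((n : ℝ) + 1)) (h z)) z v =
      fderiv ℝ (regLog (1 / ((n : ℝ) + 1))) (h z) (h' z * v) := fun n z hz v =>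
    fderiv_comp_holomorphic hd hz ((contDiff_regLog (hδ0 n)).differentiable (by simp) _) v
  have hlim : ∀ v, ‖v‖ = 1 → ∀ ψ, IsTestFunction ψ → Tendsto (fun n : ℕ => ∫ z in disc,
      ψ z • fderiv ℝ (fun z => regLog (1 / ((n : ℝ) + 1)) (h z)) z v) atTop
      (𝓝 (∫ z in disc, ψ z • ((h' z * v / h z).re : ℂ))) := fun v hv ψ hψ => by
    refine tendsto_integral_smul hint.norm
      (fun n => (continuousOn_fderiv_apply (hC n) v).aestronglyMeasurable measurableSet_ball)
      (fun n => ?_) ?_ hψ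
    · filter_upwards [hne, hdisc] with z hz hzd
      rw [hfd n z hzd]
      refine (norm_fderiv_regLog_le (hδ0 n) hz _).trans_eq ?_
      rw [norm_div, norm_mul, hv, mul_one, ← norm_div]
    · filter_upwards [hne, hdisc] with z hz hzd
      simp only [fun n => hfd n z hzd]
      exact tendsto_fderiv_regLog hδ hδ0 hz _
  have hint' : ∀ v, ∀ ψ, IsTestFunction ψ →
      IntegrableOn (fun z => ψ z • ((h' z * v / h z).re : ℂ)) disc := fun v ψ hψ => by
    refine (hψ.integrable_smul (IntegrableOn.locallyIntegrableOn ?_)).integrableOn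
    have : IntegrableOn (fun z => h' z * v / h z) disc := by
      simp only [mul_div_right_comm]
      exact hint.mul_const v
    exact Complex.ofRealCLM.integrable_comp (Complex.reCLM.integrable_comp this)
  -- By Cauchy–Riemann iḡ∇g is minus the rotated gradient of log|h|, so its divergence is a curl of
  -- ∇log|h|. That curl vanishes for every regularised logarithm, hence in the limit.
  have hzero : ∫ z in disc, (fderiv ℝ φ z 1 • ((h' z * I / h z).re : ℂ) -
      fderiv ℝ φ z I • ((h' z * 1 / h z).re : ℂ)) = 0 := by
    rw [integral_sub (hint' I _ (hφ.fderiv_apply 1)) (hint' 1 _ (hφ.fderiv_apply I))]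
    refine tendsto_nhds_unique ((hlim I norm_I _ (hφ.fderiv_apply 1)).sub
      (hlim 1 norm_one _ (hφ.fderiv_apply I))) ?_
    refine tendsto_const_nhds.congr fun n => ?_
    rw [← integral_fderiv_smul_fderiv_sub_eq_zero (hC n) hφ, integral_sub]
    · exact ((hφ.fderiv_apply 1).integrable_smul ((continuousOn_fderiv_apply
        (hC n) I).locallyIntegrableOn measurableSet_ball)).integrableOn
    · exact ((hφ.fderiv_apply I).integrable_smul ((continuousOn_fderiv_apply
        (hC n) 1).locallyIntegrableOn measurableSet_ball)).integrableOn
  rw [← hzero]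
  refine integral_congr_ae (Eventually.of_forall fun z => ?_)
  have hn : conj (phase (h z)) * phase (h z) = 1 := by
    rw [mul_comm, Complex.mul_conj, Complex.normSq_eq_norm_sq, norm_phase]; simp
  have key : ∀ x : ℂ, I * conj (phase (h z)) * (phase (h z) * (I * x)) = -x := fun x => by
    linear_combination (I * I * x) * hn + x * I_mul_I
  simp only [key, mul_one, mul_div_right_comm _ I, mul_I_re]
  simp only [smul_neg, ofReal_neg]
  ring

end Holomorphic

/-! ### Functions with poles of order one -/

/-- `f` grows at most like `1 / |z - x|` near `x`. -/
def HasPoleBound (f : ℂ → ℂ) (x : ℂ) : Prop := ∃ C, ∀ᶠ z in 𝓝 x, ‖f z‖ * ‖z - x‖ ≤ C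

/-- Near a simple zero |φ| ≥ |φ'(x)||z - x|/2 and |φ'| < 2|φ'(x)|, whence the constant 4. Elsewhere
the quotient is continuous. -/
lemma hasPoleBound_logDeriv {φ φ' : ℂ → ℂ} {x : ℂ} (hφ : HasDerivAt φ (φ' x) x)
    (hc : ContinuousAt φ' x) (hx : φ x = 0 → φ' x ≠ 0) :
    HasPoleBound (fun z => φ' z / φ z) x := by
  by_cases h0 : φ x = 0
  · have hne := hx h0
    have hpos : 0 < ‖φ' x‖ := norm_pos_iff.2 hne
    have h1 : ∀ᶠ z in 𝓝 x, ‖φ' z‖ < 2 * ‖φ' x‖ :=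
      hc.norm.eventually_lt continuousAt_const (by linarith)
    have h2 := (hasDerivAt_iff_isLittleO.1 hφ).def (c := ‖φ' x‖ / 2) (by positivity)
    refine ⟨4, ?_⟩
    filter_upwards [h1, h2] with z hz1 hz2
    rw [h0, sub_zero, smul_eq_mul] at hz2
    have h3 : ‖φ' x‖ / 2 * ‖z - x‖ ≤ ‖φ z‖ := by
      have h4 := norm_sub_norm_le ((z - x) * φ' x) (φ z)
      rw [norm_sub_rev, norm_mul] at h4
      linarith
    rw [norm_div, div_mul_eq_mul_div]
    refine div_le_of_le_mul₀ (norm_nonneg _) (by norm_num) ?_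
    nlinarith [norm_nonneg (z - x)]
  · have h1 : ContinuousAt (fun z => ‖φ' z / φ z‖ * ‖z - x‖) x :=
      (hc.div hφ.continuousAt h0).norm.mul (by fun_prop)
    refine ⟨1, (h1.eventually_lt continuousAt_const ?_).mono fun z hz => hz.le⟩
    simp

lemma HasPoleBound.exists_ball {f : ℂ → ℂ} {x : ℂ} (h : HasPoleBound f x) :
    ∃ C > 0, ∃ r > 0, ∀ z ∈ Metric.ball x r, ‖f z‖ * ‖z - x‖ ≤ C := by
  obtain ⟨C, hC⟩ := h
  obtain ⟨r, hr, h⟩ := Metric.eventually_nhds_iff_ball.1 hC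
  exact ⟨max C 1, by positivity, r, hr, fun z hz => (h z hz).trans (le_max_left _ _)⟩

/-- By compactness the claim is local. Near x the set |f| > t lies in a disc of radius C/t, whose
area πC²/t² is exactly what weak L² allows. -/
lemma memWeakL2_of_hasPoleBound {f : ℂ → ℂ} (hf : Measurable f) {K : Set ℂ} (hK : IsCompact K)
    (h : ∀ x ∈ K, HasPoleBound f x) : MemWeakL2 f (volume.restrict K) := by
  refine ⟨hf.aestronglyMeasurable, ?_⟩
  suffices H : ∃ C : ℝ≥0, ∀ t : ℝ≥0, (t : ℝ≥0∞) ^ 2 * volume ({z | t < ‖f z‖₊} ∩ K) ≤ C by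
    obtain ⟨C, hC⟩ := H
    refine ⟨C, fun t => ?_⟩
    rw [Measure.restrict_apply (measurableSet_lt measurable_const hf.nnnorm)]
    exact hC t
  refine hK.induction_on (p := fun s => ∃ C : ℝ≥0, ∀ t : ℝ≥0,
    (t : ℝ≥0∞) ^ 2 * volume ({z | t < ‖f z‖₊} ∩ s) ≤ C) ⟨0, by simp⟩ ?_ ?_ ?_
  · rintro s s' hs ⟨C, hC⟩
    exact ⟨C, fun t => le_trans (by gcongr) (hC t)⟩
  · rintro s s' ⟨C, hC⟩ ⟨D, hD⟩
    refine ⟨C + D, fun t => ?_⟩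
    rw [Set.inter_union_distrib_left, ENNReal.coe_add]
    refine le_trans ?_ (add_le_add (hC t) (hD t))
    rw [← mul_add]
    gcongr
    exact measure_union_le _ _
  · intro x hx
    obtain ⟨C, hC0, r, hr, hC⟩ := (h x hx).exists_ball
    refine ⟨Metric.ball x r, mem_nhdsWithin_of_mem_nhds (Metric.ball_mem_nhds x hr),
      Real.toNNReal C ^ 2 * NNReal.pi, fun t => ?_⟩
    rcases eq_or_ne t 0 with rfl | ht
    · simp
    have htpos : (0 : ℝ) < t := NNReal.coe_pos.2 (pos_iff_ne_zero.2 ht)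
    have hsub : {z | t < ‖f z‖₊} ∩ Metric.ball x r ⊆ Metric.closedBall x (C / t) := by
      rintro z ⟨hz, hzr⟩
      have hz' : (t : ℝ) < ‖f z‖ := hz
      rw [mem_closedBall_iff_norm, le_div_iff₀ htpos]
      nlinarith [hC z hzr, norm_nonneg (z - x)]
    calc (t : ℝ≥0∞) ^ 2 * volume ({z | t < ‖f z‖₊} ∩ Metric.ball x r)
        ≤ (t : ℝ≥0∞) ^ 2 * volume (Metric.closedBall x (C / t)) := by gcongr
      _ = ((Real.toNNReal C ^ 2 * NNReal.pi : ℝ≥0) : ℝ≥0∞) := by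
          rw [Complex.volume_closedBall, ENNReal.ofReal, Real.toNNReal_div hC0.le,
            Real.toNNReal_coe]
          norm_cast
          rw [div_pow, ← mul_assoc, mul_div_cancel₀ _ (pow_ne_zero 2 ht)]
      _ ≤ _ := le_rfl

/-- Again local by compactness: in the plane |z - x|^{-q} is integrable near x for q < 2. -/
lemma integrableOn_norm_rpow_of_hasPoleBound {f : ℂ → ℂ} (hf : Measurable f) {K : Set ℂ}
    (hK : IsCompact K) (h : ∀ x ∈ K, HasPoleBound f x) {q : ℝ} (hq0 : 0 ≤ q) (hq : q < 2) :
    IntegrableOn (fun z => ‖f z‖ ^ q) K := by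
  refine hK.induction_on (p := fun s => IntegrableOn (fun z => ‖f z‖ ^ q) s volume)
    integrableOn_empty (fun s s' hs h => h.mono_set hs) (fun s s' h h' => h.union h') ?_
  intro x hx
  obtain ⟨C, hC0, r, hr, hC⟩ := (h x hx).exists_ball
  refine ⟨Metric.ball x r, mem_nhdsWithin_of_mem_nhds (Metric.ball_mem_nhds x hr), ?_⟩
  have hpre : (fun y : ℂ => y + x) ⁻¹' Metric.ball x r = Metric.ball 0 r := by
    ext y; simp
  rw [← (measurePreserving_add_right volume x).integrableOn_comp_preimage
    (measurableEmbedding_addRight x), hpre]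
  refine integrableOn_ball_of_norm_le_rpow (C := C ^ q) (α := q) (by simp) (by simpa using hq) ?_
    (((hf.comp (measurable_add_const x)).norm.pow_const q).aestronglyMeasurable)
  have hne : ∀ᵐ y ∂(volume.restrict (Metric.ball (0 : ℂ) r)), y ≠ 0 :=
    ae_restrict_of_ae (by simp [ae_iff])
  filter_upwards [hne, ae_restrict_mem measurableSet_ball] with y hy hyr
  have hy0 : 0 < ‖y‖ := norm_pos_iff.2 hy
  have h1 := hC (y + x) (by simpa using hyr)
  rw [add_sub_cancel_right] at h1
  rw [Function.comp_apply, Real.norm_of_nonneg (by positivity), Real.rpow_neg hy0.le,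
    ← Real.inv_rpow hy0.le, ← Real.mul_rpow hC0.le (by positivity), ← div_eq_mul_inv]
  exact Real.rpow_le_rpow (norm_nonneg _) ((le_div_iff₀ hy0).2 h1) hq0

/-! ### Integrability of the logarithmic derivative -/

/-- The logarithmic derivative of `sin ∘ log`. -/
def cotLog (ζ : ℂ) : ℂ := cos (log ζ) * ζ⁻¹ / sin (log ζ)

lemma measurable_cotLog : Measurable cotLog := by
  unfold cotLog
  have h1 : Measurable fun ζ : ℂ => cos (log ζ) := measurable_cos.comp measurable_log
  have h2 : Measurable fun ζ : ℂ => sin (log ζ) := measurable_sin.comp measurable_log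
  exact (h1.mul measurable_inv).div h2

lemma hasPoleBound_cotLog {x : ℂ} (hx : x ∈ slitPlane) : HasPoleBound cotLog x := by
  have h0 : x ≠ 0 := slitPlane_ne_zero hx
  have hlog : HasDerivAt log x⁻¹ x := hasDerivAt_log hx
  refine hasPoleBound_logDeriv (φ := fun ζ => sin (log ζ)) (φ' := fun ζ => cos (log ζ) * ζ⁻¹)
    hlog.csin ?_ fun hs => mul_ne_zero (fun hc => ?_) (inv_ne_zero h0)
  · exact hlog.ccos.continuousAt.mul (continuousAt_inv₀ h0)
  · have := Complex.sin_sq_add_cos_sq (log x)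
    simp_all

/-- Scaling by e^{-kπ} shifts the logarithm by -kπ, which multiplies sine and cosine by the same
sign; only ζ⁻¹ scales. -/
lemma cotLog_mul (k : ℕ) {ζ : ℂ} (hζ : ζ ≠ 0) :
    cotLog ((Real.exp (-Real.pi) ^ k : ℝ) • ζ) = (Real.exp (-Real.pi) ^ k : ℝ)⁻¹ • cotLog ζ := by
  have h1 : log (((Real.exp (-Real.pi) ^ k : ℝ) : ℂ) * ζ) = log ζ - k * Real.pi := by
    rw [log_ofReal_mul (by positivity) hζ, Real.log_pow, Real.log_exp]
    push_cast
    ring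
  rw [Complex.real_smul, Complex.real_smul, cotLog, cotLog, h1, Complex.cos_antiperiodic.sub_nat_mul_eq,
    Complex.sin_antiperiodic.sub_nat_mul_eq, mul_inv, ofReal_inv]
  have h2 : ((-1 : ℂ)) ^ k ≠ 0 := pow_ne_zero _ (by norm_num)
  rw [mul_assoc, mul_div_mul_left _ _ h2]
  ring

/-- A fundamental domain for the scaling by `exp (-π)` of the half disc. -/
def halfShell : Set ℂ := {ζ | 0 ≤ ζ.re ∧ 2 * Real.exp (-Real.pi) ≤ ‖ζ‖ ∧ ‖ζ‖ ≤ 2}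

lemma isCompact_halfShell : IsCompact halfShell := by
  refine (isCompact_closedBall (0 : ℂ) 2).of_isClosed_subset ?_ fun ζ hζ => by
    simpa using hζ.2.2
  exact (isClosed_le continuous_const Complex.continuous_re).inter
    ((isClosed_le continuous_const continuous_norm).inter
      (isClosed_le continuous_norm continuous_const))

lemma ne_zero_of_mem_halfShell {ζ : ℂ} (hζ : ζ ∈ halfShell) : ζ ≠ 0 := by
  rintro rfl
  have := hζ.2.1
  rw [norm_zero] at this
  linarith [Real.exp_pos (-Real.pi)]

lemma mem_slitPlane_of_re_nonneg {ζ : ℂ} (h : 0 ≤ ζ.re) (h0 : ζ ≠ 0) : ζ ∈ slitPlane := by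
  rw [mem_slitPlane_iff]
  rcases h.eq_or_lt with h1 | h1
  · exact Or.inr fun h2 => h0 (Complex.ext h1.symm h2)
  · exact Or.inl h1

open scoped Pointwise in
lemma ball_subset_iUnion_halfShell :
    Metric.ball (1 : ℂ) 1 ⊆ ⋃ k : ℕ, (Real.exp (-Real.pi) ^ k : ℝ) • halfShell := by
  intro ζ hζ
  rw [mem_ball_iff_norm] at hζ
  have h1 : 0 < ζ.re := by
    have := (abs_re_le_norm (ζ - 1)).trans_lt hζ
    rw [sub_re, one_re, abs_lt] at this
    linarith
  have h0 : ζ ≠ 0 := fun h => by simp [h] at h1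
  have hpos : 0 < ‖ζ‖ := norm_pos_iff.2 h0
  have h2 : ‖ζ‖ ≤ 2 := by
    have := norm_add_le (ζ - 1) 1
    rw [sub_add_cancel, norm_one] at this
    linarith
  -- The shell is found by placing |ζ|/2 between consecutive powers of e^{-π}.
  obtain ⟨k, hk1, hk2⟩ := exists_nat_pow_near_of_lt_one (x := ‖ζ‖ / 2) (by positivity)
    (by linarith) (Real.exp_pos (-Real.pi))
    (Real.exp_lt_one_iff.2 (by linarith [Real.pi_pos]))
  set c := Real.exp (-Real.pi) with hc
  have hck : 0 < c ^ k := by positivity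
  rw [Set.mem_iUnion]
  refine ⟨k, (c ^ k)⁻¹ • ζ, ⟨?_, ?_, ?_⟩, ?_⟩
  · rw [Complex.smul_re]; positivity
  · rw [norm_smul, Real.norm_of_nonneg (by positivity), ← div_eq_inv_mul, le_div_iff₀ hck]
    rw [pow_succ] at hk1
    nlinarith
  · rw [norm_smul, Real.norm_of_nonneg (by positivity), ← div_eq_inv_mul, div_le_iff₀ hck]
    linarith
  · change c ^ k • (c ^ k)⁻¹ • ζ = ζ
    rw [smul_smul, mul_inv_cancel₀ hck.ne', one_smul]

-- On the k-th shell the integrand is scaled by c^{-kq} and the area by c^{2k}, c = e^{-π}. The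
-- integrals thus form a geometric series of ratio c^{2-q} < 1.
open scoped Pointwise in
lemma integrableOn_cotLog {q : ℝ} (hq0 : 0 ≤ q) (hq : q < 2) :
    IntegrableOn (fun ζ => ‖cotLog ζ‖ ^ q) (Metric.ball (1 : ℂ) 1) := by
  set c := Real.exp (-Real.pi) with hc
  have hc0 : 0 < c := Real.exp_pos _
  have hc1 : c < 1 := Real.exp_lt_one_iff.2 (by linarith [Real.pi_pos])
  refine IntegrableOn.mono_set ?_ ball_subset_iUnion_halfShell
  refine integrableOn_iUnion_of_summable_integral_norm (fun k => ?_) ?_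
  · refine integrableOn_norm_rpow_of_hasPoleBound measurable_cotLog
      (isCompact_halfShell.smul _) ?_ hq0 hq
    rintro _ ⟨ζ, hζ, rfl⟩
    have hck : 0 < c ^ k := by positivity
    refine hasPoleBound_cotLog (mem_slitPlane_of_re_nonneg ?_
      (smul_ne_zero hck.ne' (ne_zero_of_mem_halfShell hζ)))
    change 0 ≤ (c ^ k • ζ).re
    rw [Complex.smul_re]
    exact mul_nonneg hck.le hζ.1
  · have key : ∀ k : ℕ, ∫ ζ in (c ^ k) • halfShell, ‖‖cotLog ζ‖ ^ q‖ =
        (c ^ (2 - q)) ^ k * ∫ ζ in halfShell, ‖cotLog ζ‖ ^ q := fun k => by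
      have hck : 0 < c ^ k := by positivity
      have h1 := Measure.setIntegral_comp_smul volume (fun ζ : ℂ => ‖cotLog ζ‖ ^ q)
        halfShell hck.ne'
      have h2 : ∫ ζ in halfShell, ‖cotLog (c ^ k • ζ)‖ ^ q =
          ((c ^ k)⁻¹) ^ q * ∫ ζ in halfShell, ‖cotLog ζ‖ ^ q := by
        rw [← integral_const_mul]
        refine setIntegral_congr_fun isCompact_halfShell.measurableSet fun ζ hζ => ?_
        rw [cotLog_mul k (ne_zero_of_mem_halfShell hζ), norm_smul,
          Real.norm_of_nonneg (by positivity), Real.mul_rpow (by positivity) (norm_nonneg _)]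
      rw [h2, Complex.finrank_real_complex, abs_of_nonneg (by positivity), smul_eq_mul] at h1
      have h3 : ∀ ζ : ℂ, ‖‖cotLog ζ‖ ^ q‖ = ‖cotLog ζ‖ ^ q := fun ζ =>
        Real.norm_of_nonneg (by positivity)
      simp only [h3]
      have h4 : (c ^ (2 - q)) ^ k = (c ^ k) ^ 2 * ((c ^ k)⁻¹) ^ q := by
        rw [Real.inv_rpow hck.le, ← Real.rpow_neg hck.le, ← Real.rpow_natCast (c ^ k) 2,
          ← Real.rpow_add hck, ← Real.rpow_natCast, ← Real.rpow_natCast, ← Real.rpow_mul hc0.le,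
          ← Real.rpow_mul hc0.le]
        congr 1
        push_cast
        ring
      rw [h4, mul_assoc, h1]
      field_simp
    exact ((summable_geometric_of_lt_one (by positivity)
      (Real.rpow_lt_one hc0.le hc1 (by linarith))).mul_right _).congr fun k => (key k).symm

/-- A logarithm is dominated by any negative power; halving |ζ| brings it into (0, 1], where |log x|
x^ε < 1/ε holds. -/
lemma norm_log_le {ε : ℝ} (hε : 0 < ε) {ζ : ℂ} (h0 : ζ ≠ 0) (h2 : ‖ζ‖ ≤ 2) :
    ‖log ζ‖ ≤ (1 + Real.pi + 1 / ε) * 2 ^ ε * ‖ζ‖ ^ (-ε) := by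
  have hpos : 0 < ‖ζ‖ := norm_pos_iff.2 h0
  set x := ‖ζ‖ / 2 with hx
  have hx0 : 0 < x := by positivity
  have hx1 : x ≤ 1 := by linarith
  have h3 : 1 ≤ x ^ (-ε) := Real.one_le_rpow_of_pos_of_le_one_of_nonpos hx0 hx1 (by linarith)
  have h4 : |Real.log x| ≤ 1 / ε * x ^ (-ε) := by
    have := (Real.abs_log_mul_self_rpow_lt x ε hx0 hx1 hε).le
    rwa [abs_mul, abs_of_pos (Real.rpow_pos_of_pos hx0 ε), ← le_div_iff₀ (by positivity),
      div_eq_mul_inv (1 / ε), ← Real.rpow_neg hx0.le] at this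
  have h5 : |Real.log ‖ζ‖| ≤ 1 + |Real.log x| := by
    have h6 : Real.log ‖ζ‖ = Real.log 2 + Real.log x := by
      rw [← Real.log_mul (by norm_num) hx0.ne', hx]
      congr 1
      ring
    have h7 : |Real.log 2| ≤ 1 := by
      rw [abs_of_pos (Real.log_pos (by norm_num))]
      linarith [Real.log_two_lt_d9]
    rw [h6]
    exact (abs_add_le _ _).trans (by linarith)
  have h8 : ‖log ζ‖ ≤ |Real.log ‖ζ‖| + Real.pi := by
    refine (norm_le_abs_re_add_abs_im _).trans ?_
    rw [log_re, log_im]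
    gcongr
    exact abs_arg_le_pi _
  have h9 : x ^ (-ε) = 2 ^ ε * ‖ζ‖ ^ (-ε) := by
    rw [hx, Real.div_rpow hpos.le (by norm_num), Real.rpow_neg (by norm_num : (0 : ℝ) ≤ 2)]
    field_simp
  rw [mul_assoc, ← h9]
  nlinarith [Real.pi_pos]

lemma integrableOn_log_div {q : ℝ} (hq0 : 1 ≤ q) (hq : q < 2) :
    IntegrableOn (fun ζ : ℂ => ‖log ζ / ζ‖ ^ q) (Metric.ball (1 : ℂ) 1) := by
  have hm : Measurable fun ζ : ℂ => ‖log ζ / ζ‖ ^ q :=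
    (measurable_log.div measurable_id).norm.pow_const q
  have hsub : Metric.ball (1 : ℂ) 1 ⊆ Metric.ball 0 2 := fun ζ hζ => by
    rw [mem_ball_iff_norm] at hζ
    have := norm_add_le (ζ - 1) 1
    rw [sub_add_cancel, norm_one] at this
    rw [mem_ball_zero_iff]
    linarith
  refine IntegrableOn.mono_set ?_ hsub
  -- Small enough that (1+ε)q < 2, the threshold for integrability in the plane.
  set ε := (2 - q) / 4 with hε
  have hε0 : 0 < ε := by rw [hε]; linarith
  refine integrableOn_ball_of_norm_le_rpow (C := ((1 + Real.pi + 1 / ε) * 2 ^ ε) ^ q)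
    (α := (1 + ε) * q) (by simp) ?_ ?_ hm.aestronglyMeasurable
  · rw [Complex.finrank_real_complex, hε]
    push_cast
    nlinarith
  · have hne : ∀ᵐ y ∂(volume.restrict (Metric.ball (0 : ℂ) 2)), y ≠ 0 :=
      ae_restrict_of_ae (by simp [ae_iff])
    filter_upwards [hne, ae_restrict_mem measurableSet_ball] with ζ h0 h2
    rw [mem_ball_zero_iff] at h2
    have hpos : 0 < ‖ζ‖ := norm_pos_iff.2 h0
    have h3 : ‖ζ‖ ^ (-((1 + ε) * q)) = (‖ζ‖ ^ (-ε) / ‖ζ‖) ^ q := by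
      rw [← Real.rpow_sub_one hpos.ne', ← Real.rpow_mul hpos.le]
      congr 1
      ring
    rw [Real.norm_of_nonneg (by positivity), h3, ← Real.mul_rpow (by positivity) (by positivity),
      norm_div, ← mul_div_assoc]
    gcongr
    exact norm_log_le hε0 h0 h2.le

/-! ### Global integrability for `flatSine` -/

lemma measurable_flatSine : Measurable flatSine := by
  have hL : Measurable fun z : ℂ => log (1 + z) := measurable_log.comp (measurable_const_add 1)
  refine Measurable.ite (measurableSet_singleton _) measurable_const ?_
  exact (measurable_exp.comp (hL.pow_const 2).neg).mul (measurable_sin.comp hL)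

lemma measurable_flatSineDeriv : Measurable flatSineDeriv := by
  have hL : Measurable fun z : ℂ => log (1 + z) := measurable_log.comp (measurable_const_add 1)
  exact ((measurable_const_add 1).inv.mul (measurable_exp.comp (hL.pow_const 2).neg)).mul
    ((measurable_cos.comp hL).sub ((hL.const_mul 2).mul (measurable_sin.comp hL)))

/-- The logarithmic derivative of `flatSine`. -/
def flatSineLogDeriv (z : ℂ) : ℂ := flatSineDeriv z / flatSine z

lemma measurable_flatSineLogDeriv : Measurable flatSineLogDeriv :=
  measurable_flatSineDeriv.div measurable_flatSine

/-- Differentiating log h = -L² + log sin L gives cot L/(1+z) - 2L/(1+z); at a zero of h the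
quotient is 0 by the convention for division. -/
lemma norm_flatSineLogDeriv_le {z : ℂ} (hz : z ∈ disc) :
    ‖flatSineLogDeriv z‖ ≤ ‖cotLog (1 + z)‖ + 2 * ‖log (1 + z) / (1 + z)‖ := by
  have hne := ne_neg_one_of_mem_halfPlane (disc_subset_halfPlane hz)
  have h0 : 1 + z ≠ 0 := one_add_ne_zero_iff.2 hne
  by_cases h : flatSine z = 0
  · rw [flatSineLogDeriv, h, div_zero, norm_zero]; positivity
  have hs : sin (log (1 + z)) ≠ 0 := fun hs => h ((flatSine_eq_zero_iff hne).2 hs)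
  have h1 : flatSineLogDeriv z = cotLog (1 + z) - 2 * (log (1 + z) / (1 + z)) := by
    rw [flatSineLogDeriv, flatSine_of_ne hne, flatSineDeriv, cotLog]
    have := Complex.exp_ne_zero (-log (1 + z) ^ 2)
    field_simp
  rw [h1]
  refine (norm_sub_le _ _).trans ?_
  rw [norm_mul, Complex.norm_ofNat]

lemma memLp_flatSineLogDeriv {p : ℝ≥0∞} (hp : p < 2) :
    MemLp flatSineLogDeriv p (volume.restrict disc) := by
  -- The disc has finite measure, so exponents below 1 follow from exponent 1.
  suffices H : ∀ p : ℝ≥0∞, 1 ≤ p → p < 2 → MemLp flatSineLogDeriv p (volume.restrict disc) by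
    have : IsFiniteMeasure (volume.restrict disc) := 
      isFiniteMeasure_restrict.2 measure_ball_lt_top.ne
    exact (H (max p 1) (le_max_right _ _) (max_lt hp (by norm_num))).mono_exponent
      (le_max_left _ _)
  intro p hp1 hp
  have htop : p ≠ ⊤ := (hp.trans_le le_top).ne
  have hzero : p ≠ 0 := (zero_lt_one.trans_le hp1).ne'
  have hq1 : 1 ≤ p.toReal := by
    have := ENNReal.toReal_mono htop hp1
    simpa using this
  have hq2 : p.toReal < 2 := by
    have := (ENNReal.toReal_lt_toReal htop (by norm_num)).2 hp
    simpa using this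
  have m1 : MemLp cotLog p (volume.restrict (Metric.ball 1 1)) :=
    (integrable_norm_rpow_iff measurable_cotLog.aestronglyMeasurable hzero htop).1
      (integrableOn_cotLog (by linarith) hq2)
  have m2 : MemLp (fun ζ : ℂ => log ζ / ζ) p (volume.restrict (Metric.ball 1 1)) :=
    (integrable_norm_rpow_iff (measurable_log.div measurable_id).aestronglyMeasurable hzero
      htop).1 (integrableOn_log_div hq1 hq2)
  have hmp : MeasurePreserving (fun z : ℂ => 1 + z) (volume.restrict disc)
      (volume.restrict (Metric.ball 1 1)) := by
    have h1 := (measurePreserving_add_left volume (1 : ℂ)).restrict_preimage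
      (measurableSet_ball (x := (1 : ℂ)) (ε := 1))
    have h2 : (fun z : ℂ => 1 + z) ⁻¹' Metric.ball 1 1 = disc := by ext z; simp
    rwa [h2] at h1
  have m3 := (m1.norm.add (m2.norm.const_mul 2)).comp_measurePreserving hmp
  refine m3.mono' measurable_flatSineLogDeriv.aestronglyMeasurable ?_
  filter_upwards [ae_restrict_mem measurableSet_ball] with z hz
  exact norm_flatSineLogDeriv_le hz

lemma integrableOn_flatSineLogDeriv : IntegrableOn flatSineLogDeriv disc :=
  memLp_one_iff_integrable.1 (memLp_flatSineLogDeriv (by norm_num))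

lemma hasPoleBound_flatSineLogDeriv {z : ℂ} (hz : z ∈ disc) : HasPoleBound flatSineLogDeriv z :=
  hasPoleBound_logDeriv (hasDerivAt_flatSine (disc_subset_halfPlane hz))
    (differentiableOn_flatSineDeriv.differentiableAt
      (isOpen_halfPlane.mem_nhds (disc_subset_halfPlane hz))).continuousAt
    (flatSineDeriv_ne_zero (ne_neg_one_of_mem_halfPlane (disc_subset_halfPlane hz)))

lemma flatSine_ae_ne_zero : ∀ᵐ z ∂volume.restrict disc, flatSine z ≠ 0 := by
  have h1 : zeroSet.Countable := by
    refine Set.Countable.mono (s₂ := Set.range fun k : ℤ => cexp (k * Real.pi) - 1) ?_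
      (Set.countable_range _)
    rintro z ⟨hz, h0⟩
    have hne := ne_neg_one_of_mem_halfPlane (disc_subset_halfPlane hz)
    rw [flatSine_eq_zero_iff hne, Complex.sin_eq_zero_iff] at h0
    obtain ⟨k, hk⟩ := h0
    refine ⟨k, ?_⟩
    simp only
    rw [← hk, Complex.exp_log (one_add_ne_zero_iff.2 hne)]
    ring
  have h2 : ∀ᵐ z ∂volume.restrict disc, z ∉ zeroSet :=
    ae_restrict_of_ae (measure_eq_zero_iff_ae_notMem.1 (h1.measure_zero volume))
  filter_upwards [h2, ae_restrict_mem measurableSet_ball] with z hz hzd h0 using hz ⟨hzd, h0⟩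

/-! ### The phase away from the zeros -/

lemma phase_eventuallyEq {w : ℂ} (hw : w ≠ 0) : phase =ᶠ[𝓝 w] monomial (-1) 1 0 := by
  filter_upwards [isOpen_ne.mem_nhds hw] with x hx
  rw [phase_of_ne hx, monomial, Real.rpow_neg_one, div_eq_inv_mul]
  simp

lemma contDiffAt_phase {w : ℂ} (hw : w ≠ 0) : ContDiffAt ℝ ∞ phase w :=
  (contDiffAt_monomial _ _ _ hw).congr_of_eventuallyEq (phase_eventuallyEq hw)

lemma fderiv_phase {w : ℂ} (hw : w ≠ 0) (v : ℂ) :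
    fderiv ℝ phase w v = phase w * (I * (v / w).im) := by
  refine fderiv_eq_of_hasDerivAt_line ((contDiffAt_phase hw).differentiableAt (by simp)) ?_
  have h1 : HasDerivAt (fun t : ℝ => w + t • v) v 0 := by
    simpa using ((hasDerivAt_id (0 : ℝ)).smul_const v).const_add w
  have h2 : HasDerivAt (fun t : ℝ => w + t • v) ((w + (0 : ℝ) • v) * (v / w)) 0 := by
    refine h1.congr_deriv ?_
    rw [zero_smul, add_zero]
    field_simp
  have h3 := hasDerivAt_monomial_comp (-1) 1 0 h2 (by simpa using hw)
  have h4 : Tendsto (fun t : ℝ => w + t • v) (𝓝 0) (𝓝 w) := by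
    simpa using h1.continuousAt.tendsto
  refine (h3.congr_of_eventuallyEq (h4.eventually (phase_eventuallyEq hw))).congr_deriv ?_
  rw [zero_smul, add_zero, ← (phase_eventuallyEq hw).eq_of_nhds]
  conv_lhs => enter [2, 1, 2, 2]; rw [← re_add_im (v / w)]
  push_cast
  ring

lemma differentiableAt_log_norm {w : ℂ} (hw : w ≠ 0) :
    DifferentiableAt ℝ (fun w : ℂ => Real.log ‖w‖) w :=
  ((contDiffAt_norm ℝ hw (n := 1)).differentiableAt one_ne_zero).log (norm_ne_zero_iff.2 hw)

lemma fderiv_log_norm {w : ℂ} (hw : w ≠ 0) (v : ℂ) :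
    fderiv ℝ (fun w : ℂ => Real.log ‖w‖) w v = (v / w).re := by
  refine fderiv_eq_of_hasDerivAt_line (differentiableAt_log_norm hw) ?_
  have hw0 : 0 < ‖w‖ := norm_pos_iff.2 hw
  have h1 := ((hasDerivAt_norm_sq_line w v 0).log (by simpa using hw)).div_const 2
  have h2 : (fun t : ℝ => Real.log (‖w + t • v‖ ^ 2 + 0) / 2) =
      fun t : ℝ => Real.log ‖w + t • v‖ := by
    ext t
    rw [add_zero, Real.log_pow]
    push_cast
    ring
  rw [h2] at h1
  refine h1.congr_deriv ?_
  rw [zero_smul, add_zero, add_zero, ← re_conj_mul_div hw]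
  ring

lemma phase_mul_exp {ρ : ℝ} (hρ : 0 < ρ) (β : ℝ) : phase (ρ * cexp (β * I)) = cexp (β * I) := by
  have h0 : (ρ : ℂ) ≠ 0 := by exact_mod_cast hρ.ne'
  rw [phase_of_ne (mul_ne_zero h0 (Complex.exp_ne_zero _)), norm_mul, norm_exp_mul_I,
    Complex.norm_real, Real.norm_of_nonneg hρ.le, mul_one, mul_div_cancel_left₀ _ h0]

/-- Polar form: |w|^s = e^{s log|w|}, and on the unit circle conjugation is inversion, which
produces the exponent -j-1. -/
lemma cone_eq_modelTerm {j : ℕ} {w : ℂ} (hw : w ≠ 0) :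
    cone j w = WithLp.toLp 2 (modelTerm j (phase w) (Real.log ‖w‖)) := by
  have hw0 : 0 < ‖w‖ := norm_pos_iff.2 hw
  have hwc : (‖w‖ : ℂ) ≠ 0 := by exact_mod_cast hw0.ne'
  have hs : Real.sqrt (j * (j + 1)) = coneDegree j := by
    rw [coneDegree]; congr 1; ring
  have he : Real.exp (coneDegree j * Real.log ‖w‖) = ‖w‖ ^ coneDegree j := by
    rw [Real.rpow_def_of_pos hw0, mul_comm]
  have hinv : (phase w)⁻¹ = conj w / ‖w‖ := by
    rw [inv_eq_conj (norm_phase w), phase_of_ne hw, map_div₀, conj_ofReal]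
  have h0 : monomial (coneDegree j - j) j 0 w =
      ((‖w‖ ^ coneDegree j : ℝ) : ℂ) * phase w ^ j := by
    rw [monomial, pow_zero, mul_one, Real.rpow_sub hw0, Real.rpow_natCast, phase_of_ne hw, div_pow]
    push_cast
    ring
  have h1 : monomial (coneDegree j - j - 1) 0 (j + 1) w =
      ((‖w‖ ^ coneDegree j : ℝ) : ℂ) * phase w ^ (-(j : ℤ) - 1) := by
    have h2 : (-(j : ℤ) - 1) = -((j + 1 : ℕ) : ℤ) := by push_cast; ring
    rw [h2, zpow_neg, zpow_natCast, ← inv_pow, hinv, monomial, pow_zero, mul_one,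
      Real.rpow_sub_one hw0.ne', Real.rpow_sub hw0, Real.rpow_natCast, div_pow, pow_succ (‖w‖ : ℂ)]
    push_cast
    field_simp
  rw [cone, modelTerm, hs, he, h0, h1, ← mul_assoc, ← mul_assoc]

/-! ### Singularities of the phase -/

/-- Factor h = (z - q)k with k(q) = h'(q) ≠ 0. Near q the ratio k/h'(q) stays in the slit plane, so
its argument is continuous and periodic along circles; the factor z - q alone contributes the turn
by 2π. -/
lemma hasSingularityOfDegree_phase {h : ℂ → ℂ} {h' q : ℂ} {U : Set ℂ} (hU : IsOpen U)
    (hc : ContinuousOn h U) (hq : q ∈ U) (h0 : h q = 0) (hd : HasDerivAt h h' q) (hne : h' ≠ 0) :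
    HasSingularityOfDegree (fun z => phase (h z)) q 1 := by
  set k : ℂ → ℂ := dslope h q with hk
  have hkq : k q = h' := by rw [hk, dslope_same, hd.deriv]
  have hkc : ContinuousOn k U :=
    (continuousOn_dslope (hU.mem_nhds hq)).2 ⟨hc, hd.differentiableAt⟩
  have hfac : ∀ z, h z = (z - q) * k z := fun z => by
    have := sub_smul_dslope h q z
    rw [h0, sub_zero, smul_eq_mul] at this
    exact this.symm
  have hev : ∀ᶠ z in 𝓝 q, z ∈ U ∧ k z / h' ∈ slitPlane := by
    refine Filter.Eventually.and (hU.mem_nhds hq) ?_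
    have h1 : ContinuousAt (fun z => k z / h') q :=
      (hkc.continuousAt (hU.mem_nhds hq)).div_const h'
    refine h1.eventually (isOpen_slitPlane.mem_nhds ?_)
    simp only [hkq, div_self hne]
    exact one_mem_slitPlane
  obtain ⟨r, hr, hball⟩ := Metric.eventually_nhds_iff_ball.1 hev
  have hk0 : ∀ z ∈ Metric.ball q r, k z ≠ 0 := fun z hz h1 => by
    have := (hball z hz).2
    rw [h1, zero_div] at this
    exact slitPlane_ne_zero this rfl
  refine ⟨r, hr, fun z hz => ?_, fun z _ => norm_phase _, fun ε hε hεr => ?_⟩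
  · have hz0 : h z ≠ 0 := by
      rw [hfac]
      exact mul_ne_zero (sub_ne_zero.2 hz.2) (hk0 z hz.1)
    exact (ContinuousAt.comp (g := phase) (contDiffAt_phase hz0).continuousAt
      (hc.continuousAt (hU.mem_nhds (hball z hz.1).1))).continuousWithinAt
  · have hmem : ∀ θ, circleMap q ε θ ∈ Metric.ball q r := fun θ => by
      rw [mem_ball_iff_norm, circleMap_sub_center, norm_circleMap_zero, abs_of_pos hε]
      exact hεr
    refine ⟨fun θ => θ + arg h' + arg (k (circleMap q ε θ) / h'), ?_, fun θ => ?_, fun θ => ?_⟩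
    · refine (continuous_id.add continuous_const).add (continuous_iff_continuousAt.2 fun θ => ?_)
      refine ContinuousAt.comp (g := arg) (continuousAt_arg (hball _ (hmem θ)).2) ?_
      refine ContinuousAt.div_const ?_ h'
      exact ContinuousAt.comp (g := k) (hkc.continuousAt (hU.mem_nhds (hball _ (hmem θ)).1))
        (continuous_circleMap q ε).continuousAt
    · set κ := k (circleMap q ε θ) / h' with hκ
      have hκ0 : κ ≠ 0 := slitPlane_ne_zero (hball _ (hmem θ)).2
      have e1 := norm_mul_exp_arg_mul_I h'
      have e2 := norm_mul_exp_arg_mul_I κ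
      have e3 : k (circleMap q ε θ) = h' * κ := by rw [hκ]; field_simp
      have hpos : 0 < ε * ‖h'‖ * ‖κ‖ := by
        have := norm_pos_iff.2 hne
        have := norm_pos_iff.2 hκ0
        positivity
      rw [← phase_mul_exp hpos]
      refine congrArg phase ?_
      rw [hfac, circleMap_sub_center, circleMap_zero, e3]
      conv_lhs => rw [← e1, ← e2]
      push_cast
      rw [add_mul, add_mul, Complex.exp_add, Complex.exp_add]
      ring
    · have h1 : circleMap q ε (θ + 2 * Real.pi) = circleMap q ε θ := periodic_circleMap q ε θ
      simp only [h1]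
      push_cast
      ring

/-! ### The Hamiltonian stationary map -/

/-- The map `Φ` of the theorem. -/
def coneMap (j : ℕ) (z : ℂ) : C2 := cone j (flatSine z)

/-- The conjugate of the Lagrangian angle of `coneMap`. -/
def angle (z : ℂ) : ℂ := phase (flatSine z)

lemma hasDerivAt_flatSine_disc : ∀ z ∈ disc, HasDerivAt flatSine (flatSineDeriv z) z :=
  fun _ hz => hasDerivAt_flatSine (disc_subset_halfPlane hz)

lemma ae_of_forall_disc {P : ℂ → Prop} (h : ∀ z ∈ disc, P z) :
    ∀ᵐ z ∂volume.restrict disc, P z := by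
  filter_upwards [ae_restrict_mem measurableSet_ball] with z hz using h z hz

lemma coneMap_holderClass {j : ℕ} (hj : 1 ≤ j) : HolderClass (coneDegree j - j) disc j C2 (coneMap j) := by
  have h1 := coneDegree_gt hj
  have h2 := coneDegree_lt j
  -- The cone is controlled only on bounded balls, so one containing the image of h is needed.
  obtain ⟨R, _, hR⟩ := flatSine_bounded
  have hF : HolderClass (coneDegree j - j) (Metric.ball 0 R) j C2 (cone j) := by
    refine IsHomogeneous.holderClass ⟨by linarith, by linarith⟩ j ?_ R
    rw [add_sub_cancel]
    exact cone_isHomogeneous hj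
  have hα : coneDegree j - j ∈ Set.Ioc (0 : ℝ) 1 := ⟨by linarith, by linarith⟩
  exact hF.comp hα Metric.isOpen_ball (convex_ball _ _) Metric.isBounded_ball
    (flatSine_holderClass hα) fun z _ => by simpa using hR z

lemma memHolder_coneMap {j : ℕ} (hj : 1 ≤ j) : MemHolder (coneDegree j) (coneMap j) := by
  have h1 := coneDegree_gt hj
  have hfl := floor_coneDegree hj
  refine HolderClass.memHolder ?_ ?_
  · rw [hfl]; linarith
  · rw [hfl]; exact coneMap_holderClass hj

lemma contDiffOn_coneMap {j : ℕ} (hj : 1 ≤ j) : ContDiffOn ℝ 1 (coneMap j) disc := by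
  have h1 := coneDegree_gt hj
  refine ((coneMap_holderClass hj).contDiffOn (by linarith) Metric.isOpen_ball).of_le ?_
  exact_mod_cast hj

lemma hasWeakGradient_coneMap {j : ℕ} (hj : 1 ≤ j) : HasWeakGradient (coneMap j)
    (fun z => fderiv ℝ (coneMap j) z 1) (fun z => fderiv ℝ (coneMap j) z I) :=
  hasWeakGradient_of_contDiffOn (contDiffOn_coneMap hj)

lemma memW1_coneMap {j : ℕ} (hj : 1 ≤ j) (p : ℝ≥0∞) : MemW1 p (coneMap j) := by
  have : IsFiniteMeasure (volume.restrict disc) :=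
    isFiniteMeasure_restrict.2 measure_ball_lt_top.ne
  have hC := contDiffOn_coneMap hj
  have hH := coneMap_holderClass hj
  obtain ⟨C, _, hb⟩ := hH.bounded
  obtain ⟨D, _, hD⟩ : ∃ D, 0 ≤ D ∧ ∀ z ∈ disc, ‖fderiv ℝ (coneMap j) z‖ ≤ D := by
    obtain ⟨k, rfl⟩ : ∃ k, j = k + 1 := ⟨j - 1, by omega⟩
    exact hH.2.2.bounded
  have hdisc : ∀ᵐ z ∂volume.restrict disc, z ∈ disc := ae_restrict_mem measurableSet_ball
  have hd : ∀ v : ℂ, ‖v‖ = 1 →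
      MemLp (fun z => fderiv ℝ (coneMap j) z v) p (volume.restrict disc) := fun v hv => by
    refine MemLp.of_bound ((continuousOn_fderiv_apply hC v).aestronglyMeasurable
      measurableSet_ball) D ?_
    filter_upwards [hdisc] with z hz
    exact ((fderiv ℝ (coneMap j) z).le_of_opNorm_le (hD z hz) v).trans (by rw [hv, mul_one])
  refine ⟨_, _, hasWeakGradient_coneMap hj, ?_, hd 1 norm_one, hd I norm_I⟩
  refine MemLp.of_bound (hC.continuousOn.aestronglyMeasurable measurableSet_ball) C ?_
  filter_upwards [hdisc] with z hz using hb z hz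

lemma fderiv_coneMap {j : ℕ} (hj : 1 ≤ j) {z : ℂ} (hz : z ∈ disc) (v : ℂ) :
    fderiv ℝ (coneMap j) z v = fderiv ℝ (cone j) (flatSine z) (flatSineDeriv z * v) :=
  fderiv_comp_holomorphic hasDerivAt_flatSine_disc hz (differentiableAt_cone hj _) v

lemma fderiv_coneMap_of_eq_zero {j : ℕ} (hj : 1 ≤ j) {z : ℂ} (hz : z ∈ disc) (h0 : flatSine z = 0) (v : ℂ) :
    fderiv ℝ (coneMap j) z v = 0 := by
  rw [fderiv_coneMap hj hz, h0, (hasFDerivAt_cone_zero hj).fderiv]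
  simp

lemma fderiv_coneMap_of_ne_zero {j : ℕ} (hj : 1 ≤ j) {z : ℂ} (hz : z ∈ disc) (h0 : flatSine z ≠ 0) (v : ℂ) :
    fderiv ℝ (coneMap j) z v =
      fderiv ℝ (cone j) (flatSine z) (flatSine z * (flatSineLogDeriv z * v)) := by
  rw [fderiv_coneMap hj hz, flatSineLogDeriv]
  congr 1
  field_simp

lemma norm_sq_fderiv_coneMap {j : ℕ} (hj : 1 ≤ j) {z : ℂ} (hz : z ∈ disc) (h0 : flatSine z ≠ 0) (v : ℂ) :
    ‖fderiv ℝ (coneMap j) z v‖ ^ 2 = (2 * j + 1) * coneDegree j ^ 2 *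
      (‖flatSine z‖ ^ coneDegree j) ^ 2 * ‖flatSineLogDeriv z * v‖ ^ 2 := by
  rw [fderiv_coneMap_of_ne_zero hj hz h0, norm_sq_fderiv_cone hj h0]

/-- At zeros of h the differential vanishes and all four identities are trivial; elsewhere they are
those of the cone with τ = h'/h. They hold at every point of the disc. -/
lemma coneMap_pointwise {j : ℕ} (hj : 1 ≤ j) {z : ℂ} (hz : z ∈ disc) :
    symplecticForm (fderiv ℝ (coneMap j) z 1) (fderiv ℝ (coneMap j) z I) = 0 ∧
    realInner (fderiv ℝ (coneMap j) z 1) (fderiv ℝ (coneMap j) z I) = 0 ∧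
    ‖fderiv ℝ (coneMap j) z 1‖ ^ 2 = ‖fderiv ℝ (coneMap j) z I‖ ^ 2 ∧
    holVolume (fderiv ℝ (coneMap j) z 1) (fderiv ℝ (coneMap j) z I) =
      ((‖fderiv ℝ (coneMap j) z 1‖ ^ 2 : ℝ) : ℂ) * conj (angle z) := by
  by_cases h0 : flatSine z = 0
  · rw [fderiv_coneMap_of_eq_zero hj hz h0, fderiv_coneMap_of_eq_zero hj hz h0]
    simp [symplecticForm, realInner, holVolume]
  · refine ⟨?_, ?_, ?_, ?_⟩
    · rw [fderiv_coneMap_of_ne_zero hj hz h0, fderiv_coneMap_of_ne_zero hj hz h0, mul_one]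
      exact symplecticForm_fderiv_cone hj h0 _
    · rw [fderiv_coneMap_of_ne_zero hj hz h0, fderiv_coneMap_of_ne_zero hj hz h0, mul_one]
      exact realInner_fderiv_cone hj h0 _
    · rw [norm_sq_fderiv_coneMap hj hz h0, norm_sq_fderiv_coneMap hj hz h0, norm_mul, norm_mul,
        norm_I, norm_one]
    · rw [fderiv_coneMap_of_ne_zero hj hz h0, fderiv_coneMap_of_ne_zero hj hz h0, mul_one, angle,
        phase_of_ne h0]
      exact holVolume_fderiv_cone hj h0 _

lemma isLagrangian_coneMap {j : ℕ} (hj : 1 ≤ j) : IsLagrangian (coneMap j) :=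
  ⟨memW1_coneMap hj 1, _, _, hasWeakGradient_coneMap hj,
    ae_of_forall_disc fun _ hz => (coneMap_pointwise hj hz).1⟩

lemma isWeaklyConformal_coneMap {j : ℕ} (hj : 1 ≤ j) : IsWeaklyConformal (coneMap j) :=
  ⟨memW1_coneMap hj 1, _, _, hasWeakGradient_coneMap hj,
    ae_of_forall_disc fun _ hz =>
      ⟨(coneMap_pointwise hj hz).2.1, (coneMap_pointwise hj hz).2.2.1⟩⟩

lemma isLagrangianAngle_coneMap {j : ℕ} (hj : 1 ≤ j) : IsLagrangianAngle (coneMap j) (fun z => conj (angle z)) := by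
  refine ⟨memW1_coneMap hj 2, ?_, fun z _ => ?_, _, _, hasWeakGradient_coneMap hj,
    ae_of_forall_disc fun _ hz => (coneMap_pointwise hj hz).2.2.2⟩
  · exact (Complex.continuous_conj.measurable.comp
      (measurable_phase.comp measurable_flatSine)).aestronglyMeasurable
  · rw [RCLike.norm_conj]; exact norm_phase _

/-! ### Weak regularity of the Lagrangian angle -/

lemma isCircleHarmonic_angle : IsCircleHarmonic angle :=
  isCircleHarmonic_phase hasDerivAt_flatSine_disc integrableOn_flatSineLogDeriv flatSine_ae_ne_zero

lemma hasWeakGradient_angle : HasWeakGradient angle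
    (fun z => angle z * (I * (flatSineLogDeriv z).im))
    (fun z => angle z * (I * (flatSineLogDeriv z).re)) :=
  hasWeakGradient_phase hasDerivAt_flatSine_disc integrableOn_flatSineLogDeriv flatSine_ae_ne_zero

lemma measurable_angle : Measurable angle := measurable_phase.comp measurable_flatSine

lemma norm_angle_mul_im_le (z : ℂ) :
    ‖angle z * (I * (flatSineLogDeriv z).im)‖ ≤ ‖flatSineLogDeriv z‖ := by
  rw [norm_mul, norm_mul, norm_I, one_mul, Complex.norm_real, angle, norm_phase, one_mul]
  exact abs_im_le_norm _

lemma norm_angle_mul_re_le (z : ℂ) :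
    ‖angle z * (I * (flatSineLogDeriv z).re)‖ ≤ ‖flatSineLogDeriv z‖ := by
  rw [norm_mul, norm_mul, norm_I, one_mul, Complex.norm_real, angle, norm_phase, one_mul]
  exact abs_re_le_norm _

lemma measurable_angle_mul_im : Measurable fun z => angle z * (I * (flatSineLogDeriv z).im) :=
  measurable_angle.mul ((measurable_ofReal.comp
    (measurable_im.comp measurable_flatSineLogDeriv)).const_mul I)

lemma measurable_angle_mul_re : Measurable fun z => angle z * (I * (flatSineLogDeriv z).re) :=
  measurable_angle.mul ((measurable_ofReal.comp
    (measurable_re.comp measurable_flatSineLogDeriv)).const_mul I)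

lemma memW1_angle {p : ℝ≥0∞} (hp : p < 2) : MemW1 p angle := by
  have : IsFiniteMeasure (volume.restrict disc) :=
    isFiniteMeasure_restrict.2 measure_ball_lt_top.ne
  have h := memLp_flatSineLogDeriv hp
  refine ⟨_, _, hasWeakGradient_angle, ?_, ?_, ?_⟩
  · exact MemLp.of_bound measurable_angle.aestronglyMeasurable 1
      (Eventually.of_forall fun z => (norm_phase _).le)
  · exact h.mono measurable_angle_mul_im.aestronglyMeasurable
      (Eventually.of_forall norm_angle_mul_im_le)
  · exact h.mono measurable_angle_mul_re.aestronglyMeasurable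
      (Eventually.of_forall norm_angle_mul_re_le)

lemma HasPoleBound.mono {f f' : ℂ → ℂ} {x : ℂ} (h : HasPoleBound f x)
    (hle : ∀ z, ‖f' z‖ ≤ ‖f z‖) : HasPoleBound f' x := by
  obtain ⟨C, hC⟩ := h
  refine ⟨C, hC.mono fun z hz => le_trans ?_ hz⟩
  gcongr
  exact hle z

lemma memW1WeakL2Loc_angle : MemW1WeakL2Loc angle :=
  ⟨_, _, hasWeakGradient_angle, fun _ hK hKd =>
    ⟨memWeakL2_of_hasPoleBound measurable_angle_mul_im hK fun _ hx =>
      (hasPoleBound_flatSineLogDeriv (hKd hx)).mono norm_angle_mul_im_le,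
    memWeakL2_of_hasPoleBound measurable_angle_mul_re hK fun _ hx =>
      (hasPoleBound_flatSineLogDeriv (hKd hx)).mono norm_angle_mul_re_le⟩⟩

/-- Cauchy–Riemann for log h = G + iβ with g = e^{iβ}: both gradients are read off from the real and
imaginary parts of h'/h. -/
lemma isPotentialOn_angle {V : Set ℂ} (hV : ∀ z ∈ V, z ∈ disc ∧ flatSine z ≠ 0) :
    IsPotentialOn angle (fun z => Real.log ‖flatSine z‖) V := by
  intro z hz
  obtain ⟨hzd, h0⟩ := hV z hz
  have hd1 : DifferentiableAt ℝ flatSine z :=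
    (hasDerivAt_flatSine_disc z hzd).differentiableAt.restrictScalars ℝ
  have hdp : DifferentiableAt ℝ phase (flatSine z) :=
    (contDiffAt_phase h0).differentiableAt (by simp)
  have hdl := differentiableAt_log_norm h0
  have hfg : ∀ v, fderiv ℝ angle z v = angle z * (I * (flatSineLogDeriv z * v).im) := fun v => by
    have h1 : fderiv ℝ angle z v = _ :=
      fderiv_comp_holomorphic hasDerivAt_flatSine_disc hzd hdp v
    rw [h1, fderiv_phase h0, flatSineLogDeriv, div_mul_eq_mul_div, angle]
  have hfG : ∀ v, fderiv ℝ (fun z => Real.log ‖flatSine z‖) z v =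
      (flatSineLogDeriv z * v).re := fun v => by
    have h1 : fderiv ℝ (fun z => Real.log ‖flatSine z‖) z v = _ :=
      fderiv_comp_holomorphic (f := fun w : ℂ => Real.log ‖w‖) hasDerivAt_flatSine_disc hzd hdl v
    rw [h1, fderiv_log_norm h0, flatSineLogDeriv, div_mul_eq_mul_div]
  have hn : conj (angle z) * angle z = 1 := by
    rw [mul_comm, Complex.mul_conj, Complex.normSq_eq_norm_sq, angle, norm_phase]; simp
  have key : ∀ x : ℂ, -I * conj (angle z) * (angle z * (I * x)) = x := fun x => by
    linear_combination (-I * I * x) * hn - x * I_mul_I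
  refine ⟨hdp.comp z hd1, hdl.comp z hd1, ?_, ?_⟩
  · rw [hfg, hfG, key, mul_one, mul_I_re]
    push_cast
    ring
  · rw [hfg, hfG, key, mul_one, mul_I_im]

lemma isSchoenWolfsonSingularity_coneMap {j : ℕ} (hj : 1 ≤ j) {q : ℂ} (hq : q ∈ zeroSet) :
    IsSchoenWolfsonSingularity j (coneMap j) angle q := by
  obtain ⟨hqd, hq0⟩ := hq
  have hqh := disc_subset_halfPlane hqd
  refine ⟨hj, hasSingularityOfDegree_phase isOpen_halfPlane differentiableOn_flatSine.continuousOn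
    hqh hq0 (hasDerivAt_flatSine hqh)
    (flatSineDeriv_ne_zero (ne_neg_one_of_mem_halfPlane hqh) hq0), ?_⟩
  have hev : ∀ᶠ z in 𝓝 q, z ∈ disc ∧ (z ≠ q → flatSine z ≠ 0) :=
    Filter.Eventually.and (Metric.isOpen_ball.mem_nhds hqd)
      (eventually_nhdsWithin_iff.1 (flatSine_eventually_ne hqh))
  obtain ⟨r, hr, hball⟩ := Metric.eventually_nhds_iff_ball.1 hev
  have hne : ∀ z ∈ Metric.ball q r \ {q}, z ∈ disc ∧ flatSine z ≠ 0 := fun z hz =>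
    ⟨(hball z hz.1).1, (hball z hz.1).2 hz.2⟩
  -- The expansion has the single term m = j, with U = 1, a_j = 1 and Φ₀ = 0.
  refine ⟨r, hr, fun z hz => (hball z hz).1, fun z => Real.log ‖flatSine z‖, 1, Pi.single j 1, 0,
    isPotentialOn_angle hne, ?_, fun z hz => ?_, by simp, fun k hk => ?_⟩
  · refine summable_of_ne_finset_zero (s := {j}) fun m hm => ?_
    rw [Pi.single_eq_of_ne (by simpa using hm)]
    simp
  · refine ⟨modelTerm j (angle z) (Real.log ‖flatSine z‖), ?_, ?_⟩
    · convert hasSum_single j fun m hm => ?_ using 1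
      · rw [Pi.single_eq_same, one_smul]
      · rw [Pi.single_eq_of_ne hm, zero_smul]
    · rw [OneMemClass.coe_one, Matrix.one_mulVec, add_zero]
      exact cone_eq_modelTerm (hne z hz).2
  · exact Pi.single_eq_of_ne hk.ne _

lemma continuousAt_angle {z : ℂ} (hz : z ∈ disc) (h0 : flatSine z ≠ 0) : ContinuousAt angle z :=
  ContinuousAt.comp (g := phase) (contDiffAt_phase h0).continuousAt
    (hasDerivAt_flatSine_disc z hz).continuousAt

/-- The squared length of dΦ(v) is a positive multiple of |(h'/h)v|² where h ≠ 0, so dΦ there is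
injective or zero according to whether h' ≠ 0. Both h and h' have isolated zeros. -/
lemma isSmoothBranchedImmersionAwayFrom_coneMap {j : ℕ} (hj : 1 ≤ j) :
    IsSmoothBranchedImmersionAwayFrom (coneMap j) (fun z => conj (angle z)) zeroSet where
  isolated z hz := by
    have hzh := disc_subset_halfPlane hz
    have hd : ∀ᶠ w in 𝓝[≠] z, w ∈ disc :=
      nhdsWithin_le_nhds (Metric.isOpen_ball.mem_nhds hz)
    filter_upwards [flatSine_eventually_ne hzh, flatSineDeriv_eventually_ne hzh, hd]
      with w h1 h2 h3 h4
    have h5 := norm_sq_fderiv_coneMap hj h3 h1 1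
    have hpos : 0 < coneDegree j := (Nat.cast_nonneg j).trans_lt (coneDegree_gt hj)
    have h6 : 0 < ‖flatSine w‖ := norm_pos_iff.2 h1
    have h7 : 0 < ‖flatSineLogDeriv w * 1‖ := by
      rw [mul_one]; exact norm_pos_iff.2 (div_ne_zero h2 h1)
    have h8 : 0 < (2 * j + 1) * coneDegree j ^ 2 *
      (‖flatSine w‖ ^ coneDegree j) ^ 2 * ‖flatSineLogDeriv w * 1‖ ^ 2 := by positivity
    rw [← h5, h4] at h8
    simp at h8
  smooth z hz := by
    have h0 : flatSine z ≠ 0 := fun h => hz.2 ⟨hz.1, h⟩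
    have h1 : ContDiffAt ℝ ∞ flatSine z :=
      (contDiffOn_of_holomorphic hasDerivAt_flatSine_disc).contDiffAt
        (Metric.isOpen_ball.mem_nhds hz.1)
    exact (((cone_isHomogeneous hj).smooth _ h0).comp z h1).contDiffWithinAt
  immersion_or_branch z hz := by
    have h0 : flatSine z ≠ 0 := fun h => hz.2 ⟨hz.1, h⟩
    by_cases hD : flatSineDeriv z = 0
    · right
      refine ⟨((contDiffOn_coneMap hj).differentiableOn one_ne_zero).differentiableAt
        (Metric.isOpen_ball.mem_nhds hz.1), ?_, ?_⟩
      · ext1 v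
        rw [fderiv_coneMap hj hz.1, hD, zero_mul, map_zero]
        rfl
      · exact Complex.continuous_conj.continuousAt.comp (continuousAt_angle hz.1 h0)
    · left
      rw [injective_iff_map_eq_zero]
      intro v hv
      have h5 := norm_sq_fderiv_coneMap hj hz.1 h0 v
      rw [hv, norm_zero] at h5
      have hpos : 0 < coneDegree j := (Nat.cast_nonneg j).trans_lt (coneDegree_gt hj)
      have h6 : 0 < ‖flatSine z‖ := norm_pos_iff.2 h0
      have h7 : 0 < (2 * j + 1) * coneDegree j ^ 2 * (‖flatSine z‖ ^ coneDegree j) ^ 2 := by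
        positivity
      have h8 : ‖flatSineLogDeriv z * v‖ ^ 2 = 0 := by
        rcases mul_eq_zero.1 (h5.symm.trans (by norm_num)) with h | h
        · exact absurd h h7.ne'
        · exact h
      have h9 : flatSineLogDeriv z * v = 0 := by simpa using h8
      exact (mul_eq_zero.1 h9).resolve_left (div_ne_zero hD h0)

end HamStat

end

theorem theorem1 (p : ℝ≥0∞) (hp : p < 2) (j : ℕ) (hj : 1 ≤ j) :
    ∃ (Φ : ℂ → HamStat.C2) (g : ℂ → ℂ) (S : Set ℂ),
      HamStat.IsWeaklyConformal Φ ∧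
      HamStat.IsLagrangian Φ ∧
      HamStat.IsHamiltonianStationary Φ ∧
      HamStat.MemHolder (Real.sqrt ((j : ℝ) ^ 2 + j)) Φ ∧
      -- the Lagrangian angle of `Φ` is the complex conjugate of `g`
      HamStat.IsLagrangianAngle Φ (fun z => conj (g z)) ∧
      -- infinitely many isolated singularities, accumulating at `-1` (and nowhere else)
      S ⊆ HamStat.disc ∧ S.Infinite ∧
      (∀ z ∈ S, ∀ᶠ w in 𝓝[≠] z, w ∉ S) ∧
      derivedSet S = {(-1 : ℂ)} ∧
      (∀ z ∈ S, HamStat.IsSchoenWolfsonSingularity j Φ g z) ∧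
      -- continuous up to the boundary, with smooth trace
      ContinuousOn Φ (Metric.closedBall (0 : ℂ) 1) ∧
      ContDiff ℝ ∞ (fun θ : ℝ => Φ (Complex.exp (θ * Complex.I))) ∧
      -- regularity of the Lagrangian angle
      HamStat.MemW1 p g ∧ HamStat.MemW1WeakL2Loc g ∧
      -- smooth branched immersion away from the singularities
      HamStat.IsSmoothBranchedImmersionAwayFrom Φ (fun z => conj (g z)) S := by
  refine ⟨HamStat.coneMap j, HamStat.angle, HamStat.zeroSet,
    HamStat.isWeaklyConformal_coneMap hj, HamStat.isLagrangian_coneMap hj,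
    ⟨HamStat.isLagrangian_coneMap hj, HamStat.angle, HamStat.isLagrangianAngle_coneMap hj,
      HamStat.isCircleHarmonic_angle⟩,
    HamStat.memHolder_coneMap hj, HamStat.isLagrangianAngle_coneMap hj, HamStat.zeroSet_subset,
    HamStat.zeroSet_infinite,
    fun z hz => HamStat.zeroSet_isolated (HamStat.disc_subset_halfPlane hz.1),
    HamStat.derivedSet_zeroSet, fun z hz => HamStat.isSchoenWolfsonSingularity_coneMap hj hz,
    (HamStat.continuous_cone hj).comp_continuousOn HamStat.continuousOn_flatSine,
    HamStat.contDiff_trace hj, HamStat.memW1_angle hp, HamStat.memW1WeakL2Loc_angle,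
    HamStat.isSmoothBranchedImmersionAwayFrom_coneMap hj⟩
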